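/- Let $p>2$ be a prime, $G=\mathrm{GL}_2(\mathbf F_p)$, and let $Z\subset G$ be the subgroup of scalar matrices, so that $\mathrm{PGL}_2(\mathbf F_p)=G/Z$. Let $B$, $T$ and $U$ be the subgroups of $G$ of upper triangular matrices, of diagonal matrices, and of matrices $\begin{pmatrix}1&x\\0&1\end{pmatrix}$, respectively. For a non-square $u\in\mathbf F_p$ let $T'=\left\{\begin{pmatrix}a&bu\\b&a\end{pmatrix}\in G : a,b\in\mathbf F_p\right\}$. Let $N$ and $N'$ be the normalizers of $T$ and $T'$ in $G$. The groups $T/Z$ and $T'/Z$ are cyclic of even order; a character of one of them is called even if it is $1$ on the element of order $2$, and odd otherwise. Consider the following complex representations of $\mathrm{PGL}_2(\mathbf F_p)$. - The Steinberg representation $V_{\rm st}$ is the space of functions $\phi:\mathbf P_1(\mathbf F_p)\to\mathbf C$ modulo the constant functions, with action $(\sigma\phi)(P)=\phi(\sigma^{-1}P)$. - $V_\omega=V_{\rm st}\otimes\omega$, where $\omega(g)=\left(\frac{\det g}{p}\right)$ is the quadratic character. - For a character $\mu:B/Z\to\mathbf C^*$ with $\mu^2\neq1$, $V_\mu=\mathrm{Ind}_{B/Z}^{\mathrm{PGL}_2(\mathbf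 F_p)}\mu$ is the principal series representation; $\mu$ is called even or odd according to its restriction to $T/Z$. - For a character $\theta:T'/Z\to\mathbf C^*$ with $\theta^2\neq1$, $V_\theta$ is the cuspidal representation attached to $\theta$, i.e. the representation, unique up to isomorphism, with $V_\theta\oplus\mathrm{Ind}_{T'/Z}^{\mathrm{PGL}_2(\mathbf F_p)}\theta\cong\mathrm{Ind}_{U}^{\mathrm{PGL}_2(\mathbf F_p)}\psi$, where $\psi\begin{pmatrix}1&x\\0&1\end{pmatrix}=e^{2\pi i x/p}$. **Proposition.** Let $V$ be an irreducible complex representation of $\mathrm{PGL}_2(\mathbf F_p)$ that is not $1$-dimensional. If $V\cong V_{\rm st}$, then $$\dim V^T=2,\qquad \dim V^N=1,\qquad \dim V^{T'}=\dim V^{N'}=0.$$ In all other cases $$\dim V^T=\dim V^{T'}=1\qquad\text{and}\qquad \dim V^N=\dim V^{N'}\le 1 .$$ Moreover, in these cases $\dim V^N=\dim V^{N'}=1$ if and only if one of the following holds: $V\cong V_\mu$ for some even $\mu$ with $\mu^2\neq1$; $V\cong V_\theta$ for some odd $\theta$ with $\theta^2\neq1$; or $V\cong V_\omega$ and $p\equiv1\pmod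 4$. -/

import Mathlib

open scoped LinearAlgebra.Projectivization

noncomputable section

namespace CartanInvariants

/-! ### Subgroups of `GL₂(𝔽_p)` -/

section Groups

variable (p : ℕ) [Fact p.Prime]

/-- The group `GL₂(𝔽_p)`. -/
abbrev GLp : Type := GL (Fin 2) (ZMod p)

/-- The group `PGL₂(𝔽_p) = GL₂(𝔽_p) / Z`, where `Z` is the group of scalar matrices. -/
abbrev PGLp : Type := Matrix.ProjGenLinGroup (Fin 2) (ZMod p)

variable {p} in
lemma coe_inv_eq (g : GLp p) :
    ((g⁻¹ : GLp p) : Matrix (Fin 2) (Fin 2) (ZMod p)) =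
      (Ring.inverse (g : Matrix (Fin 2) (Fin 2) (ZMod p)).det) •
        !![g 1 1, -g 0 1; -g 1 0, g 0 0] := by
  rw [Matrix.coe_units_inv, Matrix.inv_def, Matrix.adjugate_fin_two]

/-- The Borel subgroup `B` of upper triangular matrices. -/
def borel : Subgroup (GLp p) where
  carrier := {g | g 1 0 = 0}
  one_mem' := by simp
  mul_mem' := by
    intro g h hg hh
    simp only [Set.mem_ofPred_eq] at hg hh ⊢
    simp [Matrix.mul_apply, Fin.sum_univ_two, hg, hh]
  inv_mem' := by
    intro g hg
    simp only [Set.mem_ofPred_eq] at hg ⊢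
    rw [coe_inv_eq]
    simp [hg]

/-- The split Cartan subgroup `T` of diagonal matrices. -/
def splitCartan : Subgroup (GLp p) where
  carrier := {g | g 0 1 = 0 ∧ g 1 0 = 0}
  one_mem' := by simp
  mul_mem' := by
    rintro g h ⟨hg, hg'⟩ ⟨hh, hh'⟩
    constructor <;> simp [Matrix.mul_apply, Fin.sum_univ_two, hg, hg', hh, hh']
  inv_mem' := by
    rintro g ⟨hg, hg'⟩
    simp only [Set.mem_ofPred_eq]
    rw [coe_inv_eq]
    simp [hg, hg']

variable {p} in
/-- The subgroup `T'` of invertible matrices of the form `!![a, b * u; b, a]`.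
It is a non-split Cartan subgroup when `u` is a non-square. -/
def nonsplitCartan (u : ZMod p) : Subgroup (GLp p) where
  carrier := {g | ∃ a b : ZMod p,
    (g : Matrix (Fin 2) (Fin 2) (ZMod p)) = !![a, b * u; b, a]}
  one_mem' := ⟨1, 0, by simp [Matrix.one_fin_two]⟩
  mul_mem' := by
    rintro g h ⟨a, b, hg⟩ ⟨c, d, hh⟩
    refine ⟨a * c + b * u * d, b * c + a * d, ?_⟩
    rw [Matrix.GeneralLinearGroup.coe_mul, hg, hh, Matrix.mul_fin_two]
    congr 1
    ext i j
    fin_cases i <;> fin_cases j <;> simp <;> ring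
  inv_mem' := by
    rintro g ⟨a, b, hg⟩
    set r := Ring.inverse (g : Matrix (Fin 2) (Fin 2) (ZMod p)).det with hr
    refine ⟨r * a, -(r * b), ?_⟩
    rw [coe_inv_eq, ← hr, hg]
    ext i j
    fin_cases i <;> fin_cases j <;> simp
    ring

/-- The normalizer `N` of `T` in `GL₂(𝔽_p)`. -/
def splitNormalizer : Subgroup (GLp p) :=
  Subgroup.normalizer (splitCartan p : Set (GLp p))

variable {p} in
/-- The normalizer `N'` of `T'` in `GL₂(𝔽_p)`. -/
def nonsplitNormalizer (u : ZMod p) : Subgroup (GLp p) :=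
  Subgroup.normalizer (nonsplitCartan u : Set (GLp p))

variable {p} in
/-- The image `H/Z` in `PGL₂(𝔽_p)` of a subgroup `H` of `GL₂(𝔽_p)` containing `Z`. -/
abbrev modZ (H : Subgroup (GLp p)) : Subgroup (PGLp p) :=
  H.map Matrix.ProjGenLinGroup.mk

lemma splitCartan_le_borel : splitCartan p ≤ borel p := fun _ hg => hg.2

end Groups

/-! ### Generalities on representations -/

section Reps

/-- The one-dimensional representation on `ℂ` given by a character. -/
def charRep {H : Type*} [Group H] (χ : H →* ℂˣ) : Representation ℂ H ℂ where
  toFun h := (χ h : ℂ) • LinearMap.id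
  map_one' := by ext; simp
  map_mul' g h := by
    ext
    simp [mul_comm]

/-- The twist `V ⊗ χ` of a representation by a character, realised on `V`. -/
def twist {G V : Type*} [Group G] [AddCommGroup V] [Module ℂ V] (χ : G →* ℂˣ)
    (ρ : Representation ℂ G V) : Representation ℂ G V where
  toFun g := (χ g : ℂ) • ρ g
  map_one' := by simp
  map_mul' g h := by
    ext v
    simp [mul_smul, smul_comm (χ g : ℂ) (χ h : ℂ)]

/-- The action `(σ φ)(P) = φ (σ⁻¹ P)` on the complex functions on a `G`-set. -/
def functionRep (G X : Type*) [Group G] [MulAction G X] : Representation ℂ G (X → ℂ) where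
  toFun g := LinearMap.funLeft ℂ ℂ fun x => g⁻¹ • x
  map_one' := by ext; simp
  map_mul' g h := by ext; simp [mul_smul]

/-- The constant functions on `X`. -/
def constants (X : Type*) : Submodule ℂ (X → ℂ) :=
  Submodule.span ℂ {fun _ => 1}

lemma constants_le_comap (G X : Type*) [Group G] [MulAction G X] (g : G) :
    constants X ≤ (constants X).comap (functionRep G X g) := by
  refine Submodule.span_le.2 ?_
  rintro _ rfl
  exact Submodule.subset_span rfl

/-- A character of a cyclic group of even order is even if it is `1` on the
element of order `2`, and odd otherwise. -/
def IsEvenChar {C : Type*} [Group C] (χ : C →* ℂˣ) : Prop :=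
  ∀ c : C, orderOf c = 2 → χ c = 1

end Reps

/-! ### Representations of `PGL₂(𝔽_p)` -/

section PGLReps

variable (p : ℕ) [Fact p.Prime]

/-- For a representation `V` of `PGL₂(𝔽_p)` and a subgroup `H` of `GL₂(𝔽_p)`,
the subspace `V^H` of `H`-invariants. -/
def fixedSpace {p : ℕ} [Fact p.Prime] {V : Type*} [AddCommGroup V] [Module ℂ V]
    (ρ : Representation ℂ (PGLp p) V) (H : Subgroup (GLp p)) : Submodule ℂ V :=
  Representation.invariants (ρ.comp (Matrix.ProjGenLinGroup.mk.comp H.subtype))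

/-- The Steinberg representation: functions on `ℙ¹(𝔽_p)` modulo constants. -/
def steinberg : Representation ℂ (PGLp p)
    ((ℙ (ZMod p) (Fin 2 → ZMod p) → ℂ) ⧸ constants (ℙ (ZMod p) (Fin 2 → ZMod p))) :=
  (functionRep (PGLp p) (ℙ (ZMod p) (Fin 2 → ZMod p))).quotient _
    (constants_le_comap _ _)

/-- The quadratic character `g ↦ (det g / p)` of `GL₂(𝔽_p)`. -/
def omegaGL : GLp p →* ℂˣ :=
  ((Units.map (Int.castRingHom ℂ).toMonoidHom).comp (quadraticChar (ZMod p)).toUnitHom).comp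
    Matrix.GeneralLinearGroup.det

lemma omegaGL_scalar :
    (omegaGL p).comp (Matrix.GeneralLinearGroup.scalar (Fin 2)) = 1 := by
  ext r
  simp only [omegaGL, MonoidHom.comp_apply, MonoidHom.one_apply, Units.coe_map,
    MulChar.coe_toUnitHom]
  have : ((Matrix.GeneralLinearGroup.det
      (Matrix.GeneralLinearGroup.scalar (Fin 2) r) : (ZMod p)ˣ) : ZMod p) = (r : ZMod p) ^ 2 := by
    simp [sq]
  rw [this, quadraticChar_sq_one' r.ne_zero]
  simp

/-- The quadratic character `ω` of `PGL₂(𝔽_p)`. -/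
def omega : PGLp p →* ℂˣ :=
  Matrix.ProjGenLinGroup.lift (omegaGL p) (omegaGL_scalar p)

/-- The twisted Steinberg representation `V_ω`. -/
def twistedSteinberg : Representation ℂ (PGLp p)
    ((ℙ (ZMod p) (Fin 2 → ZMod p) → ℂ) ⧸ constants (ℙ (ZMod p) (Fin 2 → ZMod p))) :=
  twist (omega p) (steinberg p)

/-- The restriction to `T/Z` of a character of `B/Z`. -/
def restrictToTorus {p : ℕ} [Fact p.Prime] (μ : modZ (borel p) →* ℂˣ) :
    modZ (splitCartan p) →* ℂˣ :=
  μ.comp (Subgroup.inclusion (Subgroup.map_mono (splitCartan_le_borel p)))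

/-- The representation `V_μ` of `PGL₂(𝔽_p)` induced from the character `μ` of `B/Z`. It is a
principal series representation when `μ² ≠ 1`. -/
def principalSeries {p : ℕ} [Fact p.Prime] (μ : modZ (borel p) →* ℂˣ) :
    Representation ℂ (PGLp p)
      (Representation.IndV (modZ (borel p)).subtype (charRep μ)) :=
  Representation.ind (modZ (borel p)).subtype (charRep μ)

/-- The embedding `x ↦ !![1, x; 0, 1]` of the unipotent group `U ≅ 𝔽_p` in `PGL₂(𝔽_p)`. -/
def unipotentHom : Multiplicative (ZMod p) →* PGLp p :=
  Matrix.ProjGenLinGroup.mk.comp Matrix.GeneralLinearGroup.upperRightHom.toMonoidHom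

/-- The nontrivial character `x ↦ exp (2πi x / p)` of `U ≅ 𝔽_p`. -/
def psi : Multiplicative (ZMod p) →* ℂˣ :=
  (ZMod.stdAddChar (N := p)).toMonoidHom.toHomUnits

/-- The representation `ρ` of `PGL₂(𝔽_p)` is (isomorphic to) the representation `V_θ` attached to
the character `θ` of `T'/Z`. Here `V_θ` is the virtual representation
`Ind_U ψ - Ind_{T'/Z} θ`, with `ψ` a nontrivial character of `U`; when `u` is a non-square and
`θ² ≠ 1`, it is an irreducible representation of dimension `p - 1`. As complex representations of
a finite group can be cancelled in direct sums, `V ≅ V_θ` means that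
`V ⊕ Ind_{T'/Z} θ ≅ Ind_U ψ`. -/
def IsCuspidalFor {p : ℕ} [Fact p.Prime] {u : ZMod p} (θ : modZ (nonsplitCartan u) →* ℂˣ)
    {V : Type*} [AddCommGroup V] [Module ℂ V] (ρ : Representation ℂ (PGLp p) V) : Prop :=
  Nonempty ((ρ.prod (Representation.ind (modZ (nonsplitCartan u)).subtype (charRep θ))).Equiv
    (Representation.ind (unipotentHom p) (charRep (psi p))))

end PGLReps

end CartanInvariants

end

open scoped LinearAlgebra.Projectivization
noncomputable section
namespace CartanInvariants

/-! ### Semisimple modules are determined by their maps to simple modules -/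

section Semisimple

universe u v

variable {k R : Type*} [Field k] [Ring R] [Algebra k R]

/-! The dimension of `V^H` is the average over `H` of the character of `V`, so every linear relation
between averages of class functions over subgroups is a relation between dimensions. Sorting two by
two matrices by conjugacy type yields the relations that matter. `avgOn_borel` says that the
averages over `B` and `T` differ by `(f(n) - f(1)) / p`, with `n` a nontrivial unipotent.
`two_mul_avgOn_top` says `2 avg_G = 2 avg_B - avg_T + avg_T'`. In `four_mul_avgOn_splitNormalizer`
and `four_mul_avgOn_nonsplitNormalizer` the nontrivial cosets of `T` in `N` and of `T'` in `N'`
contribute the same term.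

For a character, `f(1) - f(n)` is `p` times the multiplicity of `ψ` in the restriction to `U`. This
multiplicity is one when `V` is irreducible of dimension other than one (`finrank_whittaker_eq_one`:
uniqueness of the Whittaker model, by commuting Bessel operators). Hence `dim V^T = 1 + dim V^B` and
`dim V^T' + dim V^B = 1`. Since `V^B` is nonzero exactly for the Steinberg representation
(`nonempty_equiv_steinberg_iff`), everything except the final criterion follows by arithmetic.

The criterion depends on `V^U`. If `V^U` is nonzero, it contains a `B`-eigenvector `v` with some
character `χ(a / d)`. When `χ` is nontrivial, `∑ χ⁻¹(x) n_x v`, with `n_x` running over the big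
cell, is a `T`-invariant vector: its `ψ`-component is a Gauss sum times a Whittaker vector, hence
nonzero. The antidiagonal involution acts on it by `χ(-1)`, so parity decides. Here `χ² ≠ 1` gives a
principal series, and quadratic `χ` the twisted Steinberg representation.

If `V^U = 0`, then `dim V = p - 1` and the character vanishes on nonscalar split elements. The norm
of its restriction to `T'/Z`, a group of order `p + 1`, then equals `p - 1`. So the restriction is
multiplicity free and omits exactly two characters, `θ` and `θ⁻¹`. The value at the involution of
`T'/Z` is `-2θ`, which gives `dim V^N = (1 - θ) / 2` with `θ` evaluated there. The same computation
against any `W` gives `dim Hom(V, W) + m_θ(W) = m_ψ(W)`; as representations are determined by such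
dimensions, this is the isomorphism defining `V_θ`. -/

lemma finite_linearMap_restrictScalars (A T : Type*) [AddCommGroup A] [Module k A] [Module R A]
    [IsScalarTower k R A] [Module.Finite k A] [AddCommGroup T] [Module k T] [Module R T]
    [IsScalarTower k R T] [Module.Finite k T] : Module.Finite k (A →ₗ[R] T) :=
  Module.Finite.of_injective (LinearMap.restrictScalarsₗ k R A T k)
    (LinearMap.restrictScalars_injective k)

lemma finrank_linearMap_congr {A B T : Type*} [AddCommGroup A] [Module R A]
    [AddCommGroup B] [Module R B]
    [AddCommGroup T] [Module k T] [Module R T] [IsScalarTower k R T] (e : A ≃ₗ[R] B) :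
    Module.finrank k (A →ₗ[R] T) = Module.finrank k (B →ₗ[R] T) :=
  (LinearEquiv.congrLeft T k e).finrank_eq

lemma finrank_linearMap_prod {A B T : Type*} [AddCommGroup A] [Module k A] [Module R A]
    [IsScalarTower k R A] [Module.Finite k A] [AddCommGroup B] [Module k B] [Module R B]
    [IsScalarTower k R B] [Module.Finite k B]
    [AddCommGroup T] [Module k T] [Module R T] [IsScalarTower k R T] [Module.Finite k T] :
    Module.finrank k (A × B →ₗ[R] T) =
      Module.finrank k (A →ₗ[R] T) + Module.finrank k (B →ₗ[R] T) := by
  have := finite_linearMap_restrictScalars (k := k) (R := R) A T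
  have := finite_linearMap_restrictScalars (k := k) (R := R) B T
  rw [← Module.finrank_prod, (LinearMap.coprodEquiv k).finrank_eq]

lemma finrank_linearMap_pos {A T : Type*} [AddCommGroup A] [Module k A] [Module R A]
    [IsScalarTower k R A] [Module.Finite k A] [AddCommGroup T] [Module k T] [Module R T]
    [IsScalarTower k R T] [Module.Finite k T] (f : A →ₗ[R] T) (hf : f ≠ 0) :
    0 < Module.finrank k (A →ₗ[R] T) := by
  have := finite_linearMap_restrictScalars (k := k) (R := R) A T
  have : Nontrivial (A →ₗ[R] T) := ⟨f, 0, hf⟩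
  exact Module.finrank_pos

/-- A simple submodule of `A` also receives a nonzero map from `B`, so it can be split off both
modules, and induction on dimension applies to what remains. The test modules are quantified twice
because `A` and `B` live in different universes; a simple submodule of `B` is needed as a test only
when `A` is zero. -/
theorem nonempty_linearEquiv_of_finrank_eq [IsSemisimpleRing R]
    {A : Type u} {B : Type v} [AddCommGroup A] [Module k A] [Module R A]
    [IsScalarTower k R A] [Module.Finite k A] [AddCommGroup B] [Module k B] [Module R B]
    [IsScalarTower k R B] [Module.Finite k B]
    (hA : ∀ (T : Type u) [AddCommGroup T] [Module k T] [Module R T] [IsScalarTower k R T]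
      [Module.Finite k T] [IsSimpleModule R T],
      Module.finrank k (A →ₗ[R] T) = Module.finrank k (B →ₗ[R] T))
    (hB : ∀ (T : Type v) [AddCommGroup T] [Module k T] [Module R T] [IsScalarTower k R T]
      [Module.Finite k T] [IsSimpleModule R T],
      Module.finrank k (A →ₗ[R] T) = Module.finrank k (B →ₗ[R] T)) :
    Nonempty (A ≃ₗ[R] B) := by
  induction hn : Module.finrank k A using Nat.strong_induction_on generalizing A B with
  | _ n ih =>
  rcases subsingleton_or_nontrivial A with h | h
  · rcases subsingleton_or_nontrivial B with h' | h'
    · exact ⟨0⟩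
    · exfalso
      obtain ⟨S, hS⟩ := IsSemisimpleModule.exists_simple_submodule R B
      obtain ⟨q, hq⟩ := exists_isCompl S
      have : Module.Finite k S := Module.Finite.of_injective (S.subtype.restrictScalars k)
        S.injective_subtype
      have h1 := hB S
      have h2 := finrank_linearMap_pos (k := k) (S.projectionOnto q hq) (by
        have := IsSimpleModule.nontrivial R S
        obtain ⟨x, hx⟩ := exists_ne (0 : S)
        intro h0
        apply hx
        rw [← Submodule.projectionOnto_apply_left hq x, h0]; rfl)
      have h3 : Subsingleton (A →ₗ[R] S) := ⟨fun f g => by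
        ext x; rw [Subsingleton.elim x 0]; simp⟩
      rw [← h1, Module.finrank_zero_of_subsingleton] at h2
      exact lt_irrefl _ h2
  · obtain ⟨S, hS⟩ := IsSemisimpleModule.exists_simple_submodule R A
    obtain ⟨q, hq⟩ := exists_isCompl S
    have : Module.Finite k S := Module.Finite.of_injective (S.subtype.restrictScalars k)
      S.injective_subtype
    have : Module.Finite k q := Module.Finite.of_injective (q.subtype.restrictScalars k)
      q.injective_subtype
    have : Nontrivial S := IsSimpleModule.nontrivial R S
    have h2 := finrank_linearMap_pos (k := k) (S.projectionOnto q hq) (by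
        obtain ⟨x, hx⟩ := exists_ne (0 : S)
        intro h0
        apply hx
        rw [← Submodule.projectionOnto_apply_left hq x, h0]; rfl)
    rw [hA S] at h2
    have : Nontrivial (B →ₗ[R] S) := Module.nontrivial_of_finrank_pos h2
    obtain ⟨g, hg⟩ := exists_ne (0 : B →ₗ[R] S)
    have hgs := LinearMap.surjective_of_ne_zero hg
    -- The complement `C` is a copy of `S` in `B`, so `A` is `S × q` and `B` is `S × ker g`, and the
    -- contribution of `S` cancels.
    obtain ⟨C, hC⟩ := exists_isCompl (LinearMap.ker g)
    let K := LinearMap.ker g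
    have : Module.Finite k K := Module.Finite.of_injective (K.subtype.restrictScalars k)
      K.injective_subtype
    let e1 : (S × q) ≃ₗ[R] A := Submodule.prodEquivOfIsCompl S q hq
    let e2 : (S × K) ≃ₗ[R] B :=
      ((((LinearMap.quotKerEquivOfSurjective g hgs).symm.trans
        (Submodule.quotientEquivOfIsCompl K C hC)).prodCongr (LinearEquiv.refl R K))).trans
        (Submodule.prodEquivOfIsCompl C K hC.symm)
    have hlt : Module.finrank k q < n := by
      have h1 := (e1.restrictScalars k).finrank_eq
      rw [Module.finrank_prod, hn] at h1
      have : 0 < Module.finrank k S := Module.finrank_pos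
      omega
    obtain ⟨e⟩ := ih _ hlt (A := q) (B := K) (fun T => by
        intros
        have := hA T
        rw [← finrank_linearMap_congr e1, ← finrank_linearMap_congr e2, finrank_linearMap_prod,
          finrank_linearMap_prod] at this
        omega) (fun T => by
        intros
        have := hB T
        rw [← finrank_linearMap_congr e1, ← finrank_linearMap_congr e2, finrank_linearMap_prod,
          finrank_linearMap_prod] at this
        omega) rfl
    exact ⟨e1.symm.trans (((LinearEquiv.refl R S).prodCongr e).trans e2)⟩

end Semisimple

/-! ### Representations of finite groups -/

section FiniteGroups

open scoped MonoidAlgebra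
open Representation

universe u v

section Iso

variable {G : Type*} [Group G]

/-- A `ℂ[G]`-module is the module of its associated representation. -/
def asModuleOfModuleEquiv (T : Type*) [AddCommGroup T] [Module ℂ T] [Module ℂ[G] T]
    [IsScalarTower ℂ ℂ[G] T] :
    T ≃ₗ[ℂ[G]] (Representation.ofModule' (k := ℂ) (G := G) T).asModule where
  toFun := (Representation.ofModule' (k := ℂ) (G := G) T).asModuleEquiv.symm
  invFun := (Representation.ofModule' (k := ℂ) (G := G) T).asModuleEquiv
  left_inv x := rfl
  right_inv x := rfl
  map_add' x y := rfl
  map_smul' m x := by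
    induction m using MonoidAlgebra.induction_linear with
    | zero => simp
    | add a b ha hb => simp only [add_smul, map_add, ha, hb, RingHom.id_apply]
    | single g a =>
      simp only [RingHom.id_apply, Representation.single_smul]
      change (MonoidAlgebra.single g a : ℂ[G]) • x = a • ((MonoidAlgebra.single g (1 : ℂ)) • x)
      rw [← smul_assoc]
      simp

lemma finrank_linearMap_asModule {C T : Type*} [AddCommGroup C] [Module ℂ C]
    (γ : Representation ℂ G C) [AddCommGroup T] [Module ℂ T] [Module ℂ[G] T]
    [IsScalarTower ℂ ℂ[G] T] :
    Module.finrank ℂ (γ.asModule →ₗ[ℂ[G]] T) =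
      Module.finrank ℂ (IntertwiningMap γ (Representation.ofModule' (k := ℂ) (G := G) T)) := by
  rw [(IntertwiningMap.equivLinearMapAsModule γ
    (Representation.ofModule' (k := ℂ) (G := G) T)).finrank_eq]
  let e := asModuleOfModuleEquiv (G := G) T
  exact LinearEquiv.finrank_eq
    { toFun := fun f => e.toLinearMap.comp f
      invFun := fun f => e.symm.toLinearMap.comp f
      left_inv := fun f => by ext; simp
      right_inv := fun f => by ext; simp
      map_add' := fun f g => by ext; simp
      map_smul' := fun c f => by
        ext x
        exact (asModuleOfModuleEquiv (G := G) T).toLinearMap.map_smul_of_tower c (f x) }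

theorem nonempty_equiv_of_finrank_eq [Finite G] {A : Type u} {B : Type v}
    [AddCommGroup A] [Module ℂ A] [FiniteDimensional ℂ A]
    [AddCommGroup B] [Module ℂ B] [FiniteDimensional ℂ B]
    (α : Representation ℂ G A) (β : Representation ℂ G B)
    (hA : ∀ (T : Type u) [AddCommGroup T] [Module ℂ T] [FiniteDimensional ℂ T]
      (τ : Representation ℂ G T), τ.IsIrreducible →
      Module.finrank ℂ (IntertwiningMap α τ) = Module.finrank ℂ (IntertwiningMap β τ))
    (hB : ∀ (T : Type v) [AddCommGroup T] [Module ℂ T] [FiniteDimensional ℂ T]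
      (τ : Representation ℂ G T), τ.IsIrreducible →
      Module.finrank ℂ (IntertwiningMap α τ) = Module.finrank ℂ (IntertwiningMap β τ)) :
    Nonempty (α.Equiv β) := by
  -- The hypothesis of Maschke's theorem, which makes the group algebra semisimple.
  have : NeZero (Nat.card G : ℂ) := ⟨by exact_mod_cast Nat.card_pos.ne'⟩
  have key := nonempty_linearEquiv_of_finrank_eq (k := ℂ) (R := ℂ[G]) (A := α.asModule)
    (B := β.asModule) (fun T => by
      intros
      rw [finrank_linearMap_asModule, finrank_linearMap_asModule]
      refine hA T _ ((irreducible_iff_isSimpleModule_asModule _).2 ?_)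
      exact IsSimpleModule.congr (asModuleOfModuleEquiv (G := G) T).symm) (fun T => by
      intros
      rw [finrank_linearMap_asModule, finrank_linearMap_asModule]
      refine hB T _ ((irreducible_iff_isSimpleModule_asModule _).2 ?_)
      exact IsSimpleModule.congr (asModuleOfModuleEquiv (G := G) T).symm)
  obtain ⟨e⟩ := key
  let f : IntertwiningMap α β := (IntertwiningMap.equivLinearMapAsModule α β).symm e.toLinearMap
  exact ⟨f.ofBijective e.bijective⟩

end Iso

end FiniteGroups

open Representation

/-! ### Averages over finite groups -/

section Average

/-- The average of a complex function on a finite group. -/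
def avg (G : Type*) [Group G] [Finite G] (f : G → ℂ) : ℂ :=
  haveI := Fintype.ofFinite G
  (Nat.card G : ℂ)⁻¹ * ∑ g : G, f g

lemma avg_eq (G : Type*) [Group G] [Fintype G] (f : G → ℂ) :
    avg G f = (Nat.card G : ℂ)⁻¹ * ∑ g : G, f g := by
  unfold avg
  congr!

lemma card_mul_avg (G : Type*) [Group G] [Fintype G] (f : G → ℂ) :
    (Nat.card G : ℂ) * avg G f = ∑ g : G, f g := by
  rw [avg_eq, mul_inv_cancel_left₀]
  exact_mod_cast Nat.card_pos.ne'

/-- All fibres of a surjective homomorphism have the size of its kernel. This moves averages between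
subgroups of `GL₂` and their images in `PGL₂`. -/
lemma avg_comp {G H : Type*} [Group G] [Finite G] [Group H] [Finite H] (φ : G →* H)
    (hφ : Function.Surjective φ) (f : H → ℂ) : avg G (fun g => f (φ g)) = avg H f := by
  classical
  have := Fintype.ofFinite G
  have := Fintype.ofFinite H
  have key : ∀ (f : H → ℂ), ∑ g : G, f (φ g) = (Nat.card φ.ker : ℂ) * ∑ h : H, f h := by
    intro f
    rw [← Finset.sum_fiberwise (s := Finset.univ) (g := φ), Finset.mul_sum]
    refine Finset.sum_congr rfl fun h _ => ?_
    rw [Finset.sum_congr rfl (g := fun _ => f h) (by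
      intro g hg; rw [(Finset.mem_filter.1 hg).2]), Finset.sum_const, nsmul_eq_mul]
    congr 2
    rw [MonoidHom.card_fiber_eq_of_mem_range φ (hφ h) (hφ 1), Nat.card_eq_fintype_card,
      Fintype.card_subtype]
    congr! with x
  -- The constant function gives `|G| = |ker φ| |H|`.
  have hk := key 1
  simp only [Pi.one_apply, Finset.sum_const, nsmul_eq_mul, mul_one, Finset.card_univ] at hk
  rw [avg_eq, avg_eq, key, Nat.card_eq_fintype_card, Nat.card_eq_fintype_card (α := H), hk]
  have h1 : (Nat.card φ.ker : ℂ) ≠ 0 := by exact_mod_cast Nat.card_pos.ne'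
  field_simp

lemma avg_add (G : Type*) [Group G] [Finite G] (f g : G → ℂ) :
    avg G (fun x => f x + g x) = avg G f + avg G g := by
  have := Fintype.ofFinite G
  simp only [avg_eq, Finset.sum_add_distrib, mul_add]

lemma avg_inv (G : Type*) [Group G] [Finite G] (f : G → ℂ) :
    avg G (fun x => f x⁻¹) = avg G f := by
  have := Fintype.ofFinite G
  rw [avg_eq, avg_eq, ← Equiv.sum_comp (Equiv.inv G) f]
  rfl

end Average

/-! ### Eigenspaces of characters and Frobenius reciprocity -/

section Eigenspaces

variable {G H V : Type*} [Group G] [Group H] [AddCommGroup V] [Module ℂ V]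

theorem finrank_invariants_eq_avg [Finite G] [FiniteDimensional ℂ V] (ρ : Representation ℂ G V) :
    (Module.finrank ℂ ρ.invariants : ℂ) = avg G ρ.character := by
  have := Fintype.ofFinite G
  have : Invertible (Nat.card G : ℂ) :=
    invertibleOfNonzero (by exact_mod_cast Nat.card_pos.ne')
  rw [← card_inv_mul_sum_char_eq_finrank, avg_eq]

theorem finrank_intertwiningMap_eq_avg [Finite G] [FiniteDimensional ℂ V] {W : Type*}
    [AddCommGroup W] [Module ℂ W] [FiniteDimensional ℂ W] (ρ : Representation ℂ G V)
    (σ : Representation ℂ G W) :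
    (Module.finrank ℂ (IntertwiningMap ρ σ) : ℂ) =
      avg G (fun g => ρ.character g⁻¹ * σ.character g) := by
  have := Fintype.ofFinite G
  have : Invertible (Nat.card G : ℂ) :=
    invertibleOfNonzero (by exact_mod_cast Nat.card_pos.ne')
  rw [← card_inv_mul_sum_char_mul_char_eq_finrank, avg_eq]
  simp only [mul_comm]

/-- The subspace on which `H` acts through `φ : H → G` by the character `η`. -/
def eigenspace (φ : H →* G) (η : H →* ℂˣ) (ρ : Representation ℂ G V) : Submodule ℂ V :=
  invariants (twist η⁻¹ (ρ.comp φ))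

lemma mem_eigenspace {φ : H →* G} {η : H →* ℂˣ} {ρ : Representation ℂ G V} {v : V} :
    v ∈ eigenspace φ η ρ ↔ ∀ h, ρ (φ h) v = (η h : ℂ) • v := by
  refine forall_congr' fun h => ?_
  change (((η h)⁻¹ : ℂˣ) : ℂ) • (ρ (φ h) v) = v ↔ _
  constructor
  · intro e
    conv_rhs => rw [← e, smul_smul]
    simp
  · intro e
    rw [e, smul_smul]
    simp

lemma finrank_eigenspace [Finite H] [FiniteDimensional ℂ V] (φ : H →* G) (η : H →* ℂˣ)
    (ρ : Representation ℂ G V) :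
    (Module.finrank ℂ (eigenspace φ η ρ) : ℂ) =
      avg H (fun h => ((η h)⁻¹ : ℂˣ) * ρ.character (φ h)) := by
  rw [eigenspace, finrank_invariants_eq_avg]
  congr 1
  ext h
  change LinearMap.trace ℂ V ((((η h)⁻¹ : ℂˣ) : ℂ) • (ρ (φ h))) = _
  rw [map_smul]; rfl

@[simp] lemma charRep_apply (η : H →* ℂˣ) (h : H) (z : ℂ) : charRep η h z = η h * z := rfl

lemma indV_mk_mul (φ : H →* G) (η : H →* ℂˣ) (h : H) (g : G) (z : ℂ) :
    IndV.mk φ (charRep η) (φ h * g) z = IndV.mk φ (charRep η) g (((η h)⁻¹ : ℂˣ) * z) := by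
  symm
  refine (Coinvariants.mk_eq_iff _).2 ?_
  refine Coinvariants.mem_ker_of_eq h⁻¹ (MonoidAlgebra.single (φ h * g) 1 ⊗ₜ z) _ ?_
  simp

/-- Frobenius reciprocity for characters. -/
def indHomEquiv (φ : H →* G) (η : H →* ℂˣ) (ρ : Representation ℂ G V) :
    IntertwiningMap (ind φ (charRep η)) ρ ≃ₗ[ℂ] eigenspace φ η ρ where
  toFun f := ⟨f (IndV.mk φ (charRep η) 1 1), mem_eigenspace.2 fun h => by
    rw [← IntertwiningMap.isIntertwining, ind_mk, one_mul, ← map_inv,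
      ← mul_one (φ h⁻¹), indV_mk_mul, ← map_smul f, ← map_smul]
    simp⟩
  map_add' f g := rfl
  map_smul' c f := rfl
  invFun v :=
    ⟨Coinvariants.lift _ (TensorProduct.lift <| (Finsupp.lift _ _ _ fun g =>
        ρ g⁻¹ ∘ₗ LinearMap.toSpanSingleton ℂ V v.1) ∘ₗ
      (MonoidAlgebra.coeffLinearEquiv ℂ).toLinearMap) fun h => by
        ext g
        have := mem_eigenspace.1 v.2 h⁻¹
        rw [map_inv φ, map_inv η] at this
        simp [mul_inv_rev, this, smul_smul], fun g => by ext; simp⟩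
  left_inv f := by
    ext g
    simpa using (IntertwiningMap.isIntertwining _ _ f g⁻¹ (IndV.mk φ (charRep η) 1 1)).symm
  right_inv v := by ext; simp

/-- Vectors supported on coset representatives span. The upper bound suffices: a surjection onto a
representation at least as large as the bound is an isomorphism. -/
lemma finrank_ind_le [Finite G] (φ : H →* G) (η : H →* ℂˣ) (S : Finset G)
    (hS : ∀ g : G, ∃ h : H, ∃ s ∈ S, g = φ h * s) :
    Module.finrank ℂ (IndV φ (charRep η)) ≤ S.card := by
  classical
  have key : (⊤ : Submodule ℂ (IndV φ (charRep η))) ≤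
      Submodule.span ℂ (S.image fun s => IndV.mk φ (charRep η) s 1 : Finset _) := by
    rw [← LinearMap.range_eq_top.2 (Coinvariants.mk_surjective
      (Representation.tprod ((leftRegular ℂ G).comp φ) (charRep η)))]
    rintro _ ⟨x, rfl⟩
    induction x using TensorProduct.induction_on with
    | zero => simp
    | add x y hx hy => rw [map_add]; exact Submodule.add_mem _ hx hy
    | tmul x z =>
      induction x using MonoidAlgebra.induction_linear with
      | zero => simp
      | add x y hx hy => rw [TensorProduct.add_tmul, map_add]; exact Submodule.add_mem _ hx hy
      | single g a =>
        obtain ⟨h, s, hs, rfl⟩ := hS g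
        have h1 : Coinvariants.mk (Representation.tprod ((leftRegular ℂ G).comp φ) (charRep η))
            (MonoidAlgebra.single (φ h * s) a ⊗ₜ z) =
            (a * ((((η h)⁻¹ : ℂˣ) : ℂ) * z)) • IndV.mk φ (charRep η) s 1 := by
          have h2 : (MonoidAlgebra.single (φ h * s) a : MonoidAlgebra ℂ G) =
            a • MonoidAlgebra.single (φ h * s) 1 := by simp
          have h3 := indV_mk_mul φ η h s z
          rw [h2, ← TensorProduct.smul_tmul', map_smul]
          change a • IndV.mk φ (charRep η) (φ h * s) z = _
          rw [h3, ← map_smul (IndV.mk φ (charRep η) s), ← map_smul (IndV.mk φ (charRep η) s), smul_eq_mul,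
            smul_eq_mul, mul_one]
        rw [h1]
        exact Submodule.smul_mem _ _ (Submodule.subset_span (by
          rw [Finset.coe_image]; exact ⟨s, hs, rfl⟩))
  calc Module.finrank ℂ (IndV φ (charRep η))
      = Module.finrank ℂ (⊤ : Submodule ℂ (IndV φ (charRep η))) := (finrank_top ℂ _).symm
    _ ≤ _ := Submodule.finrank_mono key
    _ ≤ _ := finrank_span_finset_le_card _
    _ ≤ S.card := Finset.card_image_le

instance finiteDimensional_indV [Finite G] (φ : H →* G) (η : H →* ℂˣ) :
    FiniteDimensional ℂ (IndV φ (charRep η)) :=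
  inferInstance

end Eigenspaces

/-! ### Irreducible representations -/

section Irreducible

variable {G V : Type*} [Group G] [AddCommGroup V] [Module ℂ V] {ρ : Representation ℂ G V}

lemma eq_bot_or_eq_top_of_invariant (hρ : ρ.IsIrreducible) (S : Submodule ℂ V)
    (hS : ∀ g, ∀ v ∈ S, ρ g v ∈ S) : S = ⊥ ∨ S = ⊤ := by
  rcases hρ.eq_bot_or_eq_top ⟨S, fun g v hv => hS g v hv⟩ with h | h
  · exact Or.inl (congrArg Subrepresentation.toSubmodule h)
  · exact Or.inr (congrArg Subrepresentation.toSubmodule h)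

lemma nontrivial_of_isIrreducible (hρ : ρ.IsIrreducible) : Nontrivial V := by
  by_contra h
  rw [not_nontrivial_iff_subsingleton] at h
  obtain ⟨a, b, hab⟩ := hρ.toNontrivial
  exact hab (Subrepresentation.toSubmodule_injective (Subsingleton.elim _ _))

lemma span_orbit_eq_top (hρ : ρ.IsIrreducible) {v : V} (hv : v ≠ 0) :
    Submodule.span ℂ (Set.range fun g => ρ g v) = ⊤ := by
  refine (eq_bot_or_eq_top_of_invariant hρ _ fun g w hw => ?_).resolve_left fun h => hv ?_
  · induction hw using Submodule.span_induction with
    | mem x hx =>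
      obtain ⟨h, rfl⟩ := hx
      exact Submodule.subset_span ⟨g * h, by simp⟩
    | zero => simp
    | add x y _ _ hx hy => rw [map_add]; exact Submodule.add_mem _ hx hy
    | smul a x _ hx => rw [map_smul]; exact Submodule.smul_mem _ _ hx
  · have : v ∈ Submodule.span ℂ (Set.range fun g => ρ g v) :=
      Submodule.subset_span ⟨1, by simp⟩
    rwa [h, Submodule.mem_bot] at this

lemma finiteDimensional_of_isIrreducible [Finite G] (hρ : ρ.IsIrreducible) :
    FiniteDimensional ℂ V := by
  have := nontrivial_of_isIrreducible hρ
  obtain ⟨v, hv⟩ := exists_ne (0 : V)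
  refine Module.finite_def.2 ?_
  rw [← span_orbit_eq_top hρ hv]
  exact Submodule.fg_span (Set.finite_range _)

lemma isIrreducible_of_forall [Nontrivial V]
    (h : ∀ S : Submodule ℂ V, (∀ g, ∀ v ∈ S, ρ g v ∈ S) → S = ⊥ ∨ S = ⊤) :
    ρ.IsIrreducible where
  exists_pair_ne := ⟨⊥, ⊤, fun e => bot_ne_top (α := Submodule ℂ V)
    (congrArg Subrepresentation.toSubmodule e)⟩
  eq_bot_or_eq_top S := by
    rcases h S.toSubmodule (fun g v hv => S.apply_mem_toSubmodule g hv) with h | h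
    · exact Or.inl (Subrepresentation.toSubmodule_injective h)
    · exact Or.inr (Subrepresentation.toSubmodule_injective h)

lemma isIrreducible_twist (χ : G →* ℂˣ) (hρ : ρ.IsIrreducible) : (twist χ ρ).IsIrreducible := by
  have := nontrivial_of_isIrreducible hρ
  refine isIrreducible_of_forall fun S hS => eq_bot_or_eq_top_of_invariant hρ S fun g v hv => ?_
  have := S.smul_mem (((χ g)⁻¹ : ℂˣ) : ℂ) (hS g v hv)
  change _ • ((χ g : ℂ) • ρ g v) ∈ S at this
  rwa [smul_smul, Units.inv_mul, one_smul] at this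

lemma character_twist (χ : G →* ℂˣ) (g : G) :
    (twist χ ρ).character g = χ g * ρ.character g := by
  change LinearMap.trace ℂ V ((χ g : ℂ) • ρ g) = _
  rw [map_smul]; rfl

/-- An irreducible representation on which all operators commute is one-dimensional. -/
lemma finrank_eq_one_of_commute [FiniteDimensional ℂ V] (hρ : ρ.IsIrreducible)
    (h : ∀ g g' : G, ρ g * ρ g' = ρ g' * ρ g) : Module.finrank ℂ V = 1 := by
  have := nontrivial_of_isIrreducible hρ
  obtain ⟨v, hv⟩ := exists_ne (0 : V)
  have scal : ∀ g, ∃ c : ℂ, ∀ w, ρ g w = c • w := by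
    intro g
    obtain ⟨c, hc⟩ := Module.End.exists_eigenvalue (ρ g)
    refine ⟨c, fun w => ?_⟩
    have := (eq_bot_or_eq_top_of_invariant hρ (Module.End.eigenspace (ρ g) c) fun g' w hw => by
      rw [Module.End.mem_eigenspace_iff] at hw ⊢
      rw [← Module.End.mul_apply, h, Module.End.mul_apply, hw, map_smul]).resolve_left hc
    exact Module.End.mem_eigenspace_iff.1 (this ▸ Submodule.mem_top)
  refine finrank_eq_one v hv fun w => ?_
  have hw : w ∈ Submodule.span ℂ (Set.range fun g => ρ g v) := by
    rw [span_orbit_eq_top hρ hv]; exact Submodule.mem_top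
  have hle : Submodule.span ℂ (Set.range fun g => ρ g v) ≤ Submodule.span ℂ {v} := by
    rw [Submodule.span_le]
    rintro _ ⟨g, rfl⟩
    obtain ⟨c, hc⟩ := scal g
    exact Submodule.mem_span_singleton.2 ⟨c, (hc v).symm⟩
  exact Submodule.mem_span_singleton.1 (hle hw)

end Irreducible

/-! ### Functions on `PGL₂(𝔽_p)` as functions on matrices -/

section MatrixFunctions

variable {p : ℕ} [Fact p.Prime]

instance : Finite (PGLp p) :=
  Finite.of_surjective _ Matrix.ProjGenLinGroup.mk_surjective

/-- A matrix with nonzero determinant, as an element of `PGL₂(𝔽_p)`. -/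
def pglOf (M : Matrix (Fin 2) (Fin 2) (ZMod p)) (h : M.det ≠ 0) : PGLp p :=
  Matrix.ProjGenLinGroup.mk (Matrix.GeneralLinearGroup.mkOfDetNeZero M h)

/-- The extension by zero of a function on `PGL₂(𝔽_p)` to all matrices. -/
def matExt (f : PGLp p → ℂ) (M : Matrix (Fin 2) (Fin 2) (ZMod p)) : ℂ :=
  if h : M.det ≠ 0 then f (pglOf M h) else 0

/-- Class functions on a group. -/
def IsClassFun {G : Type*} [Group G] (f : G → ℂ) : Prop :=
  ∀ g h, f (h * g * h⁻¹) = f g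

lemma det_ne_zero (g : GLp p) : (g : Matrix (Fin 2) (Fin 2) (ZMod p)).det ≠ 0 :=
  ((Matrix.isUnit_iff_isUnit_det _).1 g.isUnit).ne_zero

lemma pglOf_coe (g : GLp p) (h) :
    pglOf (g : Matrix (Fin 2) (Fin 2) (ZMod p)) h = Matrix.ProjGenLinGroup.mk g := by
  unfold pglOf
  congr 1
  ext : 1
  rfl

lemma pglOf_mul {M N : Matrix (Fin 2) (Fin 2) (ZMod p)} (hM hN) :
    pglOf M hM * pglOf N hN = pglOf (M * N) (by rw [Matrix.det_mul]; exact mul_ne_zero hM hN) := by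
  unfold pglOf
  rw [← map_mul]
  congr 1
  ext : 1
  rfl

lemma pglOf_smul {M : Matrix (Fin 2) (Fin 2) (ZMod p)} {r : ZMod p} (hM) (h : (r • M).det ≠ 0) :
    pglOf (r • M) h = pglOf M hM := by
  have hr : r ≠ 0 := by rintro rfl; simp at h
  unfold pglOf
  symm
  rw [Matrix.ProjGenLinGroup.mk_eq_mk_iff]
  refine ⟨Units.mk0 r hr, ?_⟩
  ext i j
  simp [Matrix.GeneralLinearGroup.mkOfDetNeZero, mul_comm]

lemma pglOf_one (h) : pglOf (1 : Matrix (Fin 2) (Fin 2) (ZMod p)) h = 1 := by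
  rw [← map_one (Matrix.ProjGenLinGroup.mk (n := Fin 2) (R := ZMod p)), ← pglOf_coe]
  rfl

lemma matExt_coe (f : PGLp p → ℂ) (g : GLp p) :
    matExt f g = f (Matrix.ProjGenLinGroup.mk g) := by
  rw [matExt, dif_pos (det_ne_zero g), pglOf_coe]

lemma matExt_of_det_ne_zero (f : PGLp p → ℂ) {M : Matrix (Fin 2) (Fin 2) (ZMod p)} (h : M.det ≠ 0) :
    matExt f M = f (pglOf M h) := dif_pos h

lemma matExt_of_det_eq_zero (f : PGLp p → ℂ) {M : Matrix (Fin 2) (Fin 2) (ZMod p)} (h : M.det = 0) :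
    matExt f M = 0 := dif_neg (not_not.2 h)

lemma matExt_smul (f : PGLp p → ℂ) (M : Matrix (Fin 2) (Fin 2) (ZMod p)) {r : ZMod p}
    (hr : r ≠ 0) : matExt f (r • M) = matExt f M := by
  by_cases h : M.det = 0
  · rw [matExt_of_det_eq_zero f h, matExt_of_det_eq_zero]
    simp [h]
  · have h' : (r • M).det ≠ 0 := by simp [hr, h]
    rw [matExt_of_det_ne_zero f h, matExt_of_det_ne_zero f h', pglOf_smul h]

/-- Writing conjugacy as `M * P = P * N` avoids inverses, and singular matrices are covered because
the determinants agree. -/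
lemma matExt_conj {f : PGLp p → ℂ} (hf : IsClassFun f) {M N P : Matrix (Fin 2) (Fin 2) (ZMod p)}
    (hP : P.det ≠ 0) (h : M * P = P * N) : matExt f M = matExt f N := by
  have hd : M.det = N.det := by
    have := congrArg Matrix.det h
    rw [Matrix.det_mul, Matrix.det_mul, mul_comm] at this
    exact mul_left_cancel₀ hP this
  by_cases hM : M.det = 0
  · rw [matExt_of_det_eq_zero f hM, matExt_of_det_eq_zero f (hd ▸ hM)]
  · have hN : N.det ≠ 0 := hd ▸ hM
    rw [matExt_of_det_ne_zero f hM, matExt_of_det_ne_zero f hN, ← hf (pglOf N hN) (pglOf P hP),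
      pglOf_mul]
    congr 1
    rw [eq_mul_inv_iff_mul_eq, pglOf_mul]
    congr 1

/-- Singular parameters contribute zero, so `ι` can be a full product of copies of `ZMod p`.
Injectivity is needed only at invertible values: the two families describing a normalizer meet at
the zero matrix. -/
lemma card_mul_avg_eq_sum_matExt (H : Subgroup (GLp p)) {ι : Type*} [Fintype ι]
    (φ : ι → Matrix (Fin 2) (Fin 2) (ZMod p))
    (hφ : ∀ i j, (φ i).det ≠ 0 → φ i = φ j → i = j)
    (hmem : ∀ i, ∀ g : GLp p, (g : Matrix (Fin 2) (Fin 2) (ZMod p)) = φ i → g ∈ H)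
    (hsurj : ∀ g ∈ H, ∃ i, φ i = (g : Matrix (Fin 2) (Fin 2) (ZMod p))) (f : PGLp p → ℂ) :
    (Nat.card H : ℂ) * avg H (fun h => f (Matrix.ProjGenLinGroup.mk h)) =
      ∑ i, matExt f (φ i) := by
  classical
  have := Fintype.ofFinite H
  rw [card_mul_avg]
  have : Nonempty ι := ⟨(hsurj 1 H.one_mem).choose⟩
  choose! j hj using hsurj
  refine Finset.sum_bij_ne_zero (fun h _ _ => j h) (fun _ _ _ => Finset.mem_univ _) ?_ ?_ ?_
  · intro h₁ _ _ h₂ _ _ h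
    ext : 2
    rw [← hj h₁ h₁.2, ← hj h₂ h₂.2, h]
  · intro i _ hi
    have hd : (φ i).det ≠ 0 := fun h => hi (matExt_of_det_eq_zero f h)
    have hm := hmem i (Matrix.GeneralLinearGroup.mkOfDetNeZero _ hd) rfl
    refine ⟨⟨_, hm⟩, Finset.mem_univ _, ?_, (hφ _ _ hd ?_).symm⟩
    · rw [← matExt_coe f]; exact hi
    · rw [hj _ hm]; rfl
  · intro h _ _
    rw [hj h h.2, matExt_coe]

end MatrixFunctions

/-! ### Conjugacy of two by two matrices -/

section Conjugacy

variable {p : ℕ} [Fact p.Prime] {f : PGLp p → ℂ}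

lemma mat_eq {R : Type*} {a b c d a' b' c' d' : R} (ha : a = a') (hb : b = b') (hc : c = c')
    (hd : d = d') : !![a, b; c, d] = !![a', b'; c', d'] := by rw [ha, hb, hc, hd]

/-- Two matrices that are conjugate by the matrix with entries `x, y, z, w`. -/
lemma matExt_conj_of (hf : IsClassFun f) {a b c d a' b' c' d' : ZMod p} (x y z w : ZMod p)
    (hP : x * w - y * z ≠ 0)
    (h1 : a * x + b * z = x * a' + y * c') (h2 : a * y + b * w = x * b' + y * d')
    (h3 : c * x + d * z = z * a' + w * c') (h4 : c * y + d * w = z * b' + w * d') :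
    matExt f !![a, b; c, d] = matExt f !![a', b'; c', d'] := by
  refine matExt_conj hf (P := !![x, y; z, w]) (by rwa [Matrix.det_fin_two_of]) ?_
  rw [Matrix.mul_fin_two, Matrix.mul_fin_two]
  exact mat_eq h1 h2 h3 h4

lemma matExt_smul_of (f : PGLp p → ℂ) {r : ZMod p} (hr : r ≠ 0) (a b c d : ZMod p) :
    matExt f !![r * a, r * b; r * c, r * d] = matExt f !![a, b; c, d] := by
  rw [← matExt_smul f !![a, b; c, d] hr]
  simp [Matrix.smul_of]

lemma two_ne_zero_of_lt (hp : 2 < p) : (2 : ZMod p) ≠ 0 := by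
  intro h
  have : ((2 : ℕ) : ZMod p) = 0 := by exact_mod_cast h
  rw [ZMod.natCast_eq_zero_iff] at this
  exact absurd (Nat.le_of_dvd (by norm_num) this) (by omega)

lemma matExt_scalar (f : PGLp p → ℂ) {a : ZMod p} (ha : a ≠ 0) :
    matExt f !![a, 0; 0, a] = matExt f !![1, 0; 0, 1] := by
  simpa using matExt_smul_of f ha 1 0 0 1

lemma matExt_upper (hf : IsClassFun f) {a d : ZMod p} (b : ZMod p) (h : a ≠ d) :
    matExt f !![a, b; 0, d] = matExt f !![a, 0; 0, d] := by
  have : d - a ≠ 0 := sub_ne_zero.2 h.symm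
  refine matExt_conj_of hf 1 (b / (d - a)) 0 1 (by simp) ?_ ?_ ?_ ?_ <;> field_simp <;> ring

lemma matExt_unipotent (hf : IsClassFun f) {a b : ZMod p} (ha : a ≠ 0) (hb : b ≠ 0) :
    matExt f !![a, b; 0, a] = matExt f !![1, 1; 0, 1] := by
  rw [← matExt_smul_of f ha 1 1 0 1]
  refine matExt_conj_of hf b 0 0 a (by simp [ha, hb]) ?_ ?_ ?_ ?_ <;> ring

/-- A matrix with `c ≠ 0` is nonscalar, so trace and determinant determine its class. The
representative has half the trace on the diagonal and a quarter of the discriminant in the corner.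
-/
lemma matExt_generic (hp : 2 < p) (hf : IsClassFun f) (a b d : ZMod p) {c : ZMod p} (hc : c ≠ 0) :
    matExt f !![a, b; c, d] =
      matExt f !![(a + d) / 2, ((a - d) / 2) ^ 2 + b * c; 1, (a + d) / 2] := by
  have h2 := two_ne_zero_of_lt hp
  refine matExt_conj_of hf 1 ((a - d) / 2) 0 c (by simpa) ?_ ?_ ?_ ?_ <;> field_simp <;> ring

lemma matExt_lower_unipotent (hf : IsClassFun f) {s : ZMod p} (hs : s ≠ 0) :
    matExt f !![s, 0; 1, s] = matExt f !![1, 1; 0, 1] := by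
  rw [← matExt_unipotent hf hs one_ne_zero]
  refine matExt_conj_of hf 0 1 1 0 (by simp) ?_ ?_ ?_ ?_ <;> ring

lemma matExt_sq (hp : 2 < p) (hf : IsClassFun f) (s : ZMod p) {b : ZMod p} (hb : b ≠ 0) :
    matExt f !![s, b ^ 2; 1, s] = matExt f !![s + b, 0; 0, s - b] := by
  have h2 := two_ne_zero_of_lt hp
  refine matExt_conj_of hf b b 1 (-1) ?_ ?_ ?_ ?_ ?_
  · rw [show b * -1 - b * 1 = -(2 * b) by ring]
    exact neg_ne_zero.2 (mul_ne_zero h2 hb)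
  all_goals ring

lemma matExt_nonsq (hf : IsClassFun f) (u s : ZMod p) {b : ZMod p} (hb : b ≠ 0) :
    matExt f !![s, u * b ^ 2; 1, s] = matExt f !![s, b * u; b, s] := by
  refine matExt_conj_of hf b 0 0 1 (by simpa) ?_ ?_ ?_ ?_ <;> ring

lemma matExt_antidiag (hf : IsClassFun f) (b : ZMod p) {c : ZMod p} (hc : c ≠ 0) :
    matExt f !![0, b; c, 0] = matExt f !![0, b * c; 1, 0] := by
  refine matExt_conj_of hf 1 0 0 c (by simpa) ?_ ?_ ?_ ?_ <;> ring

lemma matExt_antidiag_mul_sq (hf : IsClassFun f) (δ : ZMod p) {r : ZMod p} (hr : r ≠ 0) :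
    matExt f !![0, δ * r ^ 2; 1, 0] = matExt f !![0, δ; 1, 0] := by
  rw [← matExt_smul_of f hr 0 δ 1 0]
  refine matExt_conj_of hf r 0 0 1 (by simpa) ?_ ?_ ?_ ?_ <;> ring

/-- Both matrices have trace zero and the same determinant. The case `b = 0` has to be diagonalised
separately. -/
lemma matExt_nonsplit_reflection (hp : 2 < p) (hf : IsClassFun f) (u a b : ZMod p) :
    matExt f !![a, -(b * u); b, -a] = matExt f !![0, a ^ 2 - u * b ^ 2; 1, 0] := by
  have h2 := two_ne_zero_of_lt hp
  by_cases hb : b = 0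
  · subst hb
    by_cases ha : a = 0
    · subst ha
      rw [matExt_of_det_eq_zero, matExt_of_det_eq_zero] <;> simp [Matrix.det_fin_two_of]
    · refine matExt_conj_of hf 1 a 1 (-a) ?_ ?_ ?_ ?_ ?_
      · rw [show 1 * -a - a * 1 = -(2 * a) by ring]
        exact neg_ne_zero.2 (mul_ne_zero h2 ha)
      all_goals ring
  · refine matExt_conj_of hf 1 a 0 b (by simpa) ?_ ?_ ?_ ?_ <;> ring

end Conjugacy

/-! ### Sums over squares and non-squares -/

section Squares

variable {p : ℕ} [Fact p.Prime]

lemma card_sq_eq (hp : 2 < p) (a : ZMod p) :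
    ((Finset.univ.filter fun x : ZMod p => x ^ 2 = a).card : ℂ) =
      ((quadraticChar (ZMod p) a : ℤ) : ℂ) + 1 := by
  have h := quadraticChar_card_sqrts (F := ZMod p) (by rw [ZMod.ringChar_zmod_n]; omega) a
  rw [← Int.cast_one, ← Int.cast_add, ← h]
  simp

lemma quadraticChar_of_not_isSquare {u : ZMod p} (hu : ¬ IsSquare u) :
    quadraticChar (ZMod p) u = -1 :=
  quadraticChar_neg_one_iff_not_isSquare.2 hu

lemma ne_zero_of_not_isSquare {u : ZMod p} (hu : ¬ IsSquare u) : u ≠ 0 := by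
  rintro rfl; exact hu (IsSquare.zero)

/-- Each `d` is hit `1 + (d/p)` times by `b ^ 2` and `1 - (d/p)` times by `u * b ^ 2`. -/
lemma sum_squares_add_sum_nonsquares (hp : 2 < p) {u : ZMod p} (hu : ¬ IsSquare u)
    (F : ZMod p → ℂ) :
    ∑ b, F (b ^ 2) + ∑ b, F (u * b ^ 2) = 2 * ∑ d, F d := by
  have hu0 := ne_zero_of_not_isSquare hu
  have h1 : ∑ b, F (b ^ 2) = ∑ d, (((quadraticChar (ZMod p) d : ℤ) : ℂ) + 1) * F d := by
    rw [← Finset.sum_fiberwise (s := Finset.univ) (g := fun b : ZMod p => b ^ 2)]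
    refine Finset.sum_congr rfl fun d _ => ?_
    rw [← card_sq_eq hp, Finset.sum_congr rfl (g := fun _ => F d), Finset.sum_const, nsmul_eq_mul]
    intro b hb
    rw [(Finset.mem_filter.1 hb).2]
  have h2 : ∑ b, F (u * b ^ 2) = ∑ d, (-((quadraticChar (ZMod p) d : ℤ) : ℂ) + 1) * F d := by
    rw [← Finset.sum_fiberwise (s := Finset.univ) (g := fun b : ZMod p => u * b ^ 2)]
    refine Finset.sum_congr rfl fun d _ => ?_
    have h3 : quadraticChar (ZMod p) (u * d) = - quadraticChar (ZMod p) d := by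
      rw [map_mul, quadraticChar_of_not_isSquare hu, neg_one_mul]
    rw [← Int.cast_neg, ← h3, show u * d = (d / u) * u ^ 2 by field_simp, map_mul,
      quadraticChar_sq_one' hu0, mul_one, ← card_sq_eq hp,
      Finset.sum_congr rfl (g := fun _ => F d), Finset.sum_const, nsmul_eq_mul]
    · congr 3
      ext x
      simp only [Finset.mem_filter, Finset.mem_univ, true_and]
      rw [eq_div_iff hu0, mul_comm]
    · intro b hb
      rw [(Finset.mem_filter.1 hb).2]
  rw [h1, h2, ← Finset.sum_add_distrib, Finset.mul_sum]
  refine Finset.sum_congr rfl fun d _ => ?_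
  ring

lemma exists_eq_mul_sq {u : ZMod p} (hu : ¬ IsSquare u) {d : ZMod p}
    (hd : ¬ IsSquare d) : ∃ r, r ≠ 0 ∧ d = u * r ^ 2 := by
  have hu0 := ne_zero_of_not_isSquare hu
  have hd0 := ne_zero_of_not_isSquare hd
  have h1 : IsSquare (d * u) := by
    rw [← quadraticChar_one_iff_isSquare (mul_ne_zero hd0 hu0), map_mul,
      quadraticChar_of_not_isSquare hu, quadraticChar_of_not_isSquare hd]
    norm_num
  obtain ⟨r, hr⟩ := h1
  refine ⟨r / u, div_ne_zero (fun h => mul_ne_zero hd0 hu0 (by rw [hr, h, mul_zero])) hu0, ?_⟩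
  field_simp
  rw [hr]; ring

lemma norm_eq_zero_iff {u : ZMod p} (hu : ¬ IsSquare u) {a b : ZMod p} :
    a ^ 2 - u * b ^ 2 = 0 ↔ a = 0 ∧ b = 0 := by
  constructor
  · intro h
    have hb : b = 0 := by
      by_contra hb
      refine hu ⟨a / b, ?_⟩
      field_simp
      linear_combination -h
    subst hb
    exact ⟨by simpa using h, rfl⟩
  · rintro ⟨rfl, rfl⟩; simp

/-- The norm from the quadratic extension takes a non-square value. -/
lemma exists_norm_not_isSquare {u : ZMod p} (hu : ¬ IsSquare u) :
    ∃ a b : ZMod p, ¬ IsSquare (a ^ 2 - u * b ^ 2) := by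
  by_cases h : IsSquare (-1 : ZMod p)
  · refine ⟨0, 1, fun h' => hu ?_⟩
    have := h.mul h'
    simpa using this
  · obtain ⟨r, hr, hr'⟩ := exists_eq_mul_sq hu h
    -- Here `-1 = u * r ^ 2` is a non-square; writing it as `a ^ 2 + b ^ 2` exhibits it as the norm
    -- of `a + b r √u`.
    obtain ⟨a, b, hab⟩ := ZMod.sq_add_sq p (-1)
    refine ⟨a, b * r, ?_⟩
    convert h using 2
    rw [← hab]
    linear_combination b ^ 2 * hr'

end Squares

/-! ### Sums of class functions over families of matrices -/

section Sums

variable {p : ℕ} [Fact p.Prime] {f : PGLp p → ℂ}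

lemma sum_ite_zero (c : ℂ) : ∑ a : ZMod p, (if a = 0 then 0 else c) = (p - 1) * c := by
  rw [Finset.sum_ite, Finset.sum_const_zero, zero_add, Finset.sum_const, nsmul_eq_mul,
    Finset.filter_ne' , Finset.card_erase_of_mem (Finset.mem_univ _), Finset.card_univ, ZMod.card,
    Nat.cast_sub (Fact.out : p.Prime).one_le, Nat.cast_one]

lemma sum_eq_zero_add (F : ZMod p → ℂ) :
    ∑ a, F a = F 0 + ∑ a, if a = 0 then 0 else F a := by
  rw [← Finset.add_sum_erase _ _ (Finset.mem_univ (0 : ZMod p))]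
  congr 1
  rw [Finset.sum_ite, Finset.sum_const_zero, zero_add, Finset.filter_ne']

lemma sum_const_zmod (c : ℂ) : ∑ _a : ZMod p, c = p * c := by
  rw [Finset.sum_const, nsmul_eq_mul, Finset.card_univ, ZMod.card]

lemma sum_affine (F : ZMod p → ℂ) {m : ZMod p} (hm : m ≠ 0) (c : ZMod p) :
    ∑ x, F (m * x + c) = ∑ x, F x :=
  ((Equiv.mulLeft₀ m hm).trans (Equiv.addRight c)).sum_comp F

/-- For `a ≠ d` every choice of `b` gives a conjugate of the diagonal matrix. For `a = d ≠ 0` the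
matrix is scalar when `b = 0` and otherwise a multiple of a nontrivial unipotent, which produces the
correction. -/
lemma sum_borel (hf : IsClassFun f) :
    ∑ a, ∑ b, ∑ d, matExt f !![a, b; 0, d] =
      p * ∑ a, ∑ d, matExt f !![a, 0; 0, d] +
        (p - 1) ^ 2 * (matExt f !![1, 1; 0, 1] - matExt f !![1, 0; 0, 1]) := by
  set f1 := matExt f !![1, 0; 0, 1]
  set fu := matExt f !![1, 1; 0, 1]
  have key : ∀ a d : ZMod p, ∑ b, matExt f !![a, b; 0, d] = p * matExt f !![a, 0; 0, d] +
      if d = a then (if a = 0 then 0 else (p - 1) * (fu - f1)) else 0 := by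
    intro a d
    split_ifs with h h'
    · subst h h'
      rw [add_zero, ← sum_const_zmod]
      refine Finset.sum_congr rfl fun b _ => ?_
      rw [matExt_of_det_eq_zero, matExt_of_det_eq_zero] <;> simp [Matrix.det_fin_two_of]
    · subst h
      rw [sum_eq_zero_add, matExt_scalar f h', ← sum_ite_zero]
      have : ∀ b : ZMod p, (if b = 0 then 0 else matExt f !![d, b; 0, d]) =
          f1 + (if b = 0 then 0 else (fu - f1)) - (if b = 0 then f1 else 0) := by
        intro b
        split_ifs with hb
        · ring
        · rw [matExt_unipotent hf h' hb]; ring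
      rw [Finset.sum_congr rfl fun b _ => this b, Finset.sum_sub_distrib, Finset.sum_add_distrib,
        sum_const_zmod]
      simp only [Finset.sum_ite_eq', Finset.mem_univ, if_true, f1]
      ring
    · rw [add_zero, ← sum_const_zmod]
      exact Finset.sum_congr rfl fun b _ => matExt_upper hf b (Ne.symm h)
  have h1 : ∀ a : ZMod p, ∑ b, ∑ d, matExt f !![a, b; 0, d] =
      p * ∑ d, matExt f !![a, 0; 0, d] + (if a = 0 then 0 else (p - 1) * (fu - f1)) := by
    intro a
    rw [Finset.sum_comm, Finset.sum_congr rfl fun d _ => key a d, Finset.sum_add_distrib,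
      ← Finset.mul_sum]
    simp
  rw [Finset.sum_congr rfl fun a _ => h1 a, Finset.sum_add_distrib, ← Finset.mul_sum,
    sum_ite_zero]
  ring

/-- For fixed `a` and `c ≠ 0`, passing to the normal form of `matExt_generic` is a bijective change
of variables from `(b, d)` to `(δ, s)`. Each of the `p (p - 1)` pairs `(a, c)` thus contributes the
same sum. -/
lemma sum_all (hp : 2 < p) (hf : IsClassFun f) :
    ∑ a, ∑ b, ∑ c, ∑ d, matExt f !![a, b; c, d] =
      ∑ a, ∑ b, ∑ d, matExt f !![a, b; 0, d] +
        p * (p - 1) * ∑ s, ∑ δ, matExt f !![s, δ; 1, s] := by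
  have h2 := two_ne_zero_of_lt hp
  set Q := ∑ s, ∑ δ, matExt f !![s, δ; 1, s]
  have key : ∀ a c : ZMod p, c ≠ 0 → ∑ b, ∑ d, matExt f !![a, b; c, d] = Q := by
    intro a c hc
    rw [Finset.sum_comm]
    have hQ := sum_affine (fun s => ∑ δ, matExt f !![s, δ; 1, s]) (inv_ne_zero h2) (a / 2)
    rw [← show _ = Q from hQ]
    refine Finset.sum_congr rfl fun d _ => ?_
    rw [← sum_affine (fun δ => matExt f !![2⁻¹ * d + a / 2, δ; 1, 2⁻¹ * d + a / 2]) hc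
      (((a - d) / 2) ^ 2)]
    refine Finset.sum_congr rfl fun b _ => ?_
    rw [matExt_generic hp hf a b d hc]
    congr 1
    refine mat_eq ?_ ?_ rfl ?_ <;> field_simp <;> ring
  have h1 : ∀ a : ZMod p, ∑ b, ∑ c, ∑ d, matExt f !![a, b; c, d] =
      ∑ b, ∑ d, matExt f !![a, b; 0, d] + (p - 1) * Q := by
    intro a
    rw [Finset.sum_comm, sum_eq_zero_add, ← sum_ite_zero]
    congr 1
    refine Finset.sum_congr rfl fun c _ => ?_
    split_ifs with hc
    · rfl
    · exact key a c hc
  rw [Finset.sum_congr rfl fun a _ => h1 a, Finset.sum_add_distrib, sum_const_zmod]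
  ring

lemma sum_lower_unipotent (hf : IsClassFun f) :
    ∑ s, matExt f !![s, 0; 1, s] = (p - 1) * matExt f !![1, 1; 0, 1] := by
  rw [← sum_ite_zero]
  refine Finset.sum_congr rfl fun s _ => ?_
  split_ifs with hs
  · exact matExt_of_det_eq_zero _ (by simp [hs, Matrix.det_fin_two_of])
  · exact matExt_lower_unipotent hf hs

lemma sum_scalar (f : PGLp p → ℂ) :
    ∑ s, matExt f !![s, 0; 0, s] = (p - 1) * matExt f !![1, 0; 0, 1] := by
  rw [← sum_ite_zero]
  refine Finset.sum_congr rfl fun s _ => ?_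
  split_ifs with hs
  · exact matExt_of_det_eq_zero _ (by simp [hs, Matrix.det_fin_two_of])
  · exact matExt_scalar f hs

lemma sum_diag (hp : 2 < p) (F : ZMod p → ZMod p → ℂ) :
    ∑ s, ∑ b, F (s + b) (s - b) = ∑ a, ∑ d, F a d := by
  have h2 := two_ne_zero_of_lt hp
  have h1 : ∀ s : ZMod p, ∑ b, F (s + b) (s - b) = ∑ a, F a (2 * s - a) := by
    intro s
    rw [← sum_affine (fun a => F a (2 * s - a)) one_ne_zero s]
    refine Finset.sum_congr rfl fun b _ => ?_
    congr 1 <;> ring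
  rw [Finset.sum_congr rfl fun s _ => h1 s, Finset.sum_comm]
  refine Finset.sum_congr rfl fun a _ => ?_
  rw [← sum_affine (F a) h2 (-a)]
  refine Finset.sum_congr rfl fun s _ => ?_
  rw [sub_eq_add_neg]

/-- Letting `δ` run over `b ^ 2` and `u * b ^ 2` counts it twice; squares give elements of `T` and
non-squares elements of `T'`. At `b = 0` the matrix is unipotent up to a scalar while the torus
element is scalar, whence the correction. -/
lemma two_mul_sum_lower (hp : 2 < p) (hf : IsClassFun f) {u : ZMod p} (hu : ¬ IsSquare u) :
    2 * ∑ s, ∑ δ, matExt f !![s, δ; 1, s] =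
      ∑ a, ∑ d, matExt f !![a, 0; 0, d] + ∑ a, ∑ b, matExt f !![a, b * u; b, a] +
        2 * (p - 1) * (matExt f !![1, 1; 0, 1] - matExt f !![1, 0; 0, 1]) := by
  have h1 : ∑ s, ∑ b, matExt f !![s, b ^ 2; 1, s] = ∑ a, ∑ d, matExt f !![a, 0; 0, d] +
      (p - 1) * (matExt f !![1, 1; 0, 1] - matExt f !![1, 0; 0, 1]) := by
    rw [← sum_diag hp (fun a d => matExt f !![a, 0; 0, d]), mul_sub, ← sum_lower_unipotent hf, ← sum_scalar, ← Finset.sum_sub_distrib,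
      ← Finset.sum_add_distrib]
    refine Finset.sum_congr rfl fun s _ => ?_
    rw [sum_eq_zero_add, sum_eq_zero_add (fun b => matExt f !![s + b, 0; 0, s - b])]
    have : ∀ b : ZMod p, (if b = 0 then 0 else matExt f !![s, b ^ 2; 1, s]) =
        if b = 0 then 0 else matExt f !![s + b, 0; 0, s - b] := by
      intro b
      split_ifs with hb
      · rfl
      · exact matExt_sq hp hf s hb
    rw [Finset.sum_congr rfl fun b _ => this b]
    simp only [add_zero, sub_zero, ne_eq, OfNat.ofNat_ne_zero, not_false_eq_true, zero_pow]
    ring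
  have h2 : ∑ s, ∑ b, matExt f !![s, u * b ^ 2; 1, s] = ∑ a, ∑ b, matExt f !![a, b * u; b, a] +
      (p - 1) * (matExt f !![1, 1; 0, 1] - matExt f !![1, 0; 0, 1]) := by
    rw [mul_sub, ← sum_lower_unipotent hf, ← sum_scalar, ← Finset.sum_sub_distrib,
      ← Finset.sum_add_distrib]
    refine Finset.sum_congr rfl fun s _ => ?_
    rw [sum_eq_zero_add, sum_eq_zero_add (fun b => matExt f !![s, b * u; b, s])]
    have : ∀ b : ZMod p, (if b = 0 then 0 else matExt f !![s, u * b ^ 2; 1, s]) =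
        if b = 0 then 0 else matExt f !![s, b * u; b, s] := by
      intro b
      split_ifs with hb
      · rfl
      · exact matExt_nonsq hf u s hb
    rw [Finset.sum_congr rfl fun b _ => this b]
    simp only [zero_mul, mul_zero, ne_eq, OfNat.ofNat_ne_zero, not_false_eq_true, zero_pow]
    ring
  rw [Finset.mul_sum, ← Finset.sum_congr rfl fun s _ =>
    sum_squares_add_sum_nonsquares hp hu (fun δ => matExt f !![s, δ; 1, s]),
    Finset.sum_add_distrib, h1, h2]
  ring

/-- Modulo scalars the class of an antidiagonal matrix depends only on `b * c` modulo squares, and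
both square classes occur equally often. -/
lemma sum_antidiag (hp : 2 < p) (hf : IsClassFun f) {u : ZMod p} (hu : ¬ IsSquare u) :
    2 * ∑ b, ∑ c, matExt f !![0, b; c, 0] =
      (p - 1) ^ 2 * (matExt f !![0, 1; 1, 0] + matExt f !![0, u; 1, 0]) := by
  have key : ∀ δ : ZMod p, ∑ r, matExt f !![0, δ * r ^ 2; 1, 0] =
      (p - 1) * matExt f !![0, δ; 1, 0] := by
    intro δ
    rw [← sum_ite_zero]
    refine Finset.sum_congr rfl fun r _ => ?_
    split_ifs with hr
    · exact matExt_of_det_eq_zero _ (by simp [hr, Matrix.det_fin_two_of])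
    · exact matExt_antidiag_mul_sq hf δ hr
  have h1 : ∀ c : ZMod p, ∑ b, matExt f !![0, b; c, 0] =
      if c = 0 then 0 else ∑ δ, matExt f !![0, δ; 1, 0] := by
    intro c
    split_ifs with hc
    · exact Finset.sum_eq_zero fun b _ =>
        matExt_of_det_eq_zero _ (by simp [hc, Matrix.det_fin_two_of])
    · rw [← sum_affine (fun δ => matExt f !![0, δ; 1, 0]) hc 0]
      refine Finset.sum_congr rfl fun b _ => ?_
      rw [matExt_antidiag hf b hc, mul_comm, add_zero]
  rw [Finset.sum_comm, Finset.sum_congr rfl fun c _ => h1 c, sum_ite_zero]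
  have h3 := sum_squares_add_sum_nonsquares hp hu (fun δ => matExt f !![0, δ; 1, 0])
  rw [key u] at h3
  have h4 := key 1
  simp only [one_mul] at h4
  rw [h4] at h3
  linear_combination (-(p - 1 : ℂ)) * h3

lemma sum_norm_ite {u : ZMod p} (hu : ¬ IsSquare u) (c : ℂ) :
    ∑ a : ZMod p, ∑ b : ZMod p, (if a ^ 2 - u * b ^ 2 = 0 then 0 else c) = (p ^ 2 - 1) * c := by
  have : ∀ a b : ZMod p, (if a ^ 2 - u * b ^ 2 = 0 then 0 else c) =
      c - if a = 0 then (if b = 0 then c else 0) else 0 := by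
    intro a b
    simp only [norm_eq_zero_iff hu]
    split_ifs <;> simp_all
  simp only [this, Finset.sum_sub_distrib, sum_const_zmod]
  have h : ∑ a : ZMod p, ∑ b : ZMod p, (if a = 0 then (if b = 0 then c else 0) else 0) = c := by
    rw [Finset.sum_eq_single 0] <;> simp +contextual
  rw [h]
  ring

/-- Multiplication by an element of non-square norm exchanges the two square classes of norms, so
these are equally frequent. -/
lemma sum_nonsplit_reflections (hp : 2 < p) (hf : IsClassFun f) {u : ZMod p}
    (hu : ¬ IsSquare u) :
    2 * ∑ a, ∑ b, matExt f !![a, -(b * u); b, -a] =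
      (p ^ 2 - 1) * (matExt f !![0, 1; 1, 0] + matExt f !![0, u; 1, 0]) := by
  obtain ⟨a₀, b₀, hν⟩ := exists_norm_not_isSquare hu
  set ν := a₀ ^ 2 - u * b₀ ^ 2 with hνdef
  have hν0 := ne_zero_of_not_isSquare hν
  simp only [matExt_nonsplit_reflection hp hf]
  have h1 : ∑ a, ∑ b, matExt f !![0, a ^ 2 - u * b ^ 2; 1, 0] =
      ∑ a, ∑ b, matExt f !![0, ν * (a ^ 2 - u * b ^ 2); 1, 0] := by
    rw [← Fintype.sum_prod_type', ← Fintype.sum_prod_type']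
    -- This map is multiplication by `a₀ + b₀ √u`, which multiplies the norm by `ν`.
    have hbij : Function.Bijective fun x : ZMod p × ZMod p =>
        (a₀ * x.1 + u * b₀ * x.2, a₀ * x.2 + b₀ * x.1) := by
      refine (Finite.injective_iff_bijective).1 fun x y h => ?_
      simp only [Prod.mk.injEq] at h
      obtain ⟨h1, h2⟩ := h
      ext
      · refine mul_left_cancel₀ hν0 ?_
        rw [hνdef]
        linear_combination a₀ * h1 - u * b₀ * h2
      · refine mul_left_cancel₀ hν0 ?_
        rw [hνdef]
        linear_combination a₀ * h2 - b₀ * h1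
    rw [← hbij.sum_comp fun x => matExt f !![0, x.1 ^ 2 - u * x.2 ^ 2; 1, 0]]
    refine Finset.sum_congr rfl fun x _ => ?_
    congr 1
    refine mat_eq rfl ?_ rfl rfl
    rw [hνdef]; ring
  rw [← sum_norm_ite hu, two_mul]
  -- One copy of the sum is rewritten with norms multiplied by `ν`, so that each nonzero `(a, b)`
  -- contributes both classes exactly once.
  conv_lhs => rw [h1]
  conv_lhs => enter [2]; rw [← h1]
  rw [← Finset.sum_add_distrib]
  refine Finset.sum_congr rfl fun a _ => ?_
  rw [← Finset.sum_add_distrib]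
  refine Finset.sum_congr rfl fun b _ => ?_
  set δ := a ^ 2 - u * b ^ 2
  split_ifs with h0
  · rw [h0, matExt_of_det_eq_zero, matExt_of_det_eq_zero] <;> simp [Matrix.det_fin_two_of]
  · by_cases hδ : IsSquare δ
    · obtain ⟨r, hr⟩ := hδ
      have hr0 : r ≠ 0 := by rintro rfl; exact h0 (by simpa using hr)
      obtain ⟨t, ht0, ht⟩ := exists_eq_mul_sq hu hν
      have e1 : δ = 1 * r ^ 2 := by rw [hr]; ring
      have e2 : ν * δ = u * (t * r) ^ 2 := by rw [hr, ht]; ring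
      rw [e2, e1, matExt_antidiag_mul_sq hf _ hr0, matExt_antidiag_mul_sq hf _ (mul_ne_zero ht0 hr0)]
      ring
    · obtain ⟨r, hr0, hr⟩ := exists_eq_mul_sq hu hδ
      obtain ⟨t, ht0, ht⟩ := exists_eq_mul_sq hu hν
      have hu0 := ne_zero_of_not_isSquare hu
      have e2 : ν * δ = 1 * (u * t * r) ^ 2 := by rw [hr, ht]; ring
      rw [e2, hr, matExt_antidiag_mul_sq hf _ hr0,
        matExt_antidiag_mul_sq hf _ (mul_ne_zero (mul_ne_zero hu0 ht0) hr0)]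

end Sums

/-! ### Averages of class functions over the subgroups -/

section Averages

variable {p : ℕ} [Fact p.Prime]

/-- The average over a subgroup of `GL₂(𝔽_p)` of a function on `PGL₂(𝔽_p)`. -/
def avgOn (H : Subgroup (GLp p)) (f : PGLp p → ℂ) : ℂ :=
  avg H fun h => f (Matrix.ProjGenLinGroup.mk h)

lemma avgOn_one (H : Subgroup (GLp p)) : avgOn H 1 = 1 := by
  have := Fintype.ofFinite H
  rw [avgOn, avg_eq]
  simp

lemma avgOn_top (f : PGLp p → ℂ) : avgOn ⊤ f = avg (PGLp p) f :=
  avg_comp ((Matrix.ProjGenLinGroup.mk).comp (⊤ : Subgroup (GLp p)).subtype)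
    (fun g => by
      obtain ⟨g, rfl⟩ := Matrix.ProjGenLinGroup.mk_surjective g
      exact ⟨⟨g, Subgroup.mem_top g⟩, rfl⟩) f

lemma avgOn_eq_avg_modZ (H : Subgroup (GLp p)) (f : PGLp p → ℂ) :
    avgOn H f = avg (modZ H) fun h => f h :=
  avg_comp (Matrix.ProjGenLinGroup.mk.subgroupMap H)
    (Matrix.ProjGenLinGroup.mk.subgroupMap_surjective H) fun h : modZ H => f h

lemma finrank_fixedSpace {V : Type*} [AddCommGroup V] [Module ℂ V] [FiniteDimensional ℂ V]
    (ρ : Representation ℂ (PGLp p) V) (H : Subgroup (GLp p)) :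
    (Module.finrank ℂ (fixedSpace ρ H) : ℂ) = avgOn H ρ.character :=
  finrank_invariants_eq_avg _

lemma mat_ext_iff {R : Type*} {a b c d a' b' c' d' : R} :
    !![a, b; c, d] = !![a', b'; c', d'] ↔ a = a' ∧ b = b' ∧ c = c' ∧ d = d' := by
  constructor
  · intro h
    exact ⟨congrFun (congrFun h 0) 0, congrFun (congrFun h 0) 1, congrFun (congrFun h 1) 0,
      congrFun (congrFun h 1) 1⟩
  · rintro ⟨rfl, rfl, rfl, rfl⟩; rfl

lemma card_mul_avgOn_splitCartan (f : PGLp p → ℂ) :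
    (Nat.card (splitCartan p) : ℂ) * avgOn (splitCartan p) f =
      ∑ a, ∑ d, matExt f !![a, 0; 0, d] := by
  rw [← Fintype.sum_prod_type' (f := fun a d => matExt f !![a, 0; 0, d])]
  refine card_mul_avg_eq_sum_matExt _ (fun x : ZMod p × ZMod p => !![x.1, 0; 0, x.2]) ?_ ?_ ?_ f
  · rintro ⟨a, d⟩ ⟨a', d'⟩ - h
    have := mat_ext_iff.1 h
    exact Prod.ext this.1 this.2.2.2
  · intro x g hg
    change g 0 1 = 0 ∧ g 1 0 = 0
    rw [hg]; simp
  · intro g hg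
    refine ⟨(g 0 0, g 1 1), ?_⟩
    ext i j
    have h1 : g 0 1 = 0 := hg.1
    have h2 : g 1 0 = 0 := hg.2
    fin_cases i <;> fin_cases j <;> simp [h1, h2]

lemma card_mul_avgOn_borel (f : PGLp p → ℂ) :
    (Nat.card (borel p) : ℂ) * avgOn (borel p) f =
      ∑ a, ∑ b, ∑ d, matExt f !![a, b; 0, d] := by
  simp only [← Fintype.sum_prod_type']
  refine card_mul_avg_eq_sum_matExt _
    (fun x : ZMod p × ZMod p × ZMod p => !![x.1, x.2.1; 0, x.2.2]) ?_ ?_ ?_ f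
  · rintro ⟨a, b, d⟩ ⟨a', b', d'⟩ - h
    obtain ⟨rfl, rfl, -, rfl⟩ := mat_ext_iff.1 h
    rfl
  · intro x g hg
    change g 1 0 = 0
    rw [hg]; simp
  · intro g hg
    refine ⟨(g 0 0, g 0 1, g 1 1), ?_⟩
    ext i j
    have h2 : g 1 0 = 0 := hg
    fin_cases i <;> fin_cases j <;> simp [h2]

lemma card_mul_avgOn_top (f : PGLp p → ℂ) :
    (Nat.card (⊤ : Subgroup (GLp p)) : ℂ) * avgOn ⊤ f =
      ∑ a, ∑ b, ∑ c, ∑ d, matExt f !![a, b; c, d] := by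
  simp only [← Fintype.sum_prod_type']
  refine card_mul_avg_eq_sum_matExt _
    (fun x : ZMod p × ZMod p × ZMod p × ZMod p => !![x.1, x.2.1; x.2.2.1, x.2.2.2]) ?_ ?_ ?_ f
  · rintro ⟨a, b, c, d⟩ ⟨a', b', c', d'⟩ - h
    obtain ⟨rfl, rfl, rfl, rfl⟩ := mat_ext_iff.1 h
    rfl
  · intro x g hg
    exact Subgroup.mem_top g
  · intro g hg
    exact ⟨(g 0 0, g 0 1, g 1 0, g 1 1), (Matrix.eta_fin_two _).symm⟩

lemma card_mul_avgOn_nonsplitCartan {u : ZMod p} (f : PGLp p → ℂ) :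
    (Nat.card (nonsplitCartan u) : ℂ) * avgOn (nonsplitCartan u) f =
      ∑ a, ∑ b, matExt f !![a, b * u; b, a] := by
  rw [← Fintype.sum_prod_type' (f := fun a b => matExt f !![a, b * u; b, a])]
  refine card_mul_avg_eq_sum_matExt _
    (fun x : ZMod p × ZMod p => !![x.1, x.2 * u; x.2, x.1]) ?_ ?_ ?_ f
  · rintro ⟨a, d⟩ ⟨a', d'⟩ - h
    have := mat_ext_iff.1 h
    exact Prod.ext this.1 this.2.2.1
  · intro x g hg
    exact ⟨x.1, x.2, hg⟩
  · rintro g ⟨a, b, h⟩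
    exact ⟨(a, b), h.symm⟩

lemma sum_matExt_one_splitCartan :
    ∑ a : ZMod p, ∑ d, matExt (1 : PGLp p → ℂ) !![a, 0; 0, d] = (p - 1) ^ 2 := by
  have : ∀ a d : ZMod p, matExt (1 : PGLp p → ℂ) !![a, 0; 0, d] =
      if a = 0 then 0 else if d = 0 then 0 else 1 := by
    intro a d
    split_ifs with h1 h2
    · exact matExt_of_det_eq_zero _ (by simp [h1, Matrix.det_fin_two_of])
    · exact matExt_of_det_eq_zero _ (by simp [h2, Matrix.det_fin_two_of])
    · exact matExt_of_det_ne_zero _ (by simp [h1, h2, Matrix.det_fin_two_of])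
  simp only [this]
  have h : ∀ a : ZMod p, (∑ d : ZMod p, if a = 0 then (0 : ℂ) else if d = 0 then 0 else 1) =
      if a = 0 then 0 else (p - 1 : ℂ) := by
    intro a
    split_ifs
    · simp
    · rw [sum_ite_zero, mul_one]
  rw [Finset.sum_congr rfl fun a _ => h a, sum_ite_zero]
  ring

lemma sum_matExt_one_nonsplitCartan {u : ZMod p} (hu : ¬ IsSquare u) :
    ∑ a : ZMod p, ∑ b, matExt (1 : PGLp p → ℂ) !![a, b * u; b, a] = p ^ 2 - 1 := by
  have : ∀ a b : ZMod p, matExt (1 : PGLp p → ℂ) !![a, b * u; b, a] =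
      if a ^ 2 - u * b ^ 2 = 0 then 0 else 1 := by
    intro a b
    have hd : Matrix.det !![a, b * u; b, a] = a ^ 2 - u * b ^ 2 := by
      rw [Matrix.det_fin_two_of]; ring
    split_ifs with h1
    · exact matExt_of_det_eq_zero _ (hd.trans h1)
    · exact matExt_of_det_ne_zero _ (hd ▸ h1)
  simp only [this]
  rw [sum_norm_ite hu, mul_one]

/-- Group orders come from the same matrix sums, evaluated at the constant function one. -/
lemma card_of_card_mul {H : Subgroup (GLp p)} {c : ℂ}
    (h : (Nat.card H : ℂ) * avgOn H 1 = c) : (Nat.card H : ℂ) = c := by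
  rwa [avgOn_one, mul_one] at h

omit [Fact p.Prime] in
lemma isClassFun_one : IsClassFun (1 : PGLp p → ℂ) := fun _ _ => rfl

lemma matExt_one_eq_one {M : Matrix (Fin 2) (Fin 2) (ZMod p)} (h : M.det ≠ 0) :
    matExt (1 : PGLp p → ℂ) M = 1 := matExt_of_det_ne_zero _ h

omit [Fact p.Prime] in
lemma prime_cast_ne (hp : 2 < p) : (p : ℂ) ≠ 0 ∧ (p : ℂ) - 1 ≠ 0 ∧ (p : ℂ) + 1 ≠ 0 := by
  refine ⟨by exact_mod_cast (by omega : p ≠ 0), ?_, by exact_mod_cast (by omega : p + 1 ≠ 0)⟩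
  rw [sub_ne_zero]
  exact_mod_cast (by omega : p ≠ 1)

lemma card_splitCartan : (Nat.card (splitCartan p) : ℂ) = (p - 1) ^ 2 :=
  card_of_card_mul ((card_mul_avgOn_splitCartan 1).trans sum_matExt_one_splitCartan)

lemma card_nonsplitCartan {u : ZMod p} (hu : ¬ IsSquare u) :
    (Nat.card (nonsplitCartan u) : ℂ) = p ^ 2 - 1 :=
  card_of_card_mul ((card_mul_avgOn_nonsplitCartan 1).trans (sum_matExt_one_nonsplitCartan hu))

lemma card_borel : (Nat.card (borel p) : ℂ) = p * (p - 1) ^ 2 := by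
  refine card_of_card_mul ((card_mul_avgOn_borel 1).trans ?_)
  rw [sum_borel isClassFun_one, sum_matExt_one_splitCartan, matExt_one_eq_one (by simp),
    matExt_one_eq_one (by simp)]
  ring

lemma card_top (hp : 2 < p) {u : ZMod p} (hu : ¬ IsSquare u) :
    (Nat.card (⊤ : Subgroup (GLp p)) : ℂ) = p * (p - 1) ^ 2 * (p + 1) := by
  refine card_of_card_mul ((card_mul_avgOn_top 1).trans ?_)
  have h := two_mul_sum_lower (f := (1 : PGLp p → ℂ)) hp isClassFun_one hu
  rw [sum_matExt_one_splitCartan, sum_matExt_one_nonsplitCartan hu, matExt_one_eq_one (by simp),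
    matExt_one_eq_one (by simp)] at h
  rw [sum_all hp isClassFun_one, sum_borel isClassFun_one, sum_matExt_one_splitCartan,
    matExt_one_eq_one (by simp), matExt_one_eq_one (by simp)]
  linear_combination (p * (p - 1 : ℂ) / 2) * h

variable {f : PGLp p → ℂ}

theorem avgOn_borel (hp : 2 < p) (hf : IsClassFun f) :
    (p : ℂ) * avgOn (borel p) f = p * avgOn (splitCartan p) f +
      (matExt f !![1, 1; 0, 1] - matExt f !![1, 0; 0, 1]) := by
  have hB := card_mul_avgOn_borel f
  have hT := card_mul_avgOn_splitCartan f
  rw [sum_borel hf, ← hT, card_borel, card_splitCartan] at hB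
  have := (prime_cast_ne hp).2.1
  refine mul_left_cancel₀ (pow_ne_zero 2 this) ?_
  linear_combination hB

/-- Pairing with a class function the identity of virtual characters `2 · 1 = 2 Ind_B 1 - Ind_T 1 +
Ind_T' 1`. -/
theorem two_mul_avgOn_top (hp : 2 < p) (hf : IsClassFun f) {u : ZMod p} (hu : ¬ IsSquare u) :
    2 * avgOn ⊤ f = 2 * avgOn (borel p) f - avgOn (splitCartan p) f +
      avgOn (nonsplitCartan u) f := by
  have hB := card_mul_avgOn_borel f
  have hT := card_mul_avgOn_splitCartan f
  have hT' := card_mul_avgOn_nonsplitCartan (u := u) f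
  have hG := card_mul_avgOn_top f
  have hs := two_mul_sum_lower hp hf hu
  rw [sum_all hp hf, ← hB, card_borel, card_top hp hu] at hG
  rw [← hT, ← hT', card_splitCartan, card_nonsplitCartan hu] at hs
  have h1 := avgOn_borel hp hf
  obtain ⟨h2, h3, h4⟩ := prime_cast_ne hp
  refine mul_left_cancel₀ (mul_ne_zero (mul_ne_zero h2 (pow_ne_zero 2 h3)) h4) ?_
  linear_combination 2 * hG + p * (p - 1 : ℂ) * hs - 2 * p * (p - 1 : ℂ) ^ 2 * h1

end Averages

/-! ### The normalizers -/

section Normalizers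

variable {p : ℕ} [Fact p.Prime]

/-- The antidiagonal matrix with entries `δ` and `1`. -/
def antidiagGL (δ : ZMod p) (hδ : δ ≠ 0) : GLp p :=
  Matrix.GeneralLinearGroup.mkOfDetNeZero !![0, δ; 1, 0] (by simpa [Matrix.det_fin_two_of])

/-- The diagonal matrix with entries `a` and `d`. -/
def diagGL (a d : ZMod p) (h : a * d ≠ 0) : GLp p :=
  Matrix.GeneralLinearGroup.mkOfDetNeZero !![a, 0; 0, d] (by simpa [Matrix.det_fin_two_of] using h)

lemma mem_normalizer_of_involution {G : Type*} [Group G] {H : Subgroup G} {w : G} (hw : w * w = 1)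
    (h : ∀ x ∈ H, w * x * w ∈ H) : w ∈ Subgroup.normalizer (H : Set G) := by
  have hw' : w⁻¹ = w := inv_eq_of_mul_eq_one_left hw
  rw [Subgroup.mem_normalizer_iff, hw']
  intro x
  refine ⟨h x, fun hx => ?_⟩
  have := h _ hx
  rwa [show w * (w * x * w) * w = (w * w) * x * (w * w) by group, hw, one_mul, mul_one] at this

lemma GL_ext_of {g h : GLp p} (e : (g : Matrix (Fin 2) (Fin 2) (ZMod p)) = h) : g = h :=
  Units.ext e

lemma antidiag_mem_splitNormalizer {g : GLp p} {b c : ZMod p}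
    (hg : (g : Matrix (Fin 2) (Fin 2) (ZMod p)) = !![0, b; c, 0]) : g ∈ splitNormalizer p := by
  set w := antidiagGL (1 : ZMod p) one_ne_zero
  have hwv : (w : Matrix (Fin 2) (Fin 2) (ZMod p)) = !![0, 1; 1, 0] := rfl
  have hw : w * w = 1 := by
    refine GL_ext_of ?_
    rw [Matrix.GeneralLinearGroup.coe_mul, hwv, Matrix.mul_fin_two]
    simp [Matrix.one_fin_two]
  have hwN : w ∈ splitNormalizer p := mem_normalizer_of_involution hw fun x hx => by
    have h1 : x 0 1 = 0 := hx.1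
    have h2 : x 1 0 = 0 := hx.2
    constructor <;> simp [hwv, Matrix.mul_apply, Matrix.vecMul, dotProduct, Fin.sum_univ_two, h1,
      h2]
  have hT : g * w ∈ splitNormalizer p := Subgroup.le_normalizer (by
    constructor <;> simp [hwv, hg, Matrix.mul_apply, Fin.sum_univ_two])
  have := (splitNormalizer p).mul_mem hT hwN
  rwa [mul_assoc, hw, mul_one] at this

/-- If `s = g t g⁻¹` is diagonal for `t = diag(1, -1)`, comparing entries of `s g = g t` shows that
no row of `g` has two nonzero entries, because `1 ≠ -1`. -/
lemma splitNormalizer_cases (hp : 2 < p) {g : GLp p} (hg : g ∈ splitNormalizer p) :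
    (g 0 1 = 0 ∧ g 1 0 = 0) ∨ (g 0 0 = 0 ∧ g 1 1 = 0) := by
  have h2 := two_ne_zero_of_lt hp
  set t := diagGL (1 : ZMod p) (-1) (by simp)
  have htv : (t : Matrix (Fin 2) (Fin 2) (ZMod p)) = !![1, 0; 0, -1] := rfl
  have ht : t ∈ splitCartan p := by constructor <;> simp [htv]
  have h := (Subgroup.mem_normalizer_iff.1 hg t).1 ht
  set s := g * t * g⁻¹ with hs
  have h01 : s 0 1 = 0 := h.1
  have h10 : s 1 0 = 0 := h.2
  have e : s * g = g * t := by rw [hs]; group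
  have e' := congrArg (fun x : GLp p => (x : Matrix (Fin 2) (Fin 2) (ZMod p))) e
  simp only [Matrix.GeneralLinearGroup.coe_mul, htv] at e'
  have e00 := congrFun (congrFun e' 0) 0
  have e01 := congrFun (congrFun e' 0) 1
  have e10 := congrFun (congrFun e' 1) 0
  have e11 := congrFun (congrFun e' 1) 1
  simp [Matrix.mul_apply, Fin.sum_univ_two, h01, h10] at e00 e01 e10 e11
  have hd := det_ne_zero g
  rw [Matrix.det_fin_two] at hd
  have cancel : ∀ x : ZMod p, x = -x → x = 0 := fun x hx => by
    have : 2 * x = 0 := by linear_combination hx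
    exact (mul_eq_zero.1 this).resolve_left h2
  grind

lemma reflection_mem_nonsplitNormalizer {u : ZMod p} {g : GLp p} {a b : ZMod p}
    (hg : (g : Matrix (Fin 2) (Fin 2) (ZMod p)) = !![a, -(b * u); b, -a]) :
    g ∈ nonsplitNormalizer u := by
  set w := diagGL (1 : ZMod p) (-1) (by simp)
  have hwv : (w : Matrix (Fin 2) (Fin 2) (ZMod p)) = !![1, 0; 0, -1] := rfl
  have hw : w * w = 1 := by
    refine GL_ext_of ?_
    rw [Matrix.GeneralLinearGroup.coe_mul, hwv, Matrix.mul_fin_two]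
    simp [Matrix.one_fin_two]
  have hwN : w ∈ nonsplitNormalizer u := mem_normalizer_of_involution hw fun x hx => by
    obtain ⟨c, d, hx⟩ := hx
    refine ⟨c, -d, ?_⟩
    rw [Matrix.GeneralLinearGroup.coe_mul, Matrix.GeneralLinearGroup.coe_mul, hwv, hx,
      Matrix.mul_fin_two, Matrix.mul_fin_two]
    refine mat_eq ?_ ?_ ?_ ?_ <;> ring
  have hT : g * w ∈ nonsplitNormalizer u := Subgroup.le_normalizer (by
    refine ⟨a, b, ?_⟩
    rw [Matrix.GeneralLinearGroup.coe_mul, hwv, hg, Matrix.mul_fin_two]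
    refine mat_eq ?_ ?_ ?_ ?_ <;> ring)
  have := (nonsplitNormalizer u).mul_mem hT hwN
  rwa [mul_assoc, hw, mul_one] at this

/-- The element `t`, a square root of `u`, has a conjugate in `T'` of trace zero, which is `b t`;
determinants give `b = ±1`. So `g` commutes or anticommutes with `t`. -/
lemma nonsplitNormalizer_cases (hp : 2 < p) {u : ZMod p} (hu : ¬ IsSquare u) {g : GLp p}
    (hg : g ∈ nonsplitNormalizer u) :
    (∃ a b, (g : Matrix (Fin 2) (Fin 2) (ZMod p)) = !![a, b * u; b, a]) ∨
      ∃ a b, (g : Matrix (Fin 2) (Fin 2) (ZMod p)) = !![a, -(b * u); b, -a] := by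
  have h2 := two_ne_zero_of_lt hp
  have hu0 := ne_zero_of_not_isSquare hu
  set t := antidiagGL u hu0
  have htv : (t : Matrix (Fin 2) (Fin 2) (ZMod p)) = !![0, u; 1, 0] := rfl
  have ht : t ∈ nonsplitCartan u := ⟨0, 1, by rw [htv, one_mul]⟩
  obtain ⟨a, b, h⟩ := (Subgroup.mem_normalizer_iff.1 hg t).1 ht
  have e : (g * t * g⁻¹) * g = g * t := by group
  have htr : Matrix.trace !![a, b * u; b, a] = 0 := by
    have := Matrix.trace_units_conj g (t : Matrix (Fin 2) (Fin 2) (ZMod p))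
    rw [← h, Matrix.GeneralLinearGroup.coe_mul, Matrix.GeneralLinearGroup.coe_mul, this, htv]
    simp [Matrix.trace_fin_two_of]
  have ha : a = 0 := by
    rw [Matrix.trace_fin_two_of] at htr
    have : 2 * a = 0 := by linear_combination htr
    exact (mul_eq_zero.1 this).resolve_left h2
  subst ha
  have e' := congrArg (fun x : GLp p => (x : Matrix (Fin 2) (Fin 2) (ZMod p))) e
  simp only [Matrix.GeneralLinearGroup.coe_mul (g * t * g⁻¹), h] at e'
  have hdet := congrArg Matrix.det e'
  simp only [Matrix.GeneralLinearGroup.coe_mul, htv, Matrix.det_mul, Matrix.det_fin_two_of] at hdet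
  have hb : b ^ 2 = 1 := by
    refine mul_left_cancel₀ (mul_ne_zero hu0 (det_ne_zero g)) ?_
    linear_combination -hdet
  simp only [Matrix.GeneralLinearGroup.coe_mul, htv] at e'
  have e00 := congrFun (congrFun e' 0) 0
  have e10 := congrFun (congrFun e' 1) 0
  simp [Matrix.mul_apply, Fin.sum_univ_two] at e00 e10
  have hb' : (b - 1) * (b + 1) = 0 := by linear_combination hb
  rcases mul_eq_zero.1 hb' with h' | h'
  · left
    refine ⟨g 0 0, g 1 0, ?_⟩
    refine (Matrix.eta_fin_two _).trans (mat_eq rfl ?_ rfl ?_)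
    · linear_combination -e00 + u * g 1 0 * h'
    · linear_combination -e10 + g 0 0 * h'
  · right
    refine ⟨g 0 0, g 1 0, ?_⟩
    refine (Matrix.eta_fin_two _).trans (mat_eq rfl ?_ rfl ?_)
    · linear_combination -e00 + u * g 1 0 * h'
    · linear_combination -e10 + g 0 0 * h'

lemma card_mul_avgOn_splitNormalizer (hp : 2 < p) (f : PGLp p → ℂ) :
    (Nat.card (splitNormalizer p) : ℂ) * avgOn (splitNormalizer p) f =
      ∑ a, ∑ d, matExt f !![a, 0; 0, d] + ∑ b, ∑ c, matExt f !![0, b; c, 0] := by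
  rw [← Fintype.sum_prod_type' (f := fun a d => matExt f !![a, 0; 0, d]),
    ← Fintype.sum_prod_type' (f := fun b c => matExt f !![0, b; c, 0])]
  refine (card_mul_avg_eq_sum_matExt _ (Sum.elim (fun x : ZMod p × ZMod p => !![x.1, 0; 0, x.2])
    fun x : ZMod p × ZMod p => !![0, x.1; x.2, 0]) ?_ ?_ ?_ f).trans
    (Fintype.sum_sum_type _)
  · rintro (⟨a, d⟩ | ⟨a, d⟩) (⟨a', d'⟩ | ⟨a', d'⟩) hd h
    · obtain ⟨rfl, -, -, rfl⟩ := mat_ext_iff.1 h; rfl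
    · obtain ⟨rfl, -, -, rfl⟩ := mat_ext_iff.1 h
      exact absurd (by simp [Matrix.det_fin_two_of]) hd
    · obtain ⟨-, rfl, rfl, -⟩ := mat_ext_iff.1 h
      exact absurd (by simp [Matrix.det_fin_two_of]) hd
    · obtain ⟨-, rfl, rfl, -⟩ := mat_ext_iff.1 h; rfl
  · rintro (x | x) g hg
    · refine Subgroup.le_normalizer ?_
      change g 0 1 = 0 ∧ g 1 0 = 0
      rw [hg]; simp
    · exact antidiag_mem_splitNormalizer hg
  · intro g hg
    rcases splitNormalizer_cases hp hg with ⟨h1, h2⟩ | ⟨h1, h2⟩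
    · exact ⟨Sum.inl (g 0 0, g 1 1),
        ((Matrix.eta_fin_two _).trans (mat_eq rfl h1 h2 rfl)).symm⟩
    · exact ⟨Sum.inr (g 0 1, g 1 0),
        ((Matrix.eta_fin_two _).trans (mat_eq h1 rfl rfl h2)).symm⟩

lemma card_mul_avgOn_nonsplitNormalizer (hp : 2 < p) {u : ZMod p} (hu : ¬ IsSquare u)
    (f : PGLp p → ℂ) :
    (Nat.card (nonsplitNormalizer u) : ℂ) * avgOn (nonsplitNormalizer u) f =
      ∑ a, ∑ b, matExt f !![a, b * u; b, a] + ∑ a, ∑ b, matExt f !![a, -(b * u); b, -a] := by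
  have h2 := two_ne_zero_of_lt hp
  have hu0 := ne_zero_of_not_isSquare hu
  have cancel : ∀ x : ZMod p, x = -x → x = 0 := fun x hx => by
    have : 2 * x = 0 := by linear_combination hx
    exact (mul_eq_zero.1 this).resolve_left h2
  rw [← Fintype.sum_prod_type' (f := fun a b => matExt f !![a, b * u; b, a]),
    ← Fintype.sum_prod_type' (f := fun a b => matExt f !![a, -(b * u); b, -a])]
  refine (card_mul_avg_eq_sum_matExt _
    (Sum.elim (fun x : ZMod p × ZMod p => !![x.1, x.2 * u; x.2, x.1])
    fun x : ZMod p × ZMod p => !![x.1, -(x.2 * u); x.2, -x.1]) ?_ ?_ ?_ f).trans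
    (Fintype.sum_sum_type _)
  · rintro (⟨a, d⟩ | ⟨a, d⟩) (⟨a', d'⟩ | ⟨a', d'⟩) hd h
    · obtain ⟨rfl, -, rfl, -⟩ := mat_ext_iff.1 h; rfl
    · obtain ⟨rfl, h3, rfl, h4⟩ := mat_ext_iff.1 h
      have ha : a = 0 := cancel _ h4
      have hb : d = 0 := (mul_eq_zero.1 (cancel _ h3)).resolve_right hu0
      exact absurd (by simp [Matrix.det_fin_two_of, ha, hb]) hd
    · obtain ⟨rfl, h3, rfl, h4⟩ := mat_ext_iff.1 h
      have ha : a = 0 := cancel _ h4.symm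
      have hb : d = 0 := (mul_eq_zero.1 (cancel _ h3.symm)).resolve_right hu0
      exact absurd (by simp [Matrix.det_fin_two_of, ha, hb]) hd
    · obtain ⟨rfl, -, rfl, -⟩ := mat_ext_iff.1 h; rfl
  · rintro (x | x) g hg
    · exact Subgroup.le_normalizer ⟨x.1, x.2, hg⟩
    · exact reflection_mem_nonsplitNormalizer hg
  · intro g hg
    rcases nonsplitNormalizer_cases hp hu hg with ⟨a, b, h⟩ | ⟨a, b, h⟩
    · exact ⟨Sum.inl (a, b), h.symm⟩
    · exact ⟨Sum.inr (a, b), h.symm⟩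

variable {f : PGLp p → ℂ}

/-- On the nontrivial coset only two classes occur, equally often. The last term is literally the
one found for the nonsplit normalizer, which is what allows the two to be compared. -/
theorem four_mul_avgOn_splitNormalizer (hp : 2 < p) (hf : IsClassFun f) {u : ZMod p}
    (hu : ¬ IsSquare u) :
    4 * avgOn (splitNormalizer p) f = 2 * avgOn (splitCartan p) f +
      (matExt f !![0, 1; 1, 0] + matExt f !![0, u; 1, 0]) := by
  have hu0 := ne_zero_of_not_isSquare hu
  have hc : (Nat.card (splitNormalizer p) : ℂ) = 2 * (p - 1) ^ 2 := by
    refine card_of_card_mul ((card_mul_avgOn_splitNormalizer hp 1).trans ?_)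
    have h := sum_antidiag hp (isClassFun_one (p := p)) hu
    rw [matExt_one_eq_one (by simp), matExt_one_eq_one (by simpa)] at h
    rw [sum_matExt_one_splitCartan]
    linear_combination h / 2
  have h := card_mul_avgOn_splitNormalizer hp f
  have h' := sum_antidiag hp hf hu
  have hT := card_mul_avgOn_splitCartan f
  rw [hc, ← hT, card_splitCartan] at h
  refine mul_left_cancel₀ (pow_ne_zero 2 (prime_cast_ne hp).2.1) ?_
  linear_combination 2 * h + h'

theorem four_mul_avgOn_nonsplitNormalizer (hp : 2 < p) (hf : IsClassFun f) {u : ZMod p}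
    (hu : ¬ IsSquare u) :
    4 * avgOn (nonsplitNormalizer u) f = 2 * avgOn (nonsplitCartan u) f +
      (matExt f !![0, 1; 1, 0] + matExt f !![0, u; 1, 0]) := by
  have hu0 := ne_zero_of_not_isSquare hu
  have hc : (Nat.card (nonsplitNormalizer u) : ℂ) = 2 * (p ^ 2 - 1) := by
    refine card_of_card_mul ((card_mul_avgOn_nonsplitNormalizer hp hu 1).trans ?_)
    have h := sum_nonsplit_reflections hp (isClassFun_one (p := p)) hu
    rw [matExt_one_eq_one (by simp), matExt_one_eq_one (by simpa)] at h
    rw [sum_matExt_one_nonsplitCartan hu]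
    linear_combination h / 2
  have h := card_mul_avgOn_nonsplitNormalizer hp hu f
  have h' := sum_nonsplit_reflections hp hf hu
  have hT := card_mul_avgOn_nonsplitCartan (u := u) f
  rw [hc, ← hT, card_nonsplitCartan hu] at h
  have hp2 : (p : ℂ) ^ 2 - 1 ≠ 0 := by
    rw [show (p : ℂ) ^ 2 - 1 = (p - 1) * (p + 1) by ring]
    exact mul_ne_zero (prime_cast_ne hp).2.1 (prime_cast_ne hp).2.2
  refine mul_left_cancel₀ hp2 ?_
  linear_combination 2 * h + h'

end Normalizers

/-! ### Representations of `PGL₂(𝔽_p)` as functions on matrices -/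

section MatRep

variable {p : ℕ} [Fact p.Prime] {V : Type*} [AddCommGroup V] [Module ℂ V]
  (ρ : Representation ℂ (PGLp p) V)

/-- The operators of a representation of `PGL₂(𝔽_p)`, extended by zero to all matrices. -/
def matRep (M : Matrix (Fin 2) (Fin 2) (ZMod p)) : Module.End ℂ V :=
  if h : M.det ≠ 0 then ρ (pglOf M h) else 0

lemma matRep_of_det_ne_zero {M : Matrix (Fin 2) (Fin 2) (ZMod p)} (h : M.det ≠ 0) :
    matRep ρ M = ρ (pglOf M h) := dif_pos h

lemma matRep_of_det_eq_zero {M : Matrix (Fin 2) (Fin 2) (ZMod p)} (h : M.det = 0) :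
    matRep ρ M = 0 := dif_neg (not_not.2 h)

lemma matRep_coe (g : GLp p) : matRep ρ g = ρ (Matrix.ProjGenLinGroup.mk g) := by
  rw [matRep_of_det_ne_zero ρ (det_ne_zero g), pglOf_coe]

lemma matRep_mul (M N : Matrix (Fin 2) (Fin 2) (ZMod p)) :
    matRep ρ M * matRep ρ N = matRep ρ (M * N) := by
  by_cases hM : M.det = 0
  · rw [matRep_of_det_eq_zero ρ hM, zero_mul, matRep_of_det_eq_zero]
    rw [Matrix.det_mul, hM, zero_mul]
  by_cases hN : N.det = 0
  · rw [matRep_of_det_eq_zero ρ hN, mul_zero, matRep_of_det_eq_zero]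
    rw [Matrix.det_mul, hN, mul_zero]
  rw [matRep_of_det_ne_zero ρ hM, matRep_of_det_ne_zero ρ hN, ← map_mul, pglOf_mul,
    matRep_of_det_ne_zero]

lemma matRep_mul_of (a b c d a' b' c' d' : ZMod p) :
    matRep ρ !![a, b; c, d] * matRep ρ !![a', b'; c', d'] =
      matRep ρ !![a * a' + b * c', a * b' + b * d'; c * a' + d * c', c * b' + d * d'] := by
  rw [matRep_mul, Matrix.mul_fin_two]

lemma matRep_smul_of {r : ZMod p} (hr : r ≠ 0) (a b c d : ZMod p) :
    matRep ρ !![r * a, r * b; r * c, r * d] = matRep ρ !![a, b; c, d] := by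
  have e : !![r * a, r * b; r * c, r * d] = r • !![a, b; c, d] := by simp [Matrix.smul_of]
  by_cases h : Matrix.det !![a, b; c, d] = 0
  · rw [matRep_of_det_eq_zero ρ h, matRep_of_det_eq_zero]
    rw [e, Matrix.det_smul, h, mul_zero]
  · have h' : Matrix.det (r • !![a, b; c, d]) ≠ 0 := by
      rw [Matrix.det_smul]
      exact mul_ne_zero (pow_ne_zero _ hr) h
    rw [e, matRep_of_det_ne_zero ρ h, matRep_of_det_ne_zero ρ h', pglOf_smul h]

lemma matRep_scalar {a : ZMod p} (ha : a ≠ 0) : matRep ρ !![a, 0; 0, a] = 1 := by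
  have h := matRep_smul_of ρ ha 1 0 0 1
  simp only [mul_one, mul_zero] at h
  rw [h, ← Matrix.one_fin_two, matRep_of_det_ne_zero ρ (by simp), pglOf_one, map_one]

lemma unipotentHom_eq (x : Multiplicative (ZMod p)) :
    unipotentHom p x = pglOf !![1, x.toAdd; 0, 1] (by simp) := by
  unfold unipotentHom pglOf
  rw [MonoidHom.comp_apply]
  congr 1
  ext i j
  fin_cases i <;> fin_cases j <;> rfl

lemma rho_unipotentHom (x : Multiplicative (ZMod p)) :
    ρ (unipotentHom p x) = matRep ρ !![1, x.toAdd; 0, 1] := by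
  rw [matRep_of_det_ne_zero ρ (by simp), unipotentHom_eq]

lemma exists_matRep (g : PGLp p) : ∃ a b c d : ZMod p, a * d - b * c ≠ 0 ∧
    ρ g = matRep ρ !![a, b; c, d] := by
  obtain ⟨g, rfl⟩ := Matrix.ProjGenLinGroup.mk_surjective g
  refine ⟨g 0 0, g 0 1, g 1 0, g 1 1, ?_, ?_⟩
  · have := det_ne_zero g
    rwa [Matrix.det_fin_two] at this
  · rw [← matRep_coe, ← Matrix.eta_fin_two]

lemma trace_matRep (M : Matrix (Fin 2) (Fin 2) (ZMod p)) :
    LinearMap.trace ℂ V (matRep ρ M) = matExt ρ.character M := by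
  by_cases h : M.det = 0
  · rw [matRep_of_det_eq_zero ρ h, matExt_of_det_eq_zero _ h, map_zero]
  · rw [matRep_of_det_ne_zero ρ h, matExt_of_det_ne_zero _ h]; rfl

lemma isClassFun_character {G W : Type*} [Group G] [AddCommGroup W] [Module ℂ W]
    (σ : Representation ℂ G W) : IsClassFun σ.character := fun g h => char_conj σ g h

lemma matExt_character_one [FiniteDimensional ℂ V] :
    matExt ρ.character !![1, 0; 0, 1] = Module.finrank ℂ V := by
  rw [← trace_matRep, matRep_scalar ρ one_ne_zero, LinearMap.trace_one]

/-- `!![a, b; c, d]` with `c ≠ 0` in the big Bruhat cell. -/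
lemma matRep_bruhat (a b d : ZMod p) {c : ZMod p} (hc : c ≠ 0) :
    matRep ρ !![a, b; c, d] = matRep ρ !![1, a / c; 0, 1] *
      matRep ρ !![0, -(a * d - b * c) / c ^ 2; 1, 0] * matRep ρ !![1, d / c; 0, 1] := by
  rw [← matRep_smul_of ρ hc 0, matRep_mul_of, matRep_mul_of]
  congr 1
  refine mat_eq ?_ ?_ ?_ ?_ <;> field_simp <;> ring

lemma matRep_borel (a b : ZMod p) {d : ZMod p} (hd : d ≠ 0) :
    matRep ρ !![a, b; 0, d] = matRep ρ !![1, b / d; 0, 1] * matRep ρ !![a, 0; 0, d] := by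
  rw [matRep_mul_of]
  congr 1
  refine mat_eq ?_ ?_ ?_ ?_ <;> field_simp <;> ring

lemma matRep_diag_mul_unipotent {a d : ZMod p} (hd : d ≠ 0) (x : ZMod p) :
    matRep ρ !![a, 0; 0, d] * matRep ρ !![1, x; 0, 1] =
      matRep ρ !![1, a * x / d; 0, 1] * matRep ρ !![a, 0; 0, d] := by
  rw [matRep_mul_of, matRep_mul_of]
  congr 1
  refine mat_eq ?_ ?_ ?_ ?_ <;> field_simp <;> ring

end MatRep

/-! ### Isotypic projections for the unipotent group -/

section UnipotentProjection

variable {p : ℕ} [Fact p.Prime] {V : Type*} [AddCommGroup V] [Module ℂ V]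
  (ρ : Representation ℂ (PGLp p) V) (e : AddChar (ZMod p) ℂ)

/-- The projection onto the `e`-isotypic part for the unipotent group. -/
def uProj : Module.End ℂ V := (p : ℂ)⁻¹ • ∑ x : ZMod p, e (-x) • matRep ρ !![1, x; 0, 1]

lemma uProj_mul_unipotent (y : ZMod p) :
    uProj ρ e * matRep ρ !![1, y; 0, 1] = e y • uProj ρ e := by
  rw [uProj, smul_mul_assoc, smul_comm]
  congr 1
  rw [Finset.sum_mul, Finset.smul_sum]
  conv_rhs => rw [← Equiv.sum_comp (Equiv.addRight y)]
  refine Finset.sum_congr rfl fun x _ => ?_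
  rw [smul_mul_assoc, matRep_mul_of, smul_smul, ← AddChar.map_add_eq_mul, Equiv.coe_addRight]
  congr 2
  · ring
  · refine mat_eq ?_ ?_ ?_ ?_ <;> ring

lemma unipotent_mul_uProj (y : ZMod p) :
    matRep ρ !![1, y; 0, 1] * uProj ρ e = e y • uProj ρ e := by
  rw [uProj, mul_smul_comm, smul_comm]
  congr 1
  rw [Finset.mul_sum, Finset.smul_sum]
  conv_rhs => rw [← Equiv.sum_comp (Equiv.addRight y)]
  refine Finset.sum_congr rfl fun x _ => ?_
  rw [mul_smul_comm, matRep_mul_of, smul_smul, ← AddChar.map_add_eq_mul, Equiv.coe_addRight]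
  congr 2
  · ring
  · refine mat_eq ?_ ?_ ?_ ?_ <;> ring

lemma uProj_mul_uProj : uProj ρ e * uProj ρ e = uProj ρ e := by
  have hp0 : (p : ℂ) ≠ 0 := by exact_mod_cast (Fact.out : p.Prime).ne_zero
  conv_lhs => enter [2]; rw [uProj]
  rw [mul_smul_comm, Finset.mul_sum]
  have : ∀ x ∈ Finset.univ, uProj ρ e * (e (-x) • matRep ρ !![1, x; 0, 1]) = uProj ρ e := by
    intro x _
    rw [mul_smul_comm, uProj_mul_unipotent, smul_smul, ← AddChar.map_add_eq_mul, neg_add_cancel,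
      AddChar.map_zero_eq_one, one_smul]
  rw [Finset.sum_congr rfl this, Finset.sum_const, Finset.card_univ, ZMod.card,
    ← Nat.cast_smul_eq_nsmul ℂ, smul_smul, inv_mul_cancel₀ hp0, one_smul]

variable {ρ e} in
lemma uProj_apply_of_forall {v : V} (h : ∀ x, matRep ρ !![1, x; 0, 1] v = e x • v) :
    uProj ρ e v = v := by
  have hp0 : (p : ℂ) ≠ 0 := by exact_mod_cast (Fact.out : p.Prime).ne_zero
  rw [uProj, LinearMap.smul_apply, LinearMap.sum_apply]
  have : ∀ x ∈ Finset.univ, (e (-x) • matRep ρ !![1, x; 0, 1]) v = v := by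
    intro x _
    rw [LinearMap.smul_apply, h, smul_smul, ← AddChar.map_add_eq_mul, neg_add_cancel,
      AddChar.map_zero_eq_one, one_smul]
  rw [Finset.sum_congr rfl this, Finset.sum_const, Finset.card_univ, ZMod.card,
    ← Nat.cast_smul_eq_nsmul ℂ, smul_smul, inv_mul_cancel₀ hp0, one_smul]

lemma unipotent_uProj_apply (x : ZMod p) (v : V) :
    matRep ρ !![1, x; 0, 1] (uProj ρ e v) = e x • uProj ρ e v := by
  rw [← Module.End.mul_apply, unipotent_mul_uProj, LinearMap.smul_apply]

lemma uProj_unipotent_apply (x : ZMod p) (v : V) :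
    uProj ρ e (matRep ρ !![1, x; 0, 1] v) = e x • uProj ρ e v := by
  rw [← Module.End.mul_apply, uProj_mul_unipotent, LinearMap.smul_apply]

variable {e}

lemma eigenspace_unipotent_eq_range {η : Multiplicative (ZMod p) →* ℂˣ}
    (hη : ∀ x, (η (Multiplicative.ofAdd x) : ℂ) = e x) :
    eigenspace (unipotentHom p) η ρ = LinearMap.range (uProj ρ e) := by
  ext v
  rw [mem_eigenspace, LinearMap.mem_range]
  constructor
  · intro h
    refine ⟨v, uProj_apply_of_forall fun x => ?_⟩
    have := h (Multiplicative.ofAdd x)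
    rwa [rho_unipotentHom, hη] at this
  · rintro ⟨w, rfl⟩ x
    rw [rho_unipotentHom, unipotent_uProj_apply]
    congr 1
    exact (hη x.toAdd).symm

/-- All nontrivial unipotents are conjugate, so the character takes two values on `U` and only the
sum of `e` remains. -/
lemma finrank_eigenspace_unipotent [FiniteDimensional ℂ V] {η : Multiplicative (ZMod p) →* ℂˣ}
    (hη : ∀ x, (η (Multiplicative.ofAdd x) : ℂ) = e x) :
    (p : ℂ) * Module.finrank ℂ (eigenspace (unipotentHom p) η ρ) =
      matExt ρ.character !![1, 0; 0, 1] - matExt ρ.character !![1, 1; 0, 1] +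
        matExt ρ.character !![1, 1; 0, 1] * ∑ x, e x := by
  have hc : (p : ℂ) = Nat.card (Multiplicative (ZMod p)) := by
    rw [Nat.card_eq_fintype_card, Fintype.card_multiplicative, ZMod.card]
  rw [finrank_eigenspace, hc, card_mul_avg]
  have h1 : ∑ h : Multiplicative (ZMod p), (((η h)⁻¹ : ℂˣ) : ℂ) * ρ.character (unipotentHom p h) =
      ∑ x : ZMod p, e (-x) * matExt ρ.character !![1, x; 0, 1] := by
    refine Fintype.sum_equiv Multiplicative.toAdd _ _ fun x => ?_
    rw [← trace_matRep, ← rho_unipotentHom, ← hη, ofAdd_neg, map_inv]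
    rfl
  rw [h1, sum_eq_zero_add]
  have h2 : ∀ x : ZMod p, (if x = 0 then 0 else e (-x) * matExt ρ.character !![1, x; 0, 1]) =
      e (-x) * matExt ρ.character !![1, 1; 0, 1] -
        if x = 0 then matExt ρ.character !![1, 1; 0, 1] else 0 := by
    intro x
    split_ifs with hx
    · simp [hx]
    · rw [matExt_unipotent (isClassFun_character ρ) one_ne_zero hx, sub_zero]
  rw [Finset.sum_congr rfl fun x _ => h2 x, Finset.sum_sub_distrib, ← Finset.sum_mul,
    Equiv.sum_comp (Equiv.neg (ZMod p)) e |>.symm]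
  simp only [neg_zero, AddChar.map_zero_eq_one, Finset.sum_ite_eq', Finset.mem_univ, if_true,
    Equiv.neg_apply]
  ring

end UnipotentProjection

/-! ### Uniqueness of Whittaker models -/

/-- If the operators `E g E` commute, the idempotent `E` has rank at most one on an irreducible
representation. -/
lemma finrank_range_le_one {G V : Type*} [Group G] [AddCommGroup V] [Module ℂ V]
    [FiniteDimensional ℂ V] {ρ : Representation ℂ G V} (hρ : ρ.IsIrreducible)
    {E : Module.End ℂ V} (hE : E * E = E)
    (hcomm : ∀ g h, (E * ρ g * E) * (E * ρ h * E) = (E * ρ h * E) * (E * ρ g * E)) :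
    Module.finrank ℂ (LinearMap.range E) ≤ 1 := by
  have hEv : ∀ v ∈ LinearMap.range E, E v = v := by
    rintro _ ⟨w, rfl⟩
    rw [← Module.End.mul_apply, hE]
  -- The translates of `v` span `V`, and applying `E` to them spans its range.
  have hspan : ∀ v ∈ LinearMap.range E, v ≠ 0 → ∀ w ∈ LinearMap.range E,
      w ∈ Submodule.span ℂ (Set.range fun g => (E * ρ g * E) v) := by
    intro v hv hv0 w hw
    have h1 : w ∈ Submodule.map E (Submodule.span ℂ (Set.range fun g => ρ g v)) := by
      rw [span_orbit_eq_top hρ hv0, Submodule.map_top]; exact hw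
    rw [Submodule.map_span, ← Set.range_comp] at h1
    convert h1 using 4
    rename_i g
    simp [hEv v hv]
  by_cases hbot : LinearMap.range E = ⊥
  · rw [hbot]; simp
  obtain ⟨v, hv, hv0⟩ := Submodule.exists_mem_ne_zero_of_ne_bot hbot
  have hmem : ∀ g w, (E * ρ g * E) w ∈ LinearMap.range E := fun g w => ⟨ρ g (E w), rfl⟩
  -- An eigenvector in the range exists over `ℂ`; commutativity carries its eigenvalue to all the
  -- vectors of `hspan`, hence to the whole range.
  have hscal : ∀ g, ∃ c : ℂ, ∀ w ∈ LinearMap.range E, (E * ρ g * E) w = c • w := by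
    intro g
    let T : Module.End ℂ (LinearMap.range E) := (E * ρ g * E).restrict fun w _ => hmem g w
    have : Nontrivial (LinearMap.range E) := (Submodule.nontrivial_iff_ne_bot).2 hbot
    obtain ⟨c, hc⟩ := Module.End.exists_eigenvalue T
    obtain ⟨⟨w₀, hw₀⟩, hw₀'⟩ := hc.exists_hasEigenvector
    have h0 : w₀ ≠ 0 := fun h => hw₀'.2 (Subtype.ext h)
    have h1 : (E * ρ g * E) w₀ = c • w₀ := congrArg Subtype.val hw₀'.apply_eq_smul
    refine ⟨c, fun w hw => ?_⟩
    have h2 := hspan w₀ hw₀ h0 w hw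
    clear hw
    induction h2 using Submodule.span_induction with
    | mem x hx =>
      obtain ⟨h, rfl⟩ := hx
      change (E * ρ g * E) ((E * ρ h * E) w₀) = c • (E * ρ h * E) w₀
      rw [← Module.End.mul_apply, hcomm, Module.End.mul_apply, h1, map_smul]
    | zero => simp
    | add x y _ _ hx hy => rw [map_add, hx, hy, smul_add]
    | smul a x _ hx => rw [map_smul, hx, smul_comm]
  refine (Submodule.finrank_mono (t := Submodule.span ℂ {v}) fun w hw => ?_).trans
    ((finrank_span_le_card ({v} : Set V)).trans (by simp))
  refine (Submodule.span_le (p := Submodule.span ℂ {v})).2 ?_ (hspan v hv hv0 w hw)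
  rintro _ ⟨g, rfl⟩
  obtain ⟨c, hc⟩ := hscal g
  exact Submodule.mem_span_singleton.2 ⟨c, (hc v hv).symm⟩

section Whittaker

variable {p : ℕ} [Fact p.Prime] {V : Type*} [AddCommGroup V] [Module ℂ V]
  (ρ : Representation ℂ (PGLp p) V) {e : AddChar (ZMod p) ℂ}

lemma uProj_unipotent_uProj (M : Module.End ℂ V) (x y : ZMod p) :
    uProj ρ e * (matRep ρ !![1, x; 0, 1] * M * matRep ρ !![1, y; 0, 1]) * uProj ρ e =
      (e x * e y) • (uProj ρ e * M * uProj ρ e) := by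
  rw [← mul_assoc, ← mul_assoc, uProj_mul_unipotent, mul_assoc, unipotent_mul_uProj]
  simp only [smul_mul_assoc, mul_smul_comm, smul_smul, mul_comm]

/-- Conjugation by a nonscalar diagonal matrix moves a nontrivial character of `U` to a different
one, and projections to different characters annihilate each other. -/
lemma uProj_diag_uProj (he : e 1 ≠ 1) {a d : ZMod p} (hd : d ≠ 0) (had : a ≠ d) :
    uProj ρ e * matRep ρ !![a, 0; 0, d] * uProj ρ e = 0 := by
  set Y := uProj ρ e * matRep ρ !![a, 0; 0, d] * uProj ρ e
  have key : ∀ x, e x • Y = e (a * x / d) • Y := by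
    intro x
    have h1 : uProj ρ e * (matRep ρ !![a, 0; 0, d] * matRep ρ !![1, x; 0, 1]) * uProj ρ e =
        e x • Y := by
      rw [mul_assoc, mul_assoc, unipotent_mul_uProj, mul_smul_comm, mul_smul_comm, ← mul_assoc]
    rw [← h1, matRep_diag_mul_unipotent ρ hd, ← mul_assoc, uProj_mul_unipotent, smul_mul_assoc,
      smul_mul_assoc]
  have hda : d - a ≠ 0 := sub_ne_zero.2 had.symm
  -- The argument `x` is chosen so that `x - a * x / d = 1`.
  have h2 := key (d / (d - a))
  have h3 : e (d / (d - a)) = e (a * (d / (d - a)) / d) * e 1 := by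
    rw [← AddChar.map_add_eq_mul]
    congr 1
    field_simp
    ring
  rw [h3, ← sub_eq_zero, ← sub_smul, smul_eq_zero] at h2
  refine h2.resolve_left fun h => ?_
  have h4 : e (a * (d / (d - a)) / d) * (e 1 - 1) = 0 := by linear_combination h
  rcases mul_eq_zero.1 h4 with h5 | h5
  · exact (e.val_isUnit _).ne_zero h5
  · exact he (sub_eq_zero.1 h5)

/-- The operators `E n_δ E` attached to antidiagonal matrices. -/
def bessel (e : AddChar (ZMod p) ℂ) (δ : ZMod p) : Module.End ℂ V :=
  uProj ρ e * matRep ρ !![0, δ; 1, 0] * uProj ρ e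

lemma uProj_matRep_uProj_of_ne (a b d : ZMod p) {c : ZMod p} (hc : c ≠ 0) :
    uProj ρ e * matRep ρ !![a, b; c, d] * uProj ρ e =
      (e (a / c) * e (d / c)) • bessel ρ e (-(a * d - b * c) / c ^ 2) := by
  rw [matRep_bruhat ρ a b d hc, uProj_unipotent_uProj]; rfl

/-- For `x ≠ 0` Bruhat reduction leaves only `e(a/x) e(b/x)` and the product `a b`, both symmetric.
-/
lemma uProj_lower_uProj_comm (he : e 1 ≠ 1) {a b : ZMod p} (ha : a ≠ 0) (hb : b ≠ 0) (x : ZMod p) :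
    uProj ρ e * matRep ρ !![a, 0; x, b] * uProj ρ e =
      uProj ρ e * matRep ρ !![b, 0; x, a] * uProj ρ e := by
  by_cases hx : x = 0
  · subst hx
    by_cases hab : a = b
    · rw [hab]
    · rw [uProj_diag_uProj ρ he hb hab, uProj_diag_uProj ρ he ha (Ne.symm hab)]
  · rw [uProj_matRep_uProj_of_ne ρ _ _ _ hx, uProj_matRep_uProj_of_ne ρ _ _ _ hx]
    congr 1
    · ring
    · congr 2; ring

/-- Expanding the middle projection turns the product of two antidiagonal matrices into an average
of lower triangular matrices with diagonal `a, b`, which is symmetric by `uProj_lower_uProj_comm`.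
-/
lemma bessel_comm (he : e 1 ≠ 1) {a b : ZMod p} (ha : a ≠ 0) (hb : b ≠ 0) :
    bessel ρ e a * bessel ρ e b = bessel ρ e b * bessel ρ e a := by
  have key : ∀ a b : ZMod p, bessel ρ e a * bessel ρ e b = (p : ℂ)⁻¹ • ∑ x : ZMod p,
      e (-x) • (uProj ρ e * matRep ρ !![a, 0; x, b] * uProj ρ e) := by
    intro a b
    have h1 : bessel ρ e a * bessel ρ e b = uProj ρ e * matRep ρ !![0, a; 1, 0] * uProj ρ e *
        (matRep ρ !![0, b; 1, 0] * uProj ρ e) := by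
      simp only [bessel, mul_assoc]
      congr 2
      rw [← mul_assoc (uProj ρ e) (uProj ρ e), uProj_mul_uProj]
    rw [h1]
    conv_lhs => enter [1, 2]; rw [uProj]
    rw [mul_smul_comm, smul_mul_assoc, Finset.mul_sum, Finset.sum_mul]
    congr 1
    refine Finset.sum_congr rfl fun x _ => ?_
    rw [mul_smul_comm, smul_mul_assoc]
    congr 1
    rw [← mul_assoc, mul_assoc (uProj ρ e), mul_assoc (uProj ρ e), matRep_mul_of, matRep_mul_of]
    congr 3
    refine mat_eq ?_ ?_ ?_ ?_ <;> ring
  rw [key, key]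
  congr 1
  refine Finset.sum_congr rfl fun x _ => ?_
  rw [uProj_lower_uProj_comm ρ he ha hb]

/-- By Bruhat decomposition every `E g E` is a multiple of a Bessel operator or of `E`, so these
operators commute. -/
lemma uProj_matRep_uProj_cases (he : e 1 ≠ 1) {a b c d : ZMod p} (h : a * d - b * c ≠ 0) :
    (∃ (r : ℂ) (δ : ZMod p), δ ≠ 0 ∧
      uProj ρ e * matRep ρ !![a, b; c, d] * uProj ρ e = r • bessel ρ e δ) ∨
    ∃ r : ℂ, uProj ρ e * matRep ρ !![a, b; c, d] * uProj ρ e = r • uProj ρ e := by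
  by_cases hc : c = 0
  · right
    subst hc
    have hd : d ≠ 0 := by rintro rfl; simp at h
    rw [matRep_borel ρ a b hd]
    have := uProj_unipotent_uProj ρ (e := e) (matRep ρ !![a, 0; 0, d]) (b / d) 0
    rw [AddChar.map_zero_eq_one, mul_one, matRep_scalar ρ one_ne_zero, mul_one] at this
    rw [this]
    by_cases had : a = d
    · subst had
      exact ⟨e (b / a), by rw [matRep_scalar ρ hd, mul_one, uProj_mul_uProj]⟩
    · exact ⟨0, by rw [uProj_diag_uProj ρ he hd had, smul_zero, zero_smul]⟩
  · left
    refine ⟨_, _, ?_, uProj_matRep_uProj_of_ne ρ a b d hc⟩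
    exact div_ne_zero (neg_ne_zero.2 h) (pow_ne_zero 2 hc)

lemma uProj_bessel (δ : ZMod p) : uProj ρ e * bessel ρ e δ = bessel ρ e δ := by
  rw [bessel, ← mul_assoc, ← mul_assoc, uProj_mul_uProj]

lemma bessel_uProj (δ : ZMod p) : bessel ρ e δ * uProj ρ e = bessel ρ e δ := by
  rw [bessel, mul_assoc, uProj_mul_uProj]

theorem finrank_whittaker_le_one [FiniteDimensional ℂ V] (hρ : ρ.IsIrreducible) (he : e 1 ≠ 1) :
    Module.finrank ℂ (LinearMap.range (uProj ρ e)) ≤ 1 := by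
  refine finrank_range_le_one hρ (uProj_mul_uProj ρ e) fun g h => ?_
  obtain ⟨a, b, c, d, hd, hg⟩ := exists_matRep ρ g
  obtain ⟨a', b', c', d', hd', hh⟩ := exists_matRep ρ h
  rw [hg, hh]
  rcases uProj_matRep_uProj_cases ρ he hd with ⟨r, δ, hδ, h1⟩ | ⟨r, h1⟩ <;>
  rcases uProj_matRep_uProj_cases ρ he hd' with ⟨r', δ', hδ', h2⟩ | ⟨r', h2⟩ <;>
  rw [h1, h2, smul_mul_smul_comm, smul_mul_smul_comm, mul_comm r r']
  · rw [bessel_comm ρ he hδ hδ']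
  · rw [uProj_bessel, bessel_uProj]
  · rw [uProj_bessel, bessel_uProj]

/-- If the unipotent group acts trivially, an irreducible representation is one-dimensional. -/
lemma finrank_eq_one_of_unipotent_trivial [FiniteDimensional ℂ V] (hρ : ρ.IsIrreducible)
    (h : ∀ x : ZMod p, matRep ρ !![1, x; 0, 1] = 1) : Module.finrank ℂ V = 1 := by
  have hlow : matRep ρ !![1, 0; -1, 1] = 1 := by
    have h1 : matRep ρ !![1, 0; -1, 1] = matRep ρ !![0, 1; 1, 0] * matRep ρ !![1, -1; 0, 1] *
        matRep ρ !![0, 1; 1, 0] := by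
      rw [matRep_mul_of, matRep_mul_of]
      congr 1
      refine mat_eq ?_ ?_ ?_ ?_ <;> ring
    rw [h1, h, mul_one, matRep_mul_of, ← matRep_scalar ρ one_ne_zero]
    congr 1
    refine mat_eq ?_ ?_ ?_ ?_ <;> ring
  -- A Weyl element is a product of upper and lower unipotents, all of which act trivially. Every
  -- group element then acts as a diagonal one, and these commute.
  have hw : matRep ρ !![0, 1; -1, 0] = 1 := by
    have h1 : matRep ρ !![0, 1; -1, 0] = matRep ρ !![1, 1; 0, 1] * matRep ρ !![1, 0; -1, 1] *
        matRep ρ !![1, 1; 0, 1] := by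
      rw [matRep_mul_of, matRep_mul_of]
      congr 1
      refine mat_eq ?_ ?_ ?_ ?_ <;> ring
    rw [h1, h, hlow, one_mul, one_mul]
  have hdiag : ∀ g, ∃ a d, ρ g = matRep ρ !![a, 0; 0, d] := by
    intro g
    obtain ⟨a, b, c, d, hd, hg⟩ := exists_matRep ρ g
    by_cases hc : c = 0
    · subst hc
      have hd : d ≠ 0 := by rintro rfl; simp at hd
      exact ⟨a, d, by rw [hg, matRep_borel ρ a b hd, h, one_mul]⟩
    · refine ⟨-1, -(a * d - b * c) / c ^ 2, ?_⟩
      rw [hg, matRep_bruhat ρ a b d hc, h, h, one_mul, mul_one,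
        ← one_mul (matRep ρ !![-1, 0; 0, _]), ← hw, matRep_mul_of]
      congr 1
      refine mat_eq ?_ ?_ ?_ ?_ <;> ring
  refine finrank_eq_one_of_commute hρ fun g g' => ?_
  obtain ⟨a, d, hg⟩ := hdiag g
  obtain ⟨a', d', hg'⟩ := hdiag g'
  rw [hg, hg', matRep_mul_of, matRep_mul_of]
  congr 1
  refine mat_eq ?_ ?_ ?_ ?_ <;> ring

lemma psi_ofAdd (x : ZMod p) :
    (psi p (Multiplicative.ofAdd x) : ℂ) = ZMod.stdAddChar (N := p) x := rfl

lemma stdAddChar_one_ne_one : ZMod.stdAddChar (N := p) 1 ≠ 1 := by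
  intro h
  have : (1 : ZMod p) = 0 := ZMod.injective_stdAddChar (by rw [h, AddChar.map_zero_eq_one])
  exact one_ne_zero this

lemma stdAddChar_ne_zero : ZMod.stdAddChar (N := p) ≠ 0 := by
  intro h
  refine stdAddChar_one_ne_one (p := p) ?_
  rw [h]; rfl

/-- Dimension of the Whittaker space in terms of the character. -/
lemma finrank_whittaker [FiniteDimensional ℂ V] :
    (p : ℂ) * Module.finrank ℂ (eigenspace (unipotentHom p) (psi p) ρ) =
      matExt ρ.character !![1, 0; 0, 1] - matExt ρ.character !![1, 1; 0, 1] := by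
  rw [finrank_eigenspace_unipotent ρ psi_ofAdd, AddChar.sum_eq_zero_iff_ne_zero.2
    stdAddChar_ne_zero, mul_zero, add_zero]

lemma finrank_unipotent_invariants [FiniteDimensional ℂ V] :
    (p : ℂ) * Module.finrank ℂ (LinearMap.range (uProj ρ (0 : AddChar (ZMod p) ℂ))) =
      matExt ρ.character !![1, 0; 0, 1] + (p - 1) * matExt ρ.character !![1, 1; 0, 1] := by
  rw [← eigenspace_unipotent_eq_range (η := 1) ρ (by intro x; simp),
    finrank_eigenspace_unipotent (e := 0) ρ (by intro x; simp)]
  simp only [AddChar.zero_apply, sum_const_zmod]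
  ring

/-- If `ψ` did not occur, the character would agree at `1` and at nontrivial unipotents. The
`U`-invariants would then have full dimension, and trivial action of `U` forces dimension one. -/
theorem finrank_whittaker_eq_one [FiniteDimensional ℂ V] (hp : 2 < p) (hρ : ρ.IsIrreducible)
    (hdim : Module.finrank ℂ V ≠ 1) :
    Module.finrank ℂ (eigenspace (unipotentHom p) (psi p) ρ) = 1 := by
  have hle : Module.finrank ℂ (eigenspace (unipotentHom p) (psi p) ρ) ≤ 1 := by
    rw [eigenspace_unipotent_eq_range ρ psi_ofAdd]
    exact finrank_whittaker_le_one ρ hρ (stdAddChar_one_ne_one)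
  refine le_antisymm hle (Nat.one_le_iff_ne_zero.2 fun h0 => hdim ?_)
  refine finrank_eq_one_of_unipotent_trivial ρ hρ fun x => ?_
  have h1 := finrank_whittaker ρ
  have h2 := finrank_unipotent_invariants ρ
  rw [h0, Nat.cast_zero, mul_zero] at h1
  rw [matExt_character_one] at h1 h2
  have h3 : Module.finrank ℂ (LinearMap.range (uProj ρ (0 : AddChar (ZMod p) ℂ))) =
      Module.finrank ℂ V := by
    have := mul_left_cancel₀ (prime_cast_ne hp).1
      (h2.trans (show _ = (p : ℂ) * (Module.finrank ℂ V : ℂ) by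
        linear_combination (p - 1 : ℂ) * h1))
    exact_mod_cast this
  have h4 := Submodule.eq_top_of_finrank_eq h3
  ext v
  obtain ⟨w, rfl⟩ := LinearMap.range_eq_top.1 h4 v
  rw [unipotent_uProj_apply]
  simp

end Whittaker

/-! ### Dimensions of invariants -/

section Dimensions

variable {p : ℕ} [Fact p.Prime] {V : Type*} [AddCommGroup V] [Module ℂ V]
  {ρ : Representation ℂ (PGLp p) V}

lemma mem_fixedSpace {H : Subgroup (GLp p)} {v : V} :
    v ∈ fixedSpace ρ H ↔ ∀ g ∈ H, matRep ρ g v = v := by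
  rw [fixedSpace, mem_invariants]
  constructor
  · intro h g hg
    rw [matRep_coe]
    exact h ⟨g, hg⟩
  · rintro h ⟨g, hg⟩
    have := h g hg
    rwa [matRep_coe] at this

lemma fixedSpace_mono {H K : Subgroup (GLp p)} (h : H ≤ K) : fixedSpace ρ K ≤ fixedSpace ρ H :=
  fun _ hv => mem_fixedSpace.2 fun g hg => mem_fixedSpace.1 hv g (h hg)

lemma exists_GL_eq {M : Matrix (Fin 2) (Fin 2) (ZMod p)} (h : M.det ≠ 0) :
    ∃ g : GLp p, (g : Matrix (Fin 2) (Fin 2) (ZMod p)) = M :=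
  ⟨Matrix.GeneralLinearGroup.mkOfDetNeZero M h, rfl⟩

lemma fixedSpace_top_eq_bot [FiniteDimensional ℂ V] (hρ : ρ.IsIrreducible)
    (hdim : Module.finrank ℂ V ≠ 1) : fixedSpace ρ ⊤ = ⊥ := by
  have hfix : ∀ v ∈ fixedSpace ρ ⊤, ∀ g, ρ g v = v := by
    intro v hv g
    obtain ⟨g, rfl⟩ := Matrix.ProjGenLinGroup.mk_surjective g
    rw [← matRep_coe]
    exact mem_fixedSpace.1 hv g (Subgroup.mem_top g)
  refine (eq_bot_or_eq_top_of_invariant hρ _ fun g v hv => ?_).resolve_right fun h => hdim ?_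
  · rw [hfix v hv]; exact hv
  · have h1 : ∀ g, ρ g = 1 := fun g => by
      ext v
      exact hfix v (h ▸ Submodule.mem_top) g
    exact finrank_eq_one_of_commute hρ fun g g' => by rw [h1, h1]

variable (ρ) in
/-- The invariants of the unipotent group. -/
abbrev uInvariants : Submodule ℂ V := LinearMap.range (uProj ρ (0 : AddChar (ZMod p) ℂ))

lemma mem_uInvariants {v : V} : v ∈ uInvariants ρ ↔ ∀ x, matRep ρ !![1, x; 0, 1] v = v := by
  constructor
  · rintro ⟨w, rfl⟩ x
    rw [unipotent_uProj_apply]; simp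
  · intro h
    exact ⟨v, uProj_apply_of_forall fun x => by rw [h]; simp⟩

variable [FiniteDimensional ℂ V]

/-- The correction in `avgOn_borel` is `-p` times the Whittaker multiplicity, which is one. -/
theorem finrank_fixedSpace_splitCartan (hp : 2 < p) (hρ : ρ.IsIrreducible)
    (hdim : Module.finrank ℂ V ≠ 1) :
    Module.finrank ℂ (fixedSpace ρ (splitCartan p)) =
      1 + Module.finrank ℂ (fixedSpace ρ (borel p)) := by
  have h1 := avgOn_borel hp (isClassFun_character ρ)
  have h2 := finrank_whittaker ρ
  rw [finrank_whittaker_eq_one ρ hp hρ hdim] at h2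
  rw [← finrank_fixedSpace, ← finrank_fixedSpace] at h1
  have h3 : (Module.finrank ℂ (fixedSpace ρ (splitCartan p)) : ℂ) =
      1 + Module.finrank ℂ (fixedSpace ρ (borel p)) := by
    refine mul_left_cancel₀ (prime_cast_ne hp).1 ?_
    push_cast at h2
    linear_combination -h1 - h2
  exact_mod_cast h3

theorem finrank_fixedSpace_nonsplitCartan (hp : 2 < p) {u : ZMod p} (hu : ¬ IsSquare u)
    (hρ : ρ.IsIrreducible) (hdim : Module.finrank ℂ V ≠ 1) :
    Module.finrank ℂ (fixedSpace ρ (nonsplitCartan u)) +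
      Module.finrank ℂ (fixedSpace ρ (borel p)) = 1 := by
  have h1 := two_mul_avgOn_top hp (isClassFun_character ρ) hu
  have h2 := finrank_fixedSpace_splitCartan hp hρ hdim
  simp only [← finrank_fixedSpace] at h1
  rw [fixedSpace_top_eq_bot hρ hdim, finrank_bot, h2] at h1
  have h3 : (Module.finrank ℂ (fixedSpace ρ (nonsplitCartan u)) : ℂ) +
      Module.finrank ℂ (fixedSpace ρ (borel p)) = 1 := by
    push_cast at h1
    linear_combination -h1
  exact_mod_cast h3

/-- Subtracting the two normalizer formulas cancels the common contribution of the nontrivial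
cosets. -/
theorem finrank_fixedSpace_normalizers (hp : 2 < p) {u : ZMod p} (hu : ¬ IsSquare u) :
    2 * Module.finrank ℂ (fixedSpace ρ (splitNormalizer p)) +
      Module.finrank ℂ (fixedSpace ρ (nonsplitCartan u)) =
    2 * Module.finrank ℂ (fixedSpace ρ (nonsplitNormalizer u)) +
      Module.finrank ℂ (fixedSpace ρ (splitCartan p)) := by
  have h1 := four_mul_avgOn_splitNormalizer hp (isClassFun_character ρ) hu
  have h2 := four_mul_avgOn_nonsplitNormalizer hp (isClassFun_character ρ) hu
  simp only [← finrank_fixedSpace] at h1 h2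
  have h3 : (2 * Module.finrank ℂ (fixedSpace ρ (splitNormalizer p)) +
      Module.finrank ℂ (fixedSpace ρ (nonsplitCartan u)) : ℂ) =
    2 * Module.finrank ℂ (fixedSpace ρ (nonsplitNormalizer u)) +
      Module.finrank ℂ (fixedSpace ρ (splitCartan p)) := by
    linear_combination h1 / 2 - h2 / 2
  exact_mod_cast h3

/-- The multiplicities of `ψ` and of the trivial character of `U` are two linear expressions in the
dimension and the unipotent value; eliminating that value leaves this. -/
theorem finrank_eq_add_uInvariants (hp : 2 < p) (hρ : ρ.IsIrreducible)
    (hdim : Module.finrank ℂ V ≠ 1) :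
    Module.finrank ℂ V + 1 = p + Module.finrank ℂ (uInvariants ρ) := by
  have h1 := finrank_whittaker ρ
  have h2 := finrank_unipotent_invariants ρ
  rw [finrank_whittaker_eq_one ρ hp hρ hdim] at h1
  rw [matExt_character_one] at h1 h2
  have h3 : (Module.finrank ℂ V : ℂ) + 1 = p + Module.finrank ℂ (uInvariants ρ) := by
    refine mul_left_cancel₀ (prime_cast_ne hp).1 ?_
    push_cast at h1
    linear_combination (-(p - 1 : ℂ)) * h1 - h2
  exact_mod_cast h3

theorem matExt_character_unipotent (hp : 2 < p) (hρ : ρ.IsIrreducible)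
    (hdim : Module.finrank ℂ V ≠ 1) :
    matExt ρ.character !![1, 1; 0, 1] = (Module.finrank ℂ V : ℂ) - p := by
  have h1 := finrank_whittaker ρ
  rw [finrank_whittaker_eq_one ρ hp hρ hdim, matExt_character_one] at h1
  push_cast at h1
  linear_combination h1

end Dimensions

/-! ### The Steinberg representation -/

section Steinberg

variable {p : ℕ} [Fact p.Prime] {V : Type*} [AddCommGroup V] [Module ℂ V]
  {ρ : Representation ℂ (PGLp p) V}

lemma rho_mk_of_mem {H : Subgroup (GLp p)} {v : V} (hv : v ∈ fixedSpace ρ H) {g : GLp p}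
    (hg : g ∈ H) : ρ (Matrix.ProjGenLinGroup.mk g) v = v := by
  rw [← matRep_coe]; exact mem_fixedSpace.1 hv g hg

lemma apply_mem_fixedSpace {W : Type*} [AddCommGroup W] [Module ℂ W]
    {σ : Representation ℂ (PGLp p) W} (f : IntertwiningMap ρ σ) {H : Subgroup (GLp p)} {v : V}
    (hv : v ∈ fixedSpace ρ H) : f v ∈ fixedSpace σ H := by
  refine mem_fixedSpace.2 fun g hg => ?_
  rw [matRep_coe, ← IntertwiningMap.isIntertwining, rho_mk_of_mem hv hg]

variable (p) in
/-- The point at infinity of the projective line. -/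
def infty : ℙ (ZMod p) (Fin 2 → ZMod p) :=
  Projectivization.mk (ZMod p) ![1, 0] fun h => one_ne_zero (congrFun h 0)

lemma mk_smul_infty (g : GLp p) : Matrix.ProjGenLinGroup.mk g • infty p =
    Projectivization.mk (ZMod p) (g • ![1, 0])
      ((smul_ne_zero_iff_ne g).2 fun h => one_ne_zero (congrFun h 0)) := rfl

lemma smul_one_zero (g : GLp p) : g • (![1, 0] : Fin 2 → ZMod p) = ![g 0 0, g 1 0] := by
  change (g : Matrix (Fin 2) (Fin 2) (ZMod p)).mulVec _ = _
  ext i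
  fin_cases i <;> simp [Matrix.mulVec, dotProduct, Fin.sum_univ_two]

lemma mk_smul_infty_eq_iff (g : GLp p) :
    Matrix.ProjGenLinGroup.mk g • infty p = infty p ↔ g ∈ borel p := by
  rw [mk_smul_infty, infty, Projectivization.mk_eq_mk_iff', smul_one_zero]
  constructor
  · rintro ⟨a, ha⟩
    have := congrFun ha 1
    change g 1 0 = 0
    simpa using this.symm
  · intro hg
    have : g 1 0 = 0 := hg
    exact ⟨g 0 0, by simp [this]⟩

lemma exists_smul_infty (P : ℙ (ZMod p) (Fin 2 → ZMod p)) :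
    ∃ g : PGLp p, g • infty p = P := by
  induction P using Projectivization.ind with
  | h w hw =>
    by_cases h0 : w 0 = 0
    · have h1 : w 1 ≠ 0 := fun h1 => hw (by ext i; fin_cases i <;> simpa)
      obtain ⟨g, hg⟩ := exists_GL_eq (M := !![0, 1; w 1, 0]) (by simpa [Matrix.det_fin_two] using h1)
      refine ⟨Matrix.ProjGenLinGroup.mk g, ?_⟩
      rw [mk_smul_infty, Projectivization.mk_eq_mk_iff', smul_one_zero, hg]
      exact ⟨1, by ext i; fin_cases i <;> simp [h0]⟩
    · obtain ⟨g, hg⟩ := exists_GL_eq (M := !![w 0, 0; w 1, 1]) (by simpa [Matrix.det_fin_two] using h0)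
      refine ⟨Matrix.ProjGenLinGroup.mk g, ?_⟩
      rw [mk_smul_infty, Projectivization.mk_eq_mk_iff', smul_one_zero, hg]
      exact ⟨1, by ext i; fin_cases i <;> simp⟩

instance : Finite (ℙ (ZMod p) (Fin 2 → ZMod p)) :=
  Quotient.finite _

/-- The stabiliser of infinity is `B`, which fixes `v`, so sending `g • ∞` to `ρ g v` is well
defined. -/
lemma exists_equivariant_map {v : V} (hv : v ∈ fixedSpace ρ (borel p)) :
    ∃ s : ℙ (ZMod p) (Fin 2 → ZMod p) → V, s (infty p) = v ∧ ∀ g P, s (g • P) = ρ g (s P) := by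
  choose r hr using exists_smul_infty (p := p)
  have key : ∀ g h : PGLp p, g • infty p = h • infty p → ρ g v = ρ h v := by
    intro g h e
    obtain ⟨b, hb⟩ := Matrix.ProjGenLinGroup.mk_surjective (h⁻¹ * g)
    have : b ∈ borel p := by
      rw [← mk_smul_infty_eq_iff, hb, mul_smul, e, inv_smul_smul]
    have h2 := rho_mk_of_mem hv this
    rw [hb] at h2
    calc ρ g v = ρ h (ρ (h⁻¹ * g) v) := by rw [← Module.End.mul_apply, ← map_mul, mul_inv_cancel_left]
      _ = _ := by rw [h2]
  refine ⟨fun P => ρ (r P) v, ?_, fun g P => ?_⟩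
  · exact (key _ 1 (by rw [hr, one_smul])).trans (by simp)
  · rw [← Module.End.mul_apply, ← map_mul]
    exact key _ _ (by rw [hr, mul_smul, hr])

/-- Frobenius reciprocity on the projective line: summing over points gives a map from functions to
`V`, and constants land in the `G`-invariants, which vanish. -/
lemma exists_steinberg_map [FiniteDimensional ℂ V] (hρ : ρ.IsIrreducible)
    (hdim : Module.finrank ℂ V ≠ 1) {v : V} (hv : v ∈ fixedSpace ρ (borel p)) (hv0 : v ≠ 0) :
    ∃ f : IntertwiningMap (steinberg p) ρ, f ≠ 0 := by
  classical
  have := Fintype.ofFinite (ℙ (ZMod p) (Fin 2 → ZMod p))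
  obtain ⟨s, hs, hsg⟩ := exists_equivariant_map hv
  let F : (ℙ (ZMod p) (Fin 2 → ZMod p) → ℂ) →ₗ[ℂ] V := Fintype.linearCombination ℂ s
  have hF : ∀ φ, F φ = ∑ P, φ P • s P := fun φ => Fintype.linearCombination_apply ℂ s φ
  have hFg : ∀ g φ, F (functionRep _ _ g φ) = ρ g (F φ) := by
    intro g φ
    rw [hF, hF, map_sum]
    refine (Fintype.sum_equiv (MulAction.toPerm g) _ _ fun P => ?_).symm
    rw [map_smul, ← hsg]
    change _ = φ (g⁻¹ • g • P) • s (g • P)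
    rw [inv_smul_smul]
  have hker : constants _ ≤ LinearMap.ker F := by
    refine Submodule.span_le.2 ?_
    rintro _ rfl
    have : F (fun _ => 1) ∈ fixedSpace ρ ⊤ := by
      refine mem_fixedSpace.2 fun g _ => ?_
      rw [matRep_coe, ← hFg]; rfl
    rwa [fixedSpace_top_eq_bot hρ hdim, Submodule.mem_bot] at this
  let f : IntertwiningMap (steinberg p) ρ := ⟨(constants _).liftQ F hker, fun g => by
    exact Submodule.linearMap_qext _ (LinearMap.ext fun φ => hFg g φ)⟩
  refine ⟨f, fun h => hv0 ?_⟩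
  have h1 : f (Submodule.Quotient.mk (Pi.single (infty p) 1)) = v := by
    change F _ = v
    rw [hF, Finset.sum_eq_single (infty p) (by intro b _ hb; simp [hb]) (by simp)]
    simp [hs]
  rw [← h1, h]; rfl

lemma finrank_steinberg_add_one : Module.finrank ℂ ((ℙ (ZMod p) (Fin 2 → ZMod p) → ℂ) ⧸
    constants (ℙ (ZMod p) (Fin 2 → ZMod p))) + 1 = p + 1 := by
  have := Fintype.ofFinite (ℙ (ZMod p) (Fin 2 → ZMod p))
  have h1 := (constants (ℙ (ZMod p) (Fin 2 → ZMod p))).finrank_quotient_add_finrank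
  have h2 : Module.finrank ℂ (constants (ℙ (ZMod p) (Fin 2 → ZMod p))) = 1 :=
    finrank_span_singleton fun h => one_ne_zero (congrFun h (infty p))
  rw [h2, Module.finrank_fintype_fun_eq_card, ← Nat.card_eq_fintype_card,
    Projectivization.card_of_finrank_two (ZMod p) (Fin 2 → ZMod p) (by simp)] at h1
  simpa using h1

lemma fixedSpace_borel_le_uInvariants : fixedSpace ρ (borel p) ≤ uInvariants ρ := by
  intro v hv
  refine mem_uInvariants.2 fun x => ?_
  obtain ⟨g, hg⟩ := exists_GL_eq (M := !![1, x; 0, 1]) (by simp [Matrix.det_fin_two])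
  rw [← hg]
  exact mem_fixedSpace.1 hv g (by change g 1 0 = 0; simp [hg])

/-- Since `V^B ⊆ V^U`, the dimension of `V` is at least `p`, the dimension of the Steinberg
representation, so the surjection from it is bijective. -/
theorem nonempty_equiv_steinberg [FiniteDimensional ℂ V] (hp : 2 < p) (hρ : ρ.IsIrreducible)
    (hdim : Module.finrank ℂ V ≠ 1) (h : fixedSpace ρ (borel p) ≠ ⊥) :
    Nonempty (ρ.Equiv (steinberg p)) := by
  obtain ⟨v, hv, hv0⟩ := (Submodule.ne_bot_iff _).1 h
  obtain ⟨f, hf⟩ := exists_steinberg_map hρ hdim hv hv0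
  have hsurj := (IsIrreducible.surjective_or_eq_zero f).resolve_right hf
  have h1 := finrank_eq_add_uInvariants hp hρ hdim
  have h2 : 1 ≤ Module.finrank ℂ (uInvariants ρ) :=
    Submodule.one_le_finrank_iff.2 fun h0 => h (le_bot_iff.1 (h0 ▸ fixedSpace_borel_le_uInvariants))
  have h3 := finrank_steinberg_add_one (p := p)
  have h4 : Module.finrank ℂ V ≤ _ := LinearMap.finrank_le_finrank_of_surjective (f := f.toLinearMap) hsurj
  have hinj := (LinearMap.injective_iff_surjective_of_finrank_eq_finrank
    (f := f.toLinearMap) (by omega)).2 hsurj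
  exact ⟨(f.ofBijective ⟨hinj, hsurj⟩).symm⟩

/-- The class of the indicator of infinity is `B`-invariant; a second point of the line shows that
it is not constant. -/
lemma fixedSpace_borel_ne_bot_of_equiv (e : ρ.Equiv (steinberg p)) :
    fixedSpace ρ (borel p) ≠ ⊥ := by
  classical
  have := Fintype.ofFinite (ℙ (ZMod p) (Fin 2 → ZMod p))
  let w : (ℙ (ZMod p) (Fin 2 → ZMod p) → ℂ) ⧸ constants (ℙ (ZMod p) (Fin 2 → ZMod p)) :=
    Submodule.Quotient.mk (Pi.single (infty p) 1)
  have hw : w ∈ fixedSpace (steinberg p) (borel p) := by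
    refine mem_fixedSpace.2 fun g hg => ?_
    rw [matRep_coe]
    refine congrArg Submodule.Quotient.mk ?_
    ext P
    change (Pi.single (infty p) 1 : _ → ℂ) ((Matrix.ProjGenLinGroup.mk g)⁻¹ • P) = _
    rw [Pi.single_apply, Pi.single_apply, inv_smul_eq_iff, (mk_smul_infty_eq_iff g).2 hg]
  have hw0 : w ≠ 0 := by
    intro h
    obtain ⟨c, hc⟩ := Submodule.mem_span_singleton.1 ((Submodule.Quotient.mk_eq_zero _).1 h)
    have h1 := congrFun hc (infty p)
    obtain ⟨g, hg⟩ := exists_GL_eq (p := p) (M := !![0, 1; 1, 0]) (by simp [Matrix.det_fin_two])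
    have h2 := congrFun hc (Matrix.ProjGenLinGroup.mk g • infty p)
    have h3 : Matrix.ProjGenLinGroup.mk g • infty p ≠ infty p := by
      rw [Ne, mk_smul_infty_eq_iff]
      change ¬ (g 1 0 = 0)
      simp [hg]
    rw [Pi.single_eq_of_ne h3] at h2
    rw [Pi.single_eq_same] at h1
    exact one_ne_zero (h1.symm.trans h2)
  refine (Submodule.ne_bot_iff _).2 ⟨e.symm w, apply_mem_fixedSpace e.symm.toIntertwiningMap hw, ?_⟩
  exact fun h => hw0 ((map_eq_zero_iff e.symm e.symm.toLinearEquiv.injective).1 h)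

theorem nonempty_equiv_steinberg_iff [FiniteDimensional ℂ V] (hp : 2 < p) (hρ : ρ.IsIrreducible)
    (hdim : Module.finrank ℂ V ≠ 1) :
    Nonempty (ρ.Equiv (steinberg p)) ↔ fixedSpace ρ (borel p) ≠ ⊥ :=
  ⟨fun ⟨e⟩ => fixedSpace_borel_ne_bot_of_equiv e, nonempty_equiv_steinberg hp hρ hdim⟩

end Steinberg

/-! ### Invariants of the Cartan subgroups and normalizers, Steinberg or not. -/

section Normalizers

variable {p : ℕ} [Fact p.Prime] {V : Type*} [AddCommGroup V] [Module ℂ V]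
  {ρ : Representation ℂ (PGLp p) V} [FiniteDimensional ℂ V]

lemma splitCartan_le_splitNormalizer : splitCartan p ≤ splitNormalizer p := Subgroup.le_normalizer

lemma nonsplitCartan_le_nonsplitNormalizer (u : ZMod p) :
    nonsplitCartan u ≤ nonsplitNormalizer u := Subgroup.le_normalizer

/-- Here `dim V^B ≥ 1`, so `dim V^T' + dim V^B = 1` leaves only `dim V^B = 1` and `dim V^T' = 0`;
the remaining dimensions follow from the linear relations. -/
theorem finrank_fixedSpace_of_equiv_steinberg (hp : 2 < p) {u : ZMod p} (hu : ¬ IsSquare u)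
    (hρ : ρ.IsIrreducible) (hdim : Module.finrank ℂ V ≠ 1)
    (h : Nonempty (ρ.Equiv (steinberg p))) :
    Module.finrank ℂ (fixedSpace ρ (splitCartan p)) = 2 ∧
      Module.finrank ℂ (fixedSpace ρ (splitNormalizer p)) = 1 ∧
      Module.finrank ℂ (fixedSpace ρ (nonsplitCartan u)) = 0 ∧
      Module.finrank ℂ (fixedSpace ρ (nonsplitNormalizer u)) = 0 := by
  have h1 := Submodule.one_le_finrank_iff.2 ((nonempty_equiv_steinberg_iff hp hρ hdim).1 h)
  have h2 := finrank_fixedSpace_splitCartan hp hρ hdim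
  have h3 := finrank_fixedSpace_nonsplitCartan hp hu hρ hdim
  have h4 := finrank_fixedSpace_normalizers (ρ := ρ) hp hu
  have h5 := Submodule.finrank_mono
    (fixedSpace_mono (ρ := ρ) (nonsplitCartan_le_nonsplitNormalizer u))
  omega

theorem finrank_fixedSpace_of_not_equiv_steinberg (hp : 2 < p) {u : ZMod p} (hu : ¬ IsSquare u)
    (hρ : ρ.IsIrreducible) (hdim : Module.finrank ℂ V ≠ 1)
    (h : ¬ Nonempty (ρ.Equiv (steinberg p))) :
    Module.finrank ℂ (fixedSpace ρ (splitCartan p)) = 1 ∧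
      Module.finrank ℂ (fixedSpace ρ (nonsplitCartan u)) = 1 ∧
      Module.finrank ℂ (fixedSpace ρ (splitNormalizer p)) =
        Module.finrank ℂ (fixedSpace ρ (nonsplitNormalizer u)) ∧
      Module.finrank ℂ (fixedSpace ρ (nonsplitNormalizer u)) ≤ 1 := by
  rw [nonempty_equiv_steinberg_iff hp hρ hdim, not_not] at h
  have h2 := finrank_fixedSpace_splitCartan hp hρ hdim
  have h3 := finrank_fixedSpace_nonsplitCartan hp hu hρ hdim
  have h4 := finrank_fixedSpace_normalizers (ρ := ρ) hp hu
  have h5 := Submodule.finrank_mono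
    (fixedSpace_mono (ρ := ρ) (nonsplitCartan_le_nonsplitNormalizer u))
  rw [h, finrank_bot] at h2 h3
  omega

end Normalizers

/-! ### Eigenvectors of the Borel subgroup -/

section BorelEigenvectors

variable {p : ℕ} [Fact p.Prime] {V : Type*} [AddCommGroup V] [Module ℂ V]

/-- Eigenvectors of `B` with the character `!![a, b; 0, d] ↦ χ (a / d)`. -/
structure IsBorelEigenvector (ρ : Representation ℂ (PGLp p) V) (χ : MulChar (ZMod p) ℂ) (v : V) :
    Prop where
  unipotent : ∀ x, matRep ρ !![1, x; 0, 1] v = v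
  torus : ∀ a, a ≠ 0 → matRep ρ !![a, 0; 0, 1] v = χ a • v

variable {ρ : Representation ℂ (PGLp p) V} {χ : MulChar (ZMod p) ℂ} {v : V}

lemma matRep_apply_apply (a b c d a' b' c' d' : ZMod p) (v : V) :
    matRep ρ !![a, b; c, d] (matRep ρ !![a', b'; c', d'] v) =
      matRep ρ !![a * a' + b * c', a * b' + b * d'; c * a' + d * c', c * b' + d * d'] v := by
  rw [← matRep_mul_of]; rfl

lemma matRep_one_apply (v : V) : matRep ρ !![1, 0; 0, 1] v = v := by
  rw [matRep_scalar ρ one_ne_zero]; rfl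

namespace IsBorelEigenvector

lemma borel (h : IsBorelEigenvector ρ χ v) {a d : ZMod p} (ha : a ≠ 0) (hd : d ≠ 0) (b : ZMod p) :
    matRep ρ !![a, b; 0, d] v = χ (a / d) • v := by
  rw [matRep_borel ρ a b hd, Module.End.mul_apply]
  have : matRep ρ !![a, 0; 0, d] = matRep ρ !![a / d, 0; 0, 1] := by
    rw [← matRep_smul_of ρ hd (a / d) 0 0 1, mul_div_cancel₀ _ hd, mul_zero, mul_one]
  rw [this, h.torus _ (div_ne_zero ha hd), map_smul, h.unipotent]

/-- Translates of an eigenvector of `B` by the big Bruhat cell. -/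
lemma unipotent_bigCell (x y : ZMod p) (v : V) :
    matRep ρ !![1, y; 0, 1] (matRep ρ !![x, 1; 1, 0] v) = matRep ρ !![x + y, 1; 1, 0] v := by
  rw [matRep_apply_apply]
  congr 2
  refine mat_eq ?_ ?_ ?_ ?_ <;> ring

lemma torus_bigCell (h : IsBorelEigenvector ρ χ v) {a : ZMod p} (ha : a ≠ 0) (x : ZMod p) :
    matRep ρ !![a, 0; 0, 1] (matRep ρ !![x, 1; 1, 0] v) =
      χ a⁻¹ • matRep ρ !![a * x, 1; 1, 0] v := by
  have h1 := h.borel one_ne_zero ha 0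
  rw [one_div] at h1
  rw [← map_smul, ← h1, matRep_apply_apply, matRep_apply_apply]
  congr 2
  refine mat_eq ?_ ?_ ?_ ?_ <;> ring

lemma antidiag_bigCell_zero (v : V) :
    matRep ρ !![0, 1; 1, 0] (matRep ρ !![0, 1; 1, 0] v) = v := by
  rw [matRep_apply_apply]
  simpa using matRep_one_apply v

lemma antidiag_bigCell (h : IsBorelEigenvector ρ χ v) {x : ZMod p} (hx : x ≠ 0) :
    matRep ρ !![0, 1; 1, 0] (matRep ρ !![x, 1; 1, 0] v) =
      χ (-x ^ 2) • matRep ρ !![x⁻¹, 1; 1, 0] v := by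
  -- From `!![1, 0; x, 1] = !![x⁻¹, 1; 1, 0] * !![x, 1; 0, -x⁻¹]`; the quotient of the diagonal
  -- entries of the last factor is `-x ^ 2`.
  have h1 := h.borel hx (d := -x⁻¹) (by simpa using hx) 1
  rw [show x / -x⁻¹ = -x ^ 2 by field_simp] at h1
  rw [← map_smul, ← h1, matRep_apply_apply, matRep_apply_apply]
  congr 2
  refine mat_eq ?_ ?_ ?_ ?_ <;> field_simp <;> ring

lemma uProj_bigCell (e : AddChar (ZMod p) ℂ) (x : ZMod p) (v : V) :
    uProj ρ e (matRep ρ !![x, 1; 1, 0] v) = e x • uProj ρ e (matRep ρ !![0, 1; 1, 0] v) := by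
  have := unipotent_bigCell (ρ := ρ) 0 x v
  rw [zero_add] at this
  rw [← this, uProj_unipotent_apply]

lemma mem_uInvariants (h : IsBorelEigenvector ρ χ v) : v ∈ uInvariants ρ :=
  CartanInvariants.mem_uInvariants.2 h.unipotent

lemma uProj_zero_apply (h : IsBorelEigenvector ρ χ v) : uProj ρ 0 v = v :=
  uProj_apply_of_forall fun x => by rw [h.unipotent]; simp

/-- If the sum of the big-cell translates vanished, applying the involution and projecting to `V^U`
would leave only the term `x = 0`, which is `v`; the other terms are multiples of the vector assumed
to be zero. -/
lemma uProj_zero_bigCell_ne_zero (h : IsBorelEigenvector ρ χ v) (hv : v ≠ 0) :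
    uProj ρ 0 (matRep ρ !![0, 1; 1, 0] v) ≠ 0 := by
  intro h0
  have h1 : ∑ x : ZMod p, matRep ρ !![x, 1; 1, 0] v = 0 := by
    rw [uProj, LinearMap.smul_apply, smul_eq_zero] at h0
    have h2 := h0.resolve_left (inv_ne_zero (by exact_mod_cast (Fact.out : p.Prime).ne_zero))
    rw [LinearMap.sum_apply] at h2
    rw [← h2]
    refine Finset.sum_congr rfl fun x _ => ?_
    rw [LinearMap.smul_apply, unipotent_bigCell, zero_add]; simp
  have h2 := congrArg (fun z => uProj ρ 0 (matRep ρ !![0, 1; 1, 0] z)) h1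
  simp only [map_zero, map_sum] at h2
  rw [← Finset.add_sum_erase _ _ (Finset.mem_univ 0), antidiag_bigCell_zero, h.uProj_zero_apply,
    Finset.sum_eq_zero, add_zero] at h2
  · exact hv h2
  · intro x hx
    rw [h.antidiag_bigCell (Finset.ne_of_mem_erase hx), map_smul, uProj_bigCell, h0]; simp

/-- This is the standard intertwining operator, which exchanges `χ` and `χ⁻¹`. -/
lemma bigCell_projection (h : IsBorelEigenvector ρ χ v) :
    IsBorelEigenvector ρ χ⁻¹ (uProj ρ 0 (matRep ρ !![0, 1; 1, 0] v)) where
  unipotent x := by rw [unipotent_uProj_apply]; simp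
  torus a ha := by
    rw [uProj, LinearMap.smul_apply, map_smul, smul_comm, LinearMap.sum_apply, map_sum]
    congr 1
    rw [Finset.smul_sum]
    refine Fintype.sum_equiv (Equiv.mulLeft₀ a ha) _ _ fun x => ?_
    simp only [unipotent_bigCell, zero_add, h.torus_bigCell ha,
      AddChar.zero_apply, one_smul, Equiv.mulLeft₀_apply, MulChar.inv_apply']

/-- The orbit of `v` consists of multiples of `v` and of its big-cell translates. The `ψ`-projection
kills `v`, so if it also killed this vector it would vanish on all of `V`, contradicting the
existence of a Whittaker vector. -/
lemma uProj_bigCell_ne_zero (h : IsBorelEigenvector ρ χ v) [FiniteDimensional ℂ V]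
    (hp : 2 < p) (hρ : ρ.IsIrreducible) (hdim : Module.finrank ℂ V ≠ 1) (hv : v ≠ 0) :
    uProj ρ ZMod.stdAddChar (matRep ρ !![0, 1; 1, 0] v) ≠ 0 := by
  intro h0
  have hv0 : uProj ρ ZMod.stdAddChar v = 0 := by
    have h1 := uProj_unipotent_apply ρ (ZMod.stdAddChar (N := p)) 1 v
    rw [h.unipotent] at h1
    have h2 : (1 - ZMod.stdAddChar (N := p) 1) • uProj ρ ZMod.stdAddChar v = 0 := by
      rw [sub_smul, one_smul, ← h1, sub_self]
    exact (smul_eq_zero.1 h2).resolve_left (sub_ne_zero.2 stdAddChar_one_ne_one.symm)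
  have h1 : ∀ w, uProj ρ ZMod.stdAddChar w = 0 := by
    intro w
    have hw : w ∈ Submodule.span ℂ (Set.range fun g => ρ g v) := by
      rw [span_orbit_eq_top hρ hv]; exact Submodule.mem_top
    refine (Submodule.span_le (p := LinearMap.ker (uProj ρ ZMod.stdAddChar))).2 ?_ hw
    rintro _ ⟨g, rfl⟩
    obtain ⟨a, b, c, d, hd, hg⟩ := exists_matRep ρ g
    change uProj ρ _ (ρ g v) = 0
    rw [hg]
    by_cases hc : c = 0
    · subst hc
      rw [mul_zero, sub_zero] at hd
      rw [h.borel (left_ne_zero_of_mul hd) (right_ne_zero_of_mul hd), map_smul, hv0, smul_zero]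
    · have h2 : matRep ρ !![a, b; c, d] v = χ (c / ((b * c - a * d) / c)) •
          matRep ρ !![a / c, 1; 1, 0] v := by
        rw [← map_smul, ← h.borel hc (d := (b * c - a * d) / c) ?_ d, matRep_apply_apply]
        · congr 2
          refine mat_eq ?_ ?_ ?_ ?_ <;> field_simp <;> ring
        · refine div_ne_zero (fun h3 => hd ?_) hc
          linear_combination -h3
      rw [h2, map_smul, uProj_bigCell, h0, smul_zero, smul_zero]
  have h2 := finrank_whittaker_eq_one ρ hp hρ hdim
  rw [eigenspace_unipotent_eq_range ρ psi_ofAdd, LinearMap.range_eq_bot.2 (LinearMap.ext h1),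
    finrank_bot] at h2
  exact zero_ne_one h2

variable (ρ χ v) in
/-- The vector invariant under the diagonal torus attached to an eigenvector of `B`. -/
def torusVector : V := ∑ x : ZMod p, χ⁻¹ x • matRep ρ !![x, 1; 1, 0] v

lemma torus_torusVector (h : IsBorelEigenvector ρ χ v) {a : ZMod p} (ha : a ≠ 0) :
    matRep ρ !![a, 0; 0, 1] (torusVector ρ χ v) = torusVector ρ χ v := by
  rw [torusVector, map_sum]
  refine Fintype.sum_equiv (Equiv.mulLeft₀ a ha) _ _ fun x => ?_
  rw [map_smul, h.torus_bigCell ha, smul_smul, Equiv.mulLeft₀_apply, MulChar.inv_apply',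
    MulChar.inv_apply', mul_inv, map_mul, mul_comm]

/-- Substitute `x ↦ x⁻¹` and use `χ(-x²) χ⁻¹(x) = χ(-1) χ⁻¹(x⁻¹)`; the term at zero vanishes on both
sides. -/
lemma antidiag_torusVector (h : IsBorelEigenvector ρ χ v) :
    matRep ρ !![0, 1; 1, 0] (torusVector ρ χ v) = χ (-1) • torusVector ρ χ v := by
  rw [torusVector, map_sum, Finset.smul_sum]
  refine Fintype.sum_equiv (Equiv.inv (ZMod p)) _ _ fun x => ?_
  by_cases hx : x = 0
  · subst hx; simp [MulChar.map_zero]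
  · rw [map_smul, h.antidiag_bigCell hx, smul_smul, smul_smul, Equiv.inv_apply, MulChar.inv_apply',
      MulChar.inv_apply', inv_inv, ← map_mul, ← map_mul]
    congr 2
    field_simp

/-- The `ψ`-projection of the vector is a Gauss sum of `χ⁻¹` times a nonzero Whittaker vector, and
the Gauss sum of a nontrivial character is nonzero. -/
lemma torusVector_ne_zero (h : IsBorelEigenvector ρ χ v) [FiniteDimensional ℂ V]
    (hp : 2 < p) (hρ : ρ.IsIrreducible) (hdim : Module.finrank ℂ V ≠ 1) (hv : v ≠ 0)
    (hχ : χ ≠ 1) : torusVector ρ χ v ≠ 0 := by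
  intro h0
  have h1 : uProj ρ ZMod.stdAddChar (torusVector ρ χ v) =
      gaussSum χ⁻¹ ZMod.stdAddChar • uProj ρ ZMod.stdAddChar (matRep ρ !![0, 1; 1, 0] v) := by
    rw [torusVector, map_sum, gaussSum, Finset.sum_smul]
    refine Finset.sum_congr rfl fun x _ => ?_
    rw [map_smul, uProj_bigCell, smul_smul]
  rw [h0, map_zero] at h1
  have h2 := (smul_eq_zero.1 h1.symm).resolve_right (h.uProj_bigCell_ne_zero hp hρ hdim hv)
  have h3 := gaussSum_mul_gaussSum_eq_card (χ := χ⁻¹) (by simpa using hχ)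
    (ZMod.isPrimitive_stdAddChar p)
  rw [h2, zero_mul, ZMod.card] at h3
  exact (prime_cast_ne hp).1 h3.symm

end IsBorelEigenvector

end BorelEigenvectors

lemma exists_mem_eigenspace_of_forall {G H V : Type*} [Group G] [Group H] [AddCommGroup V]
    [Module ℂ V] (φ : H →* G) (ρ : Representation ℂ G V) {v : V} (hv : v ≠ 0)
    (h : ∀ x : H, ∃ c : ℂ, ρ (φ x) v = c • v) : ∃ η : H →* ℂˣ, v ∈ eigenspace φ η ρ := by
  choose c hc using h
  let f : H →* ℂ :=
    { toFun := c
      map_one' := smul_left_injective ℂ hv (by simp [← hc])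
      map_mul' := fun x y => smul_left_injective ℂ hv (by
        simp only [← hc, map_mul, Module.End.mul_apply]
        rw [hc y, map_smul, hc x, smul_smul, mul_comm]) }
  exact ⟨f.toHomUnits, mem_eigenspace.2 hc⟩

/-! ### Existence of Borel eigenvectors and consequences of their character. -/

section Torus

variable {p : ℕ} [Fact p.Prime]

variable (p) in
/-- The embedding `a ↦ !![a, 0; 0, 1]` of the torus in `PGL₂(𝔽_p)`. -/
def torusHom : (ZMod p)ˣ →* PGLp p :=
  Matrix.ProjGenLinGroup.mk.comp
    { toFun := fun a => diagGL (a : ZMod p) 1 (by simp)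
      map_one' := GL_ext_of (by
        change !![((1 : (ZMod p)ˣ) : ZMod p), 0; 0, 1] = 1
        rw [Matrix.one_fin_two]; rfl)
      map_mul' := fun a b => GL_ext_of (by
        rw [Matrix.GeneralLinearGroup.coe_mul]
        change !![((a * b : (ZMod p)ˣ) : ZMod p), 0; 0, 1] =
          !![(a : ZMod p), 0; 0, 1] * !![(b : ZMod p), 0; 0, 1]
        rw [Matrix.mul_fin_two]; simp) }

variable {V : Type*} [AddCommGroup V] [Module ℂ V] {ρ : Representation ℂ (PGLp p) V}

lemma rho_torusHom (a : (ZMod p)ˣ) : ρ (torusHom p a) = matRep ρ !![(a : ZMod p), 0; 0, 1] :=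
  (matRep_coe ρ _).symm

lemma coe_of_mem_borel {g : GLp p} (hg : g ∈ borel p) :
    (g : Matrix (Fin 2) (Fin 2) (ZMod p)) = !![g 0 0, g 0 1; 0, g 1 1] ∧
      g 0 0 ≠ 0 ∧ g 1 1 ≠ 0 := by
  have h1 : g 1 0 = 0 := hg
  have h2 := Matrix.eta_fin_two (g : Matrix (Fin 2) (Fin 2) (ZMod p))
  have h3 := det_ne_zero g
  rw [h1] at h2
  rw [h2, Matrix.det_fin_two_of, mul_zero, sub_zero] at h3
  exact ⟨h2, left_ne_zero_of_mul h3, right_ne_zero_of_mul h3⟩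

namespace IsBorelEigenvector

lemma mem_fixedSpace_borel_iff {v : V} :
    v ∈ fixedSpace ρ (CartanInvariants.borel p) ↔ IsBorelEigenvector ρ 1 v := by
  constructor
  · intro h
    have key : ∀ a b : ZMod p, a ≠ 0 → matRep ρ !![a, b; 0, 1] v = v := by
      intro a b ha
      obtain ⟨g, hg⟩ := exists_GL_eq (M := !![a, b; 0, 1]) (by simpa [Matrix.det_fin_two] using ha)
      rw [← hg]
      exact mem_fixedSpace.1 h g (by change g 1 0 = 0; simp [hg])
    refine ⟨fun x => key 1 x one_ne_zero, fun a ha => ?_⟩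
    rw [key a 0 ha, MulChar.one_apply (Ne.isUnit ha), one_smul]
  · intro h
    refine mem_fixedSpace.2 fun g hg => ?_
    obtain ⟨h1, h2, h3⟩ := coe_of_mem_borel hg
    rw [h1, h.borel h2 h3, MulChar.one_apply (Ne.isUnit (div_ne_zero h2 h3)), one_smul]

lemma of_forall (hp : 2 < p) {v : V} (hv : v ≠ 0)
    (h : ∀ a b d : ZMod p, a ≠ 0 → d ≠ 0 → ∃ c : ℂ, matRep ρ !![a, b; 0, d] v = c • v) :
    ∃ χ, IsBorelEigenvector ρ χ v := by
  have h2 := two_ne_zero_of_lt hp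
  have hne : ∀ {a b d : ZMod p} {c : ℂ}, a ≠ 0 → d ≠ 0 → matRep ρ !![a, b; 0, d] v = c • v →
      c ≠ 0 := by
    rintro a b d c ha hd hc rfl
    rw [zero_smul] at hc
    have h3 := congrArg (matRep ρ !![a⁻¹, -b * a⁻¹ * d⁻¹; 0, d⁻¹]) hc
    rw [map_zero, matRep_apply_apply] at h3
    refine hv ?_
    rw [← h3]
    conv_lhs => rw [← matRep_one_apply (ρ := ρ) v]
    congr 2
    refine mat_eq ?_ ?_ ?_ ?_ <;> field_simp <;> ring
  obtain ⟨η, hη⟩ := exists_mem_eigenspace_of_forall (torusHom p) ρ hv fun a => by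
    rw [rho_torusHom]
    exact h a 0 1 a.ne_zero one_ne_zero
  refine ⟨MulChar.ofUnitHom η, fun x => ?_, fun a ha => ?_⟩
  -- Triviality on `U`: the scalar of `2 * x` is `c ^ 2` by multiplicativity and `c` by conjugation
  -- with `diag(2, 1)`, so `c = 1`.
  · obtain ⟨c, hc⟩ := h 1 x 1 one_ne_zero one_ne_zero
    obtain ⟨m, hm⟩ := h 2 0 1 h2 one_ne_zero
    obtain ⟨c', hc'⟩ := h 1 (2 * x) 1 one_ne_zero one_ne_zero
    have e1 : c' • v = (c * c) • v := by
      rw [← hc', ← smul_smul, ← hc, ← map_smul, ← hc, matRep_apply_apply]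
      congr 2
      refine mat_eq ?_ ?_ ?_ ?_ <;> ring
    have e2 : (m * c') • v = (c * m) • v := by
      rw [← smul_smul, ← smul_smul, ← hc', ← hm, ← map_smul, ← map_smul, ← hc, ← hm,
        matRep_apply_apply, matRep_apply_apply]
      congr 2
      refine mat_eq ?_ ?_ ?_ ?_ <;> ring
    have e3 := smul_left_injective ℂ hv e1
    have e4 := smul_left_injective ℂ hv e2
    have e5 : c = 1 := by
      have hm0 := hne h2 one_ne_zero hm
      have hc0 := hne one_ne_zero one_ne_zero hc
      subst e3
      have : m * c * (c - 1) = 0 := by linear_combination e4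
      rcases mul_eq_zero.1 this with h3 | h3
      · exact absurd h3 (mul_ne_zero hm0 hc0)
      · exact sub_eq_zero.1 h3
    rw [hc, e5, one_smul]
  · lift a to (ZMod p)ˣ using Ne.isUnit ha
    rw [← rho_torusHom, mem_eigenspace.1 hη, MulChar.ofUnitHom_coe]

/-- The torus modulo scalars is cyclic and preserves `V^U`, so an eigenvector of a generator there
is an eigenvector of all of `B`. -/
lemma exists_of_uInvariants_ne_bot [FiniteDimensional ℂ V] (hp : 2 < p) (h : uInvariants ρ ≠ ⊥) :
    ∃ (v : V) (χ : MulChar (ZMod p) ℂ), v ≠ 0 ∧ IsBorelEigenvector ρ χ v := by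
  obtain ⟨a, ha⟩ := IsCyclic.exists_generator (α := (ZMod p)ˣ)
  have hinv : ∀ w ∈ uInvariants ρ, matRep ρ !![(a : ZMod p), 0; 0, 1] w ∈ uInvariants ρ := by
    intro w hw
    refine CartanInvariants.mem_uInvariants.2 fun x => ?_
    have h1 := CartanInvariants.mem_uInvariants.1 hw (x / a)
    conv_rhs => rw [← h1]
    rw [matRep_apply_apply, matRep_apply_apply]
    congr 2
    refine mat_eq ?_ ?_ ?_ ?_ <;> field_simp <;> ring
  have : Nontrivial (uInvariants ρ) := Submodule.nontrivial_iff_ne_bot.2 h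
  obtain ⟨c, hc⟩ := Module.End.exists_eigenvalue ((matRep ρ !![(a : ZMod p), 0; 0, 1]).restrict hinv)
  obtain ⟨⟨v, hvU⟩, hv⟩ := hc.exists_hasEigenvector
  have hv0 : v ≠ 0 := fun h0 => hv.2 (Subtype.ext h0)
  have hv1 : matRep ρ !![(a : ZMod p), 0; 0, 1] v = c • v :=
    congrArg Subtype.val (Module.End.mem_eigenspace_iff.1 hv.1)
  have hpow : ∀ k : ℕ, matRep ρ !![(a : ZMod p) ^ k, 0; 0, 1] v = c ^ k • v := by
    intro k
    induction k with
    | zero => simpa using matRep_one_apply v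
    | succ k ih =>
      rw [pow_succ c, mul_smul, ← hv1, ← map_smul, ← ih, matRep_apply_apply]
      congr 2
      refine mat_eq ?_ ?_ ?_ ?_ <;> ring
  obtain ⟨χ, hχ⟩ := of_forall hp hv0 (ρ := ρ) fun x b d hx hd => by
    obtain ⟨k, hk⟩ := (mem_powers_iff_mem_zpowers.2 (ha (Units.mk0 (x / d) (div_ne_zero hx hd))))
    have hk' : (a : ZMod p) ^ k = x / d := by
      have := congrArg Units.val hk
      simpa using this
    refine ⟨c ^ k, ?_⟩
    rw [← hpow, hk']
    conv_rhs => rw [← CartanInvariants.mem_uInvariants.1 hvU (b / x)]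
    rw [matRep_apply_apply]
    symm
    rw [← matRep_smul_of ρ hd]
    congr 2
    refine mat_eq ?_ ?_ ?_ ?_ <;> field_simp <;> ring
  exact ⟨v, χ, hv0, hχ⟩

/-- The central statement on the principal series: the invariants of the split normalizer are
determined by the parity of the character. -/
lemma finrank_fixedSpace_splitNormalizer_eq_one_iff {v : V} {χ : MulChar (ZMod p) ℂ}
    (h : IsBorelEigenvector ρ χ v) [FiniteDimensional ℂ V] (hp : 2 < p) (hρ : ρ.IsIrreducible)
    (hdim : Module.finrank ℂ V ≠ 1) (hv : v ≠ 0) (hχ : χ ≠ 1)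
    (hT : Module.finrank ℂ (fixedSpace ρ (splitCartan p)) = 1) :
    Module.finrank ℂ (fixedSpace ρ (splitNormalizer p)) = 1 ↔ χ (-1) = 1 := by
  have hle := Submodule.finrank_mono
    (fixedSpace_mono (ρ := ρ) (splitCartan_le_splitNormalizer (p := p)))
  set f := torusVector ρ χ v
  have hf0 : f ≠ 0 := h.torusVector_ne_zero hp hρ hdim hv hχ
  have hdiag : ∀ a d : ZMod p, a ≠ 0 → d ≠ 0 → matRep ρ !![a, 0; 0, d] f = f := by
    intro a d ha hd
    have h1 := h.torus_torusVector (div_ne_zero ha hd)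
    rw [← matRep_smul_of ρ hd, mul_div_cancel₀ _ hd, mul_zero, mul_one] at h1
    exact h1
  have hfT : f ∈ fixedSpace ρ (splitCartan p) := by
    refine mem_fixedSpace.2 fun g hg => ?_
    obtain ⟨h1, h2, h3⟩ := coe_of_mem_borel hg.2
    rw [h1, show g 0 1 = 0 from hg.1]
    exact hdiag _ _ h2 h3
  obtain ⟨w, hw⟩ := exists_GL_eq (p := p) (M := !![0, 1; 1, 0]) (by simp [Matrix.det_fin_two])
  have hwN : w ∈ splitNormalizer p := antidiag_mem_splitNormalizer hw
  constructor
  · intro hN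
    obtain ⟨x, hx, hx0⟩ := (Submodule.ne_bot_iff _).1
      (Submodule.one_le_finrank_iff.1 hN.ge)
    -- `V^T` is the line through `f`, so an `N`-invariant vector is a multiple of `f`, on which the
    -- involution acts by `χ (-1)`.
    obtain ⟨c, hc⟩ := (finrank_eq_one_iff_of_nonzero' (⟨f, hfT⟩ : fixedSpace ρ (splitCartan p))
      (fun h0 => hf0 (congrArg Subtype.val h0))).1 hT
      ⟨x, fixedSpace_mono splitCartan_le_splitNormalizer hx⟩
    have hc' : c • f = x := congrArg Subtype.val hc
    have hwx := mem_fixedSpace.1 hx w hwN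
    rw [hw, ← hc', map_smul, h.antidiag_torusVector, smul_comm] at hwx
    rw [← hc'] at hx0
    refine smul_left_injective ℂ hx0 ?_
    simpa using hwx
  · intro hχ1
    have hfN : f ∈ fixedSpace ρ (splitNormalizer p) := by
      refine mem_fixedSpace.2 fun g hg => ?_
      rcases splitNormalizer_cases hp hg with h1 | h1
      · exact mem_fixedSpace.1 hfT g h1
      · have h2 := Matrix.eta_fin_two (g : Matrix (Fin 2) (Fin 2) (ZMod p))
        have h3 := det_ne_zero g
        rw [h1.1, h1.2] at h2
        rw [h2, Matrix.det_fin_two_of, zero_mul, zero_sub, neg_ne_zero] at h3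
        have h4 := hdiag _ _ (left_ne_zero_of_mul h3) (right_ne_zero_of_mul h3)
        have h5 : matRep ρ !![0, 1; 1, 0] f = f :=
          h.antidiag_torusVector.trans (by rw [hχ1, one_smul])
        rw [h2]
        conv_rhs => rw [← h4]
        conv_lhs => rw [← h5]
        rw [matRep_apply_apply]
        congr 2
        refine mat_eq ?_ ?_ ?_ ?_ <;> ring
    have := Submodule.one_le_finrank_iff.2 ((Submodule.ne_bot_iff _).2 ⟨f, hfN, hf0⟩)
    omega

/-- An irreducible representation with an eigenvector of `B` whose character has nontrivial square
has dimension at least `p + 1`. -/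
lemma le_finrank {v : V} {χ : MulChar (ZMod p) ℂ}
    (h : IsBorelEigenvector ρ χ v) [FiniteDimensional ℂ V] (hp : 2 < p) (hρ : ρ.IsIrreducible)
    (hdim : Module.finrank ℂ V ≠ 1) (hv : v ≠ 0) (hχ : χ ^ 2 ≠ 1) :
    p + 1 ≤ Module.finrank ℂ V := by
  have h1 := finrank_eq_add_uInvariants hp hρ hdim
  have h2 := h.bigCell_projection
  set v' := uProj ρ 0 (matRep ρ !![0, 1; 1, 0] v)
  have hv' : v' ≠ 0 := h.uProj_zero_bigCell_ne_zero hv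
  have hne : ∃ a : (ZMod p)ˣ, χ a ≠ χ⁻¹ a := by
    by_contra! h3
    refine hχ ?_
    have : χ = χ⁻¹ := MulChar.ext h3
    rw [sq]
    conv_lhs => rw [this]
    rw [← sq]
    nth_rewrite 1 [sq]
    nth_rewrite 2 [← this]
    simp
  obtain ⟨a, ha⟩ := hne
  -- As `χ` and `χ⁻¹` differ, `v` and its image `v'` under the intertwining operator are independent
  -- in `V^U`.
  have h3 : 2 ≤ Module.finrank ℂ (uInvariants ρ) := by
    by_contra! h4
    have h5 : 1 ≤ Module.finrank ℂ (uInvariants ρ) :=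
      Submodule.one_le_finrank_iff.2 ((Submodule.ne_bot_iff _).2 ⟨v, h.mem_uInvariants, hv⟩)
    have h7 : Module.finrank ℂ (uInvariants ρ) = 1 := le_antisymm (Nat.lt_succ_iff.1 h4) h5
    obtain ⟨c, hc⟩ := (finrank_eq_one_iff_of_nonzero' (⟨v, h.mem_uInvariants⟩ : uInvariants ρ)
      (fun h0 => hv (congrArg Subtype.val h0))).1 (by exact h7) ⟨v', h2.mem_uInvariants⟩
    have hc' : c • v = v' := congrArg Subtype.val hc
    have h6 := h2.torus a a.ne_zero
    rw [← hc', map_smul, h.torus a a.ne_zero, smul_comm] at h6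
    rw [← hc'] at hv'
    exact ha (smul_left_injective ℂ hv' h6)
  omega

end IsBorelEigenvector

end Torus

/-! ### Characters of `B/Z` and the principal series. -/

section BorelCharacters

variable {p : ℕ} [Fact p.Prime] {V : Type*} [AddCommGroup V] [Module ℂ V]
  {ρ : Representation ℂ (PGLp p) V}

namespace IsBorelEigenvector

variable {v : V} {χ : MulChar (ZMod p) ℂ} {μ : modZ (CartanInvariants.borel p) →* ℂˣ}

lemma exists_mem_eigenspace (h : IsBorelEigenvector ρ χ v) (hv : v ≠ 0) :
    ∃ μ : modZ (CartanInvariants.borel p) →* ℂˣ,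
      v ∈ eigenspace (modZ (CartanInvariants.borel p)).subtype μ ρ := by
  refine exists_mem_eigenspace_of_forall _ ρ hv ?_
  rintro ⟨_, g, hg, rfl⟩
  obtain ⟨h1, h2, h3⟩ := coe_of_mem_borel hg
  refine ⟨χ (g 0 0 / g 1 1), ?_⟩
  change ρ (Matrix.ProjGenLinGroup.mk g) v = _
  rw [← matRep_coe, h1, h.borel h2 h3]; rfl

lemma of_mem_eigenspace (hp : 2 < p) (hv : v ≠ 0)
    (h : v ∈ eigenspace (modZ (CartanInvariants.borel p)).subtype μ ρ) :
    ∃ χ, IsBorelEigenvector ρ χ v := by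
  refine of_forall hp hv fun a b d ha hd => ?_
  obtain ⟨g, hg⟩ := exists_GL_eq (M := !![a, b; 0, d]) (by
    simpa [Matrix.det_fin_two] using ⟨ha, hd⟩)
  have hgB : g ∈ CartanInvariants.borel p := by change g 1 0 = 0; simp [hg]
  refine ⟨μ ⟨_, Subgroup.mem_map_of_mem _ hgB⟩, ?_⟩
  rw [← hg, matRep_coe]
  exact mem_eigenspace.1 h ⟨_, Subgroup.mem_map_of_mem _ hgB⟩

lemma apply_eq (h : IsBorelEigenvector ρ χ v) (hv : v ≠ 0)
    (hμ : v ∈ eigenspace (modZ (CartanInvariants.borel p)).subtype μ ρ) {g : GLp p}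
    (hg : g ∈ CartanInvariants.borel p) :
    (μ ⟨_, Subgroup.mem_map_of_mem Matrix.ProjGenLinGroup.mk hg⟩ : ℂ) = χ (g 0 0 / g 1 1) := by
  refine smul_left_injective ℂ hv ?_
  obtain ⟨h1, h2, h3⟩ := coe_of_mem_borel hg
  change _ • v = _ • v
  rw [← mem_eigenspace.1 hμ, ← h.borel h2 h3 (g 0 1), ← h1, matRep_coe]
  rfl

lemma sq_eq_one_iff (h : IsBorelEigenvector ρ χ v) (hv : v ≠ 0)
    (hμ : v ∈ eigenspace (modZ (CartanInvariants.borel p)).subtype μ ρ) :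
    μ ^ 2 = 1 ↔ χ ^ 2 = 1 := by
  constructor
  · intro h1
    refine MulChar.ext fun a => ?_
    have hg : diagGL (a : ZMod p) 1 (by simp) ∈ CartanInvariants.borel p := by
      change (!![(a : ZMod p), 0; 0, 1] : Matrix _ _ _) 1 0 = 0; simp
    have h2 := h.apply_eq hv hμ hg
    have h3 : χ (a : ZMod p) = μ ⟨_, Subgroup.mem_map_of_mem Matrix.ProjGenLinGroup.mk hg⟩ := by
      rw [h2]
      change _ = χ ((!![(a : ZMod p), 0; 0, 1] : Matrix _ _ _) 0 0 /
        (!![(a : ZMod p), 0; 0, 1] : Matrix _ _ _) 1 1)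
      simp
    rw [MulChar.pow_apply_coe, h3, MulChar.one_apply_coe, ← Units.val_pow_eq_pow_val,
      ← MonoidHom.pow_apply, h1]
    rfl
  · intro h1
    refine MonoidHom.ext ?_
    rintro ⟨_, g, hg, rfl⟩
    obtain ⟨-, h2, h3⟩ := coe_of_mem_borel hg
    refine Units.ext ?_
    rw [MonoidHom.pow_apply, Units.val_pow_eq_pow_val]
    change (μ ⟨_, Subgroup.mem_map_of_mem Matrix.ProjGenLinGroup.mk hg⟩ : ℂ) ^ 2 = 1
    rw [h.apply_eq hv hμ hg, ← MulChar.pow_apply' _ two_ne_zero, h1,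
      MulChar.one_apply (Ne.isUnit (div_ne_zero h2 h3))]

/-- The only element of order two in `T/Z` is the class of `diag(-1, 1)`: if the square of a
diagonal matrix is scalar, its entries are equal, giving the identity, or opposite. -/
lemma isEvenChar_iff (h : IsBorelEigenvector ρ χ v) (hp : 2 < p) (hv : v ≠ 0)
    (hμ : v ∈ eigenspace (modZ (CartanInvariants.borel p)).subtype μ ρ) :
    IsEvenChar (restrictToTorus μ) ↔ χ (-1) = 1 := by
  have h2 := two_ne_zero_of_lt hp
  constructor
  · intro he
    set t := diagGL (-1 : ZMod p) 1 (by simp) with ht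
    have htv : (t : Matrix (Fin 2) (Fin 2) (ZMod p)) = !![-1, 0; 0, 1] := rfl
    have htT : t ∈ splitCartan p := by constructor <;> simp [htv]
    have h3 := he ⟨_, Subgroup.mem_map_of_mem Matrix.ProjGenLinGroup.mk htT⟩ (by
      refine orderOf_eq_prime ?_ ?_
      · refine Subtype.ext ?_
        change Matrix.ProjGenLinGroup.mk t ^ 2 = 1
        have : t ^ 2 = 1 := GL_ext_of (by
          rw [sq, Matrix.GeneralLinearGroup.coe_mul, htv, Matrix.mul_fin_two]
          simp [Matrix.one_fin_two])
        rw [← map_pow, this, map_one]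
      · intro h4
        have h5 : Matrix.ProjGenLinGroup.mk t = Matrix.ProjGenLinGroup.mk 1 :=
          congrArg Subtype.val h4
        obtain ⟨z, hz⟩ := Matrix.ProjGenLinGroup.mk_eq_mk_iff.1 h5.symm
        have h6 := congrArg (fun g : GLp p => g 0 0) hz
        have h7 := congrArg (fun g : GLp p => g 1 1) hz
        simp [htv] at h6 h7
        have h8 := congrArg Units.val (h6.symm.trans h7)
        rw [Units.val_neg, Units.val_one] at h8
        exact h2 (by linear_combination -h8))
    have h4 := h.apply_eq hv hμ htT.2
    have h5 : (μ ⟨_, Subgroup.mem_map_of_mem Matrix.ProjGenLinGroup.mk htT.2⟩ : ℂ) = 1 :=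
      congrArg Units.val h3
    rw [h5, htv] at h4
    simpa using h4.symm
  · rintro he ⟨_, g, hg, rfl⟩ hc
    obtain ⟨h1, h3, h4⟩ := coe_of_mem_borel hg.2
    obtain ⟨h5, h6⟩ := orderOf_eq_prime_iff.1 hc
    have h5 : Matrix.ProjGenLinGroup.mk 1 = Matrix.ProjGenLinGroup.mk (g ^ 2) := by
      rw [map_pow, map_one]; exact (congrArg Subtype.val h5).symm
    obtain ⟨z, hz⟩ := Matrix.ProjGenLinGroup.mk_eq_mk_iff.1 h5
    rw [show g 0 1 = 0 from hg.1] at h1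
    have h7 := congrArg (fun g : GLp p => (g : Matrix (Fin 2) (Fin 2) (ZMod p))) hz
    simp only [one_mul, sq, Matrix.GeneralLinearGroup.coe_mul] at h7
    have h8 := congrFun (congrFun h7 0) 0
    have h9 := congrFun (congrFun h7 1) 1
    rw [h1] at h8 h9
    simp at h8 h9
    have h10 : (g 0 0 - g 1 1) * (g 0 0 + g 1 1) = 0 := by linear_combination h9 - h8
    refine Units.ext ?_
    change (μ ⟨_, Subgroup.mem_map_of_mem Matrix.ProjGenLinGroup.mk hg.2⟩ : ℂ) = 1
    rw [h.apply_eq hv hμ hg.2]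
    rcases mul_eq_zero.1 h10 with h11 | h11
    · exfalso
      refine h6 (Subtype.ext ?_)
      change Matrix.ProjGenLinGroup.mk g = 1
      rw [← Matrix.ProjGenLinGroup.mk_scalar (Units.mk0 _ h4)]
      congr 1
      refine GL_ext_of ?_
      have e0 := sub_eq_zero.1 h11
      have e1 : g 0 1 = 0 := hg.1
      have e2 : g 1 0 = 0 := hg.2
      ext i j
      fin_cases i <;> fin_cases j <;> simp [e0, e1, e2]
    · rw [eq_neg_of_add_eq_zero_left h11, neg_div, div_self h4, he]

end IsBorelEigenvector

/-- By Bruhat decomposition, `1` and the `p` elements `s x` represent all the cosets of `B`. -/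
lemma finrank_principalSeries_le (μ : modZ (borel p) →* ℂˣ) :
    Module.finrank ℂ (IndV (modZ (borel p)).subtype (charRep μ)) ≤ p + 1 := by
  classical
  let s : ZMod p → PGLp p := fun x => pglOf !![0, 1; 1, x] (by simp [Matrix.det_fin_two])
  refine (finrank_ind_le _ μ (insert 1 (Finset.univ.image s)) fun g => ?_).trans ?_
  · obtain ⟨g, rfl⟩ := Matrix.ProjGenLinGroup.mk_surjective g
    by_cases hg : g 1 0 = 0
    · exact ⟨⟨_, Subgroup.mem_map_of_mem Matrix.ProjGenLinGroup.mk hg⟩, 1,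
        Finset.mem_insert_self _ _, (mul_one _).symm⟩
    · have hd := det_ne_zero g
      rw [Matrix.det_fin_two] at hd
      obtain ⟨b, hb⟩ := exists_GL_eq (M := !![(g 0 1 * g 1 0 - g 0 0 * g 1 1) / g 1 0, g 0 0; 0, g 1 0])
        (by
          rw [Matrix.det_fin_two_of, div_mul_cancel₀ _ hg]
          intro h; exact hd (by linear_combination -h))
      have hbB : b ∈ borel p := by change b 1 0 = 0; simp [hb]
      refine ⟨⟨_, Subgroup.mem_map_of_mem Matrix.ProjGenLinGroup.mk hbB⟩, s (g 1 1 / g 1 0),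
        Finset.mem_insert_of_mem (Finset.mem_image_of_mem _ (Finset.mem_univ _)), ?_⟩
      change _ = Matrix.ProjGenLinGroup.mk b * s _
      rw [← pglOf_coe g (det_ne_zero g), ← pglOf_coe b (det_ne_zero b), pglOf_mul]
      congr 1
      rw [hb, Matrix.mul_fin_two]
      conv_lhs => rw [Matrix.eta_fin_two (g : Matrix (Fin 2) (Fin 2) (ZMod p))]
      refine mat_eq ?_ ?_ ?_ ?_ <;> field_simp <;> ring
  · refine (Finset.card_insert_le _ _).trans (Nat.succ_le_succ (Finset.card_image_le.trans ?_))
    rw [Finset.card_univ, ZMod.card]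

/-- Frobenius reciprocity for the principal series. -/
lemma nonempty_equiv_principalSeries [FiniteDimensional ℂ V] (hρ : ρ.IsIrreducible)
    {μ : modZ (borel p) →* ℂˣ} {v : V} (hv : v ≠ 0)
    (hμ : v ∈ eigenspace (modZ (borel p)).subtype μ ρ) (hdim : p + 1 ≤ Module.finrank ℂ V) :
    Nonempty (ρ.Equiv (principalSeries μ)) := by
  let f : IntertwiningMap (principalSeries μ) ρ :=
    (indHomEquiv (modZ (borel p)).subtype μ ρ).symm ⟨v, hμ⟩
  have hf : f ≠ 0 := by
    intro h
    exact hv (congrArg Subtype.val ((LinearEquiv.map_eq_zero_iff _).1 h))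
  have hsurj := (IsIrreducible.surjective_or_eq_zero f).resolve_right hf
  have h1 := finrank_principalSeries_le μ
  have h2 : Module.finrank ℂ V ≤ _ :=
    LinearMap.finrank_le_finrank_of_surjective (f := f.toLinearMap) hsurj
  have hinj := (LinearMap.injective_iff_surjective_of_finrank_eq_finrank
    (f := f.toLinearMap) (by omega)).2 hsurj
  exact ⟨(f.ofBijective ⟨hinj, hsurj⟩).symm⟩

lemma exists_mem_eigenspace_of_equiv {G H V : Type*} [Group G] [Group H] [AddCommGroup V]
    [Module ℂ V] {ρ : Representation ℂ G V} (hρ : ρ.IsIrreducible) (φ : H →* G) (η : H →* ℂˣ) (e : ρ.Equiv (ind φ (charRep η))) :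
    ∃ v : V, v ≠ 0 ∧ v ∈ eigenspace φ η ρ := by
  have := nontrivial_of_isIrreducible hρ
  let f : IntertwiningMap (ind φ (charRep η)) ρ := e.symm.toIntertwiningMap
  have hf : f ≠ 0 := by
    intro h
    obtain ⟨v, hv⟩ := exists_ne (0 : V)
    have h1 : f (e v) = v := e.symm_apply_apply v
    rw [h] at h1
    exact hv h1.symm
  exact ⟨indHomEquiv φ η ρ f, fun h => hf ((LinearEquiv.map_eq_zero_iff (indHomEquiv φ η ρ)).1
    (Subtype.ext h)), (indHomEquiv φ η ρ f).2⟩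

/-! ### Twisting by the quadratic character -/

/-- The intertwining equivalence of twists. -/
lemma nonempty_twist_equiv {G V W : Type*} [Group G] [AddCommGroup V] [Module ℂ V]
    [AddCommGroup W] [Module ℂ W] {ρ : Representation ℂ G V} {σ : Representation ℂ G W}
    (χ : G →* ℂˣ) (h : Nonempty (ρ.Equiv σ)) : Nonempty ((twist χ ρ).Equiv (twist χ σ)) := by
  obtain ⟨e⟩ := h
  refine ⟨Representation.Equiv.mk e.toLinearEquiv fun g => LinearMap.ext fun v => ?_⟩
  change e ((χ g : ℂ) • ρ g v) = (χ g : ℂ) • σ g (e v)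
  rw [map_smul]
  exact congrArg _ (IntertwiningMap.isIntertwining _ _ e.toIntertwiningMap g v)

lemma omega_mk (g : GLp p) : (omega p (Matrix.ProjGenLinGroup.mk g) : ℂ) =
    (quadraticChar (ZMod p) (g : Matrix (Fin 2) (Fin 2) (ZMod p)).det : ℂ) := rfl

lemma twist_omega_twist_omega : twist (omega p) (twist (omega p) ρ) = ρ := by
  refine MonoidHom.ext fun g => ?_
  obtain ⟨g, rfl⟩ := Matrix.ProjGenLinGroup.mk_surjective g
  change (_ : ℂ) • ((_ : ℂ) • ρ _) = _
  rw [smul_smul, omega_mk, ← Int.cast_mul, ← sq, quadraticChar_sq_one (det_ne_zero g),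
    Int.cast_one, one_smul]

lemma matRep_twist_omega (M : Matrix (Fin 2) (Fin 2) (ZMod p)) :
    matRep (twist (omega p) ρ) M = (quadraticChar (ZMod p) M.det : ℂ) • matRep ρ M := by
  by_cases h : M.det = 0
  · rw [matRep_of_det_eq_zero _ h, matRep_of_det_eq_zero _ h, smul_zero]
  · obtain ⟨g, rfl⟩ := exists_GL_eq h
    rw [matRep_coe, matRep_coe, ← omega_mk]; rfl

variable (p) in
/-- The complex valued quadratic character. -/
def quadChar : MulChar (ZMod p) ℂ := (quadraticChar (ZMod p)).ringHomComp (Int.castRingHom ℂ)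

lemma IsBorelEigenvector.twist_omega {v : V} {χ : MulChar (ZMod p) ℂ}
    (h : IsBorelEigenvector ρ χ v) :
    IsBorelEigenvector (twist (omega p) ρ) (quadChar p * χ) v where
  unipotent x := by
    rw [matRep_twist_omega, LinearMap.smul_apply, h.unipotent]; simp [Matrix.det_fin_two_of]
  torus a ha := by
    rw [matRep_twist_omega, LinearMap.smul_apply, h.torus a ha, Matrix.det_fin_two_of,
      MulChar.mul_apply, smul_smul]
    simp [quadChar]

lemma quadChar_sq : quadChar p * quadChar p = 1 := by
  refine MulChar.ext fun a => ?_
  have := quadraticChar_sq_one a.ne_zero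
  rw [MulChar.mul_apply, MulChar.one_apply_coe]
  change ((quadraticChar (ZMod p) (a : ZMod p) : ℤ) : ℂ) * ((quadraticChar (ZMod p) a : ℤ) : ℂ) = 1
  rw [← Int.cast_mul, ← sq, this, Int.cast_one]

lemma quadChar_neg_one (hp : 2 < p) : quadChar p (-1) = 1 ↔ p ≡ 1 [MOD 4] := by
  have h1 : quadChar p (-1) = 1 ↔ quadraticChar (ZMod p) (-1) = 1 := by
    change ((quadraticChar (ZMod p) (-1) : ℤ) : ℂ) = 1 ↔ _
    exact_mod_cast Iff.rfl
  rw [h1, quadraticChar_one_iff_isSquare (neg_ne_zero.2 one_ne_zero),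
    ZMod.exists_sq_eq_neg_one_iff, Nat.ModEq]
  have := (Fact.out : p.Prime).eq_two_or_odd
  omega

lemma quadChar_ne_one {u : ZMod p} (hu : ¬ IsSquare u) : quadChar p ≠ 1 := by
  intro h
  have h0 := ne_zero_of_not_isSquare hu
  have h1 : quadChar p u = 1 := by rw [h, MulChar.one_apply (Ne.isUnit h0)]
  change ((quadraticChar (ZMod p) u : ℤ) : ℂ) = 1 at h1
  exact hu ((quadraticChar_one_iff_isSquare h0).1 (by exact_mod_cast h1))

/-- The unit group is cyclic, and a nontrivial character with trivial square takes the value `-1` at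
a generator. -/
lemma eq_quadChar_of_sq {χ : MulChar (ZMod p) ℂ} {u : ZMod p} (hu : ¬ IsSquare u) (h : χ ^ 2 = 1)
    (h1 : χ ≠ 1) : χ = quadChar p := by
  obtain ⟨a, ha⟩ := IsCyclic.exists_generator (α := (ZMod p)ˣ)
  have key : ∀ ξ : MulChar (ZMod p) ℂ, ξ ^ 2 = 1 → ξ ≠ 1 → ξ a = -1 := by
    intro ξ h2 h3
    have h4 : ξ a ^ 2 = 1 := by rw [← MulChar.pow_apply_coe, h2, MulChar.one_apply_coe]
    have h5 : (ξ a - 1) * (ξ a + 1) = 0 := by linear_combination h4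
    rcases mul_eq_zero.1 h5 with h6 | h6
    · exact absurd ((MulChar.eq_iff ha ξ 1).2 (by rw [sub_eq_zero.1 h6, MulChar.one_apply_coe])) h3
    · exact eq_neg_of_add_eq_zero_left h6
  rw [MulChar.eq_iff ha, key χ h h1, key _ (by rw [sq, quadChar_sq]) (quadChar_ne_one hu)]

lemma nonempty_equiv_twistedSteinberg_iff : Nonempty (ρ.Equiv (twistedSteinberg p)) ↔
    Nonempty ((twist (omega p) ρ).Equiv (steinberg p)) := by
  constructor
  · intro h
    have := nonempty_twist_equiv (omega p) h
    rwa [twistedSteinberg, twist_omega_twist_omega] at this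
  · intro h
    have := nonempty_twist_equiv (omega p) h
    rwa [twist_omega_twist_omega] at this

end BorelCharacters

/-! ### Representations with unipotent invariants -/

section PrincipalSeries

variable {p : ℕ} [Fact p.Prime] {V : Type*} [AddCommGroup V] [Module ℂ V]
  {ρ : Representation ℂ (PGLp p) V}

lemma exists_isBorelEigenvector_of_equiv_principalSeries (hp : 2 < p) (hρ : ρ.IsIrreducible)
    {μ : modZ (borel p) →* ℂˣ} (h : Nonempty (ρ.Equiv (principalSeries μ)))
    (he : IsEvenChar (restrictToTorus μ)) :
    ∃ (v : V) (χ : MulChar (ZMod p) ℂ), v ≠ 0 ∧ IsBorelEigenvector ρ χ v ∧ χ (-1) = 1 := by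
  obtain ⟨e⟩ := h
  obtain ⟨v, hv, hμ⟩ := exists_mem_eigenspace_of_equiv hρ (modZ (borel p)).subtype μ e
  obtain ⟨χ, hχ⟩ := IsBorelEigenvector.of_mem_eigenspace hp hv hμ
  exact ⟨v, χ, hv, hχ, (hχ.isEvenChar_iff hp hv hμ).1 he⟩

variable [FiniteDimensional ℂ V]

lemma exists_isBorelEigenvector_of_equiv_twistedSteinberg (hp : 2 < p) (hρ : ρ.IsIrreducible)
    (hdim : Module.finrank ℂ V ≠ 1) (h : Nonempty (ρ.Equiv (twistedSteinberg p))) :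
    ∃ v : V, v ≠ 0 ∧ IsBorelEigenvector ρ (quadChar p) v := by
  rw [nonempty_equiv_twistedSteinberg_iff,
    nonempty_equiv_steinberg_iff hp (isIrreducible_twist _ hρ) hdim] at h
  obtain ⟨v, hv, hv0⟩ := (Submodule.ne_bot_iff _).1 h
  have h1 := (IsBorelEigenvector.mem_fixedSpace_borel_iff.1 hv).twist_omega
  rw [twist_omega_twist_omega, mul_one] at h1
  exact ⟨v, hv0, h1⟩

lemma IsBorelEigenvector.ne_one {v : V} {χ : MulChar (ZMod p) ℂ} (h : IsBorelEigenvector ρ χ v)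
    (hp : 2 < p) (hρ : ρ.IsIrreducible) (hdim : Module.finrank ℂ V ≠ 1) (hv : v ≠ 0)
    (hSt : ¬ Nonempty (ρ.Equiv (steinberg p))) : χ ≠ 1 := by
  rintro rfl
  exact hSt (nonempty_equiv_steinberg hp hρ hdim ((Submodule.ne_bot_iff _).2
    ⟨v, mem_fixedSpace_borel_iff.2 h, hv⟩))

theorem finrank_fixedSpace_splitNormalizer_of_principal (hp : 2 < p) {u : ZMod p}
    (hu : ¬ IsSquare u) (hρ : ρ.IsIrreducible)
    (hdim : Module.finrank ℂ V ≠ 1) (hSt : ¬ Nonempty (ρ.Equiv (steinberg p)))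
    (h : (∃ μ : modZ (borel p) →* ℂˣ, IsEvenChar (restrictToTorus μ) ∧
        Nonempty (ρ.Equiv (principalSeries μ))) ∨
      (Nonempty (ρ.Equiv (twistedSteinberg p)) ∧ p ≡ 1 [MOD 4])) :
    Module.finrank ℂ (fixedSpace ρ (splitNormalizer p)) = 1 := by
  have hT := (finrank_fixedSpace_of_not_equiv_steinberg hp hu hρ hdim hSt).1
  obtain ⟨v, χ, hv, hχ, hχ1⟩ : ∃ (v : V) (χ : MulChar (ZMod p) ℂ), v ≠ 0 ∧
      IsBorelEigenvector ρ χ v ∧ χ (-1) = 1 := by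
    rcases h with ⟨μ, he, h⟩ | ⟨h, h4⟩
    · exact exists_isBorelEigenvector_of_equiv_principalSeries hp hρ h he
    · obtain ⟨v, hv, h1⟩ := exists_isBorelEigenvector_of_equiv_twistedSteinberg hp hρ hdim h
      exact ⟨v, _, hv, h1, (quadChar_neg_one hp).2 h4⟩
  exact (hχ.finrank_fixedSpace_splitNormalizer_eq_one_iff hp hρ hdim hv
    (hχ.ne_one hp hρ hdim hv hSt) hT).2 hχ1

/-- The character `χ` of a Borel eigenvector is even by the parity criterion. If `χ² ≠ 1`, then `dim
V ≥ p + 1` identifies `V` with the induced representation; otherwise `χ` is quadratic and a twist by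
`ω` yields a `B`-invariant vector. -/
theorem equiv_of_finrank_fixedSpace_splitNormalizer (hp : 2 < p) {u : ZMod p}
    (hu : ¬ IsSquare u) (hρ : ρ.IsIrreducible)
    (hdim : Module.finrank ℂ V ≠ 1) (hSt : ¬ Nonempty (ρ.Equiv (steinberg p)))
    (hU : uInvariants ρ ≠ ⊥) (hN : Module.finrank ℂ (fixedSpace ρ (splitNormalizer p)) = 1) :
    (∃ μ : modZ (borel p) →* ℂˣ, μ ^ 2 ≠ 1 ∧ IsEvenChar (restrictToTorus μ) ∧
        Nonempty (ρ.Equiv (principalSeries μ))) ∨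
      (Nonempty (ρ.Equiv (twistedSteinberg p)) ∧ p ≡ 1 [MOD 4]) := by
  have hT := (finrank_fixedSpace_of_not_equiv_steinberg hp hu hρ hdim hSt).1
  obtain ⟨v, χ, hv, hχ⟩ := IsBorelEigenvector.exists_of_uInvariants_ne_bot hp hU
  have hχ1 := hχ.ne_one hp hρ hdim hv hSt
  have hχm := (hχ.finrank_fixedSpace_splitNormalizer_eq_one_iff hp hρ hdim hv hχ1 hT).1 hN
  by_cases h2 : χ ^ 2 = 1
  · right
    have h3 := eq_quadChar_of_sq hu h2 hχ1
    subst h3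
    refine ⟨nonempty_equiv_twistedSteinberg_iff.2 (nonempty_equiv_steinberg hp
      (isIrreducible_twist _ hρ) hdim ((Submodule.ne_bot_iff _).2 ⟨v, ?_, hv⟩)),
      (quadChar_neg_one hp).1 hχm⟩
    rw [IsBorelEigenvector.mem_fixedSpace_borel_iff, ← quadChar_sq]
    exact hχ.twist_omega
  · left
    obtain ⟨μ, hμ⟩ := hχ.exists_mem_eigenspace hv
    exact ⟨μ, fun h => h2 ((hχ.sq_eq_one_iff hv hμ).1 h), (hχ.isEvenChar_iff hp hv hμ).2 hχm,
      nonempty_equiv_principalSeries hρ hv hμ (hχ.le_finrank hp hρ hdim hv h2)⟩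

end PrincipalSeries

/-! ### Multiplicities of characters of a finite abelian group -/

section Abelian

variable {C : Type*} [CommGroup C] [Finite C]

lemma sum_characters [Fintype (C →* ℂˣ)] {c : C} (hc : c ≠ 1) :
    ∑ η : C →* ℂˣ, (η c : ℂ) = 0 := by
  have : NeZero (Monoid.exponent C : ℂ) := ⟨by exact_mod_cast Monoid.exponent_ne_zero_of_finite⟩
  obtain ⟨ξ, hξ⟩ := CommGroup.exists_apply_ne_one_of_hasEnoughRootsOfUnity C ℂ hc
  have h : ∑ η : C →* ℂˣ, (η c : ℂ) = ξ c * ∑ η : C →* ℂˣ, (η c : ℂ) := by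
    rw [Finset.mul_sum]
    exact Fintype.sum_equiv (Equiv.mulLeft ξ⁻¹) _ _ fun η => by simp
  have h1 : ((ξ c : ℂ) - 1) * ∑ η : C →* ℂˣ, (η c : ℂ) = 0 := by linear_combination -h
  exact (mul_eq_zero.1 h1).resolve_left fun h2 => hξ (Units.ext (sub_eq_zero.1 h2))

lemma card_characters : Nat.card (C →* ℂˣ) = Nat.card C := by
  have : NeZero (Monoid.exponent C : ℂ) := ⟨by exact_mod_cast Monoid.exponent_ne_zero_of_finite⟩
  exact CommGroup.card_monoidHom_of_hasEnoughRootsOfUnity C ℂ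

variable {G V : Type*} [Group G] [AddCommGroup V] [Module ℂ V] (φ : C →* G)
  (ρ : Representation ℂ G V)

/-- A vector whose translates under a finite abelian group span the representation. -/
theorem finrank_eigenspace_le_one_of_span {v : V}
    (h : Submodule.span ℂ (Set.range fun c => ρ (φ c) v) = ⊤) (η : C →* ℂˣ) :
    Module.finrank ℂ (eigenspace φ η ρ) ≤ 1 := by
  have := Fintype.ofFinite C
  have : Invertible (Fintype.card C : ℂ) :=
    invertibleOfNonzero (by exact_mod_cast Fintype.card_ne_zero)
  let σ := twist η⁻¹ (ρ.comp φ)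
  -- Averaging the twisted action projects to the eigenspace and sends every translate of `v` to a
  -- multiple of one vector.
  have hle : eigenspace φ η ρ ≤ Submodule.span ℂ {averageMap σ v} := by
    intro w hw
    rw [← averageMap_id σ w hw]
    have hw' : w ∈ Submodule.span ℂ (Set.range fun c => ρ (φ c) v) := h ▸ Submodule.mem_top
    refine (Submodule.span_le (p := (Submodule.span ℂ {averageMap σ v}).comap (averageMap σ))).2
      ?_ hw'
    rintro _ ⟨c, rfl⟩
    have h1 : ρ (φ c) v = (η c : ℂ) • σ c v := by
      change _ = (η c : ℂ) • ((((η c)⁻¹ : ℂˣ) : ℂ) • ρ (φ c) v)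
      rw [smul_smul, Units.mul_inv, one_smul]
    have h2 : averageMap σ (σ c v) = averageMap σ v := by
      rw [averageMap, ← asAlgebraHom_single_one, ← Module.End.mul_apply, ← map_mul,
        GroupAlgebra.mul_average_right]
    change averageMap σ (ρ (φ c) v) ∈ Submodule.span ℂ {averageMap σ v}
    rw [h1, map_smul, h2]
    exact Submodule.smul_mem _ _ (Submodule.mem_span_singleton_self _)
  refine (Submodule.finrank_mono hle).trans ?_
  have h1 := finrank_span_finset_le_card (R := ℂ) ({averageMap σ v} : Finset V)
  rwa [Finset.coe_singleton, Finset.card_singleton] at h1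

variable [FiniteDimensional ℂ V]

/-- Fourier inversion on `C`, the multiplicities being the Fourier coefficients of the character. -/
theorem sum_finrank_eigenspace_mul [Fintype (C →* ℂˣ)] (c : C) :
    ∑ η : C →* ℂˣ, (Module.finrank ℂ (eigenspace φ η ρ) : ℂ) * η c = ρ.character (φ c) := by
  have := Fintype.ofFinite C
  have hC : (Nat.card C : ℂ) ≠ 0 := by exact_mod_cast Nat.card_pos.ne'
  refine mul_left_cancel₀ hC ?_
  have h1 : ∀ η : C →* ℂˣ, (Nat.card C : ℂ) * (Module.finrank ℂ (eigenspace φ η ρ) * η c) =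
      ∑ h : C, (η (h⁻¹ * c) : ℂ) * ρ.character (φ h) := by
    intro η
    rw [← mul_assoc, finrank_eigenspace, card_mul_avg, Finset.sum_mul]
    refine Finset.sum_congr rfl fun h _ => ?_
    rw [map_mul, map_inv, Units.val_mul]
    ring
  rw [Finset.mul_sum, Finset.sum_congr rfl fun η _ => h1 η, Finset.sum_comm,
    Finset.sum_eq_single c]
  · rw [← Finset.sum_mul, inv_mul_cancel]
    simp only [map_one, Units.val_one, Finset.sum_const, Finset.card_univ]
    rw [← Nat.card_eq_fintype_card, card_characters]; simp
  · intro h _ hh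
    rw [← Finset.sum_mul, sum_characters (fun e => hh (inv_mul_eq_one.1 e)), zero_mul]
  · simp

theorem sum_finrank_eigenspace [Fintype (C →* ℂˣ)] :
    ∑ η : C →* ℂˣ, Module.finrank ℂ (eigenspace φ η ρ) = Module.finrank ℂ V := by
  have h := sum_finrank_eigenspace_mul φ ρ 1
  rw [map_one, char_one] at h
  simp only [map_one, Units.val_one, mul_one] at h
  exact_mod_cast h

/-- Parseval's identity for the restrictions of the two characters to `C`. -/
theorem sum_finrank_eigenspace_mul_finrank_eigenspace [Fintype (C →* ℂˣ)] {W : Type*}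
    [AddCommGroup W] [Module ℂ W] [FiniteDimensional ℂ W] (σ : Representation ℂ G W) :
    ∑ η : C →* ℂˣ, (Module.finrank ℂ (eigenspace φ η ρ) : ℂ) *
        Module.finrank ℂ (eigenspace φ η σ) =
      avg C fun h => ρ.character (φ h)⁻¹ * σ.character (φ h) := by
  have := Fintype.ofFinite C
  have hC : (Nat.card C : ℂ) ≠ 0 := by exact_mod_cast Nat.card_pos.ne'
  refine mul_left_cancel₀ hC ?_
  rw [card_mul_avg, Finset.mul_sum]
  have h1 : ∀ η : C →* ℂˣ, (Nat.card C : ℂ) * ((Module.finrank ℂ (eigenspace φ η ρ) : ℂ) *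
      Module.finrank ℂ (eigenspace φ η σ)) =
      ∑ h : C, (Module.finrank ℂ (eigenspace φ η ρ) : ℂ) * (η h⁻¹ * σ.character (φ h)) := by
    intro η
    rw [← Finset.mul_sum, mul_left_comm]
    congr 1
    rw [finrank_eigenspace, card_mul_avg]
    simp only [map_inv]
  rw [Finset.sum_congr rfl fun η _ => h1 η, Finset.sum_comm]
  refine Finset.sum_congr rfl fun h _ => ?_
  rw [← map_inv φ, ← sum_finrank_eigenspace_mul φ ρ h⁻¹, Finset.sum_mul]
  simp only [mul_assoc]

/-- If the norm of the character on a finite abelian group equals the dimension, then all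
multiplicities are at most one. -/
theorem finrank_eigenspace_le_one_of_avg (h : avg C (fun h => ρ.character (φ h)⁻¹ *
    ρ.character (φ h)) = Module.finrank ℂ V) (η : C →* ℂˣ) :
    Module.finrank ℂ (eigenspace φ η ρ) ≤ 1 := by
  have := Fintype.ofFinite (C →* ℂˣ)
  have h1 := sum_finrank_eigenspace_mul_finrank_eigenspace φ ρ ρ
  rw [h, ← sum_finrank_eigenspace φ ρ] at h1
  have h2 : ∑ η : C →* ℂˣ, Module.finrank ℂ (eigenspace φ η ρ) =
      ∑ η : C →* ℂˣ, Module.finrank ℂ (eigenspace φ η ρ) *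
        Module.finrank ℂ (eigenspace φ η ρ) := by
    exact_mod_cast h1.symm
  -- The multiplicities and their squares have equal sums, and `m ≤ m * m` termwise, so `m = m * m`.
  have h3 := (Finset.sum_eq_sum_iff_of_le fun η _ => Nat.le_mul_self _).1 h2 η
    (Finset.mem_univ η)
  by_contra! h4
  nlinarith

theorem card_filter_finrank_eq_zero [Fintype (C →* ℂˣ)]
    (h : ∀ η, Module.finrank ℂ (eigenspace φ η ρ) ≤ 1) :
    (Finset.univ.filter fun η : C →* ℂˣ => Module.finrank ℂ (eigenspace φ η ρ) = 0).card +
      Module.finrank ℂ V = Nat.card C := by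
  classical
  rw [← card_characters, Nat.card_eq_fintype_card, ← Finset.card_univ, ← sum_finrank_eigenspace φ ρ,
    Finset.card_filter, ← Finset.sum_add_distrib, Finset.card_eq_sum_ones]
  refine Finset.sum_congr rfl fun η _ => ?_
  have := h η
  split_ifs <;> omega

end Abelian

/-! ### The group `T'/Z` -/

section NonsplitTorus

variable {p : ℕ} [Fact p.Prime] {u : ZMod p}

/-- The element of `T'/Z` with coordinates `a` and `b`. -/
def nonsplitElt (a b : ZMod p) (h : a ^ 2 - u * b ^ 2 ≠ 0) : modZ (nonsplitCartan u) :=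
  ⟨pglOf !![a, b * u; b, a] (by
    rw [Matrix.det_fin_two_of]; intro h0; exact h (by linear_combination h0)),
    Matrix.GeneralLinearGroup.mkOfDetNeZero _ _, ⟨a, b, rfl⟩, rfl⟩

lemma nonsplitElt_eq_of {a b c d : ZMod p} (ha : a = c) (hb : b = d) (h h') :
    nonsplitElt (u := u) a b h = nonsplitElt c d h' := by subst ha hb; rfl

lemma exists_nonsplitElt (c : modZ (nonsplitCartan u)) : ∃ a b h, c = nonsplitElt a b h := by
  obtain ⟨_, g, ⟨a, b, hg⟩, rfl⟩ := c
  have hd := det_ne_zero g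
  have hd' := hd
  rw [hg, Matrix.det_fin_two_of] at hd'
  refine ⟨a, b, fun h => hd' (by linear_combination h), Subtype.ext ?_⟩
  change Matrix.ProjGenLinGroup.mk g = pglOf _ _
  rw [← pglOf_coe g hd]
  congr 1

lemma nonsplitElt_mul (a b c d : ZMod p) (h h' h'') :
    nonsplitElt (u := u) a b h * nonsplitElt c d h' =
      nonsplitElt (a * c + b * u * d) (b * c + a * d) h'' := by
  refine Subtype.ext ?_
  change pglOf _ _ * pglOf _ _ = pglOf _ _
  rw [pglOf_mul]
  congr 1
  rw [Matrix.mul_fin_two]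
  refine mat_eq ?_ ?_ ?_ ?_ <;> ring

lemma nonsplitElt_smul {r : ZMod p} (a b : ZMod p) (h h') :
    nonsplitElt (u := u) (r * a) (r * b) h = nonsplitElt a b h' := by
  refine Subtype.ext ?_
  have e : !![r * a, r * b * u; r * b, r * a] = r • !![a, b * u; b, a] := by
    simp [Matrix.smul_of, mul_assoc]
  change pglOf _ _ = pglOf _ _
  simp only [e]
  exact pglOf_smul _ _

lemma nonsplitElt_one_zero (h) : nonsplitElt (u := u) 1 0 h = 1 := by
  refine Subtype.ext ?_
  change pglOf _ _ = 1
  have e : !![1, 0 * u; 0, 1] = (1 : Matrix (Fin 2) (Fin 2) (ZMod p)) := by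
    rw [Matrix.one_fin_two, zero_mul]
  simp only [e]
  exact pglOf_one _

lemma nonsplitElt_zero_right (a : ZMod p) (h) : nonsplitElt (u := u) a 0 h = 1 := by
  rw [← nonsplitElt_one_zero (u := u) (by simp), ← nonsplitElt_smul (r := a) 1 0 (by simpa using h)]
  exact nonsplitElt_eq_of (by ring) (by ring) _ _

lemma pglOf_eq_one_iff {a b c d : ZMod p} (h) :
    pglOf !![a, b; c, d] h = 1 ↔ b = 0 ∧ c = 0 ∧ a = d := by
  constructor
  · intro h1
    obtain ⟨z, hz⟩ := Matrix.ProjGenLinGroup.mk_eq_mk_iff.1 (h1.trans (map_one _).symm).symm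
    rw [one_mul] at hz
    have h2 := congrArg (fun g : GLp p => (g : Matrix (Fin 2) (Fin 2) (ZMod p))) hz
    have h3 : Matrix.scalar (Fin 2) (z : ZMod p) = !![a, b; c, d] := h2
    have h00 := congrFun (congrFun h3 0) 0
    have h01 := congrFun (congrFun h3 0) 1
    have h10 := congrFun (congrFun h3 1) 0
    have h11 := congrFun (congrFun h3 1) 1
    simp at h00 h01 h10 h11
    exact ⟨h01.symm, h10.symm, h00.symm.trans h11⟩
  · rintro ⟨rfl, rfl, rfl⟩
    have ha : a ≠ 0 := by rintro rfl; simp [Matrix.det_fin_two_of] at h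
    have e : !![a, 0; 0, a] = a • (1 : Matrix (Fin 2) (Fin 2) (ZMod p)) := by
      simp [Matrix.one_fin_two, Matrix.smul_of]
    simp only [e]
    rw [pglOf_smul (by simp)]
    exact pglOf_one _

lemma nonsplitElt_eq_one_iff {a b : ZMod p} {h} : nonsplitElt (u := u) a b h = 1 ↔ b = 0 := by
  constructor
  · intro h1
    exact ((pglOf_eq_one_iff _).1 (congrArg Subtype.val h1)).2.1
  · rintro rfl
    exact nonsplitElt_zero_right a h

lemma norm_mul_ne_zero {a b c d : ZMod p} (h : a ^ 2 - u * b ^ 2 ≠ 0) (h' : c ^ 2 - u * d ^ 2 ≠ 0) :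
    (a * c + b * u * d) ^ 2 - u * (b * c + a * d) ^ 2 ≠ 0 := by
  rw [show (a * c + b * u * d) ^ 2 - u * (b * c + a * d) ^ 2 =
    (a ^ 2 - u * b ^ 2) * (c ^ 2 - u * d ^ 2) by ring]
  exact mul_ne_zero h h'

instance : CommGroup (modZ (nonsplitCartan u)) :=
  { (inferInstance : Group (modZ (nonsplitCartan u))) with
    mul_comm := fun x y => by
      obtain ⟨a, b, h, rfl⟩ := exists_nonsplitElt x
      obtain ⟨c, d, h', rfl⟩ := exists_nonsplitElt y
      rw [nonsplitElt_mul _ _ _ _ _ _ (norm_mul_ne_zero h h'),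
        nonsplitElt_mul _ _ _ _ _ _ (norm_mul_ne_zero h' h)]
      exact nonsplitElt_eq_of (by ring) (by ring) _ _ }

/-- The indicator of the identity averages to `1 / |T'/Z|` downstairs and to `(p - 1) / (p² - 1)`
upstairs, where the `p - 1` scalars are counted. -/
theorem card_modZ_nonsplitCartan (hp : 2 < p) (hu : ¬ IsSquare u) :
    Nat.card (modZ (nonsplitCartan u)) = p + 1 := by
  classical
  have := Fintype.ofFinite (modZ (nonsplitCartan u))
  let f : PGLp p → ℂ := fun g => if g = 1 then 1 else 0
  have h1 := card_mul_avg (modZ (nonsplitCartan u)) fun h => f h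
  rw [← avgOn_eq_avg_modZ, Finset.sum_eq_single 1 (by
    intro c _ hc; exact if_neg fun h => hc (Subtype.ext h)) (by simp)] at h1
  have h2 := card_mul_avgOn_nonsplitCartan (u := u) f
  have h3 : ∀ a b : ZMod p, matExt f !![a, b * u; b, a] =
      if b = 0 then (if a = 0 then 0 else 1) else 0 := by
    intro a b
    by_cases hb : b = 0
    · subst hb
      by_cases ha : a = 0
      · subst ha
        rw [matExt_of_det_eq_zero _ (by simp)]; simp
      · rw [matExt_of_det_ne_zero _ (by simpa [Matrix.det_fin_two_of] using ha)]
        simp only [f]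
        rw [if_pos ((pglOf_eq_one_iff _).2 ⟨by ring, rfl, rfl⟩)]
        simp [ha]
    · rw [if_neg hb]
      by_cases hd : Matrix.det !![a, b * u; b, a] = 0
      · rw [matExt_of_det_eq_zero _ hd]
      · rw [matExt_of_det_ne_zero _ hd]
        exact if_neg fun h => hb ((pglOf_eq_one_iff _).1 h).2.1
  have h4 : ∑ a : ZMod p, ∑ b : ZMod p, matExt f !![a, b * u; b, a] = p - 1 := by
    simp only [h3, Finset.sum_ite_eq', Finset.mem_univ, if_true]
    have : ∀ a : ZMod p, (if a = 0 then (0 : ℂ) else 1) = 1 - if a = 0 then 1 else 0 := by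
      intro a; split_ifs <;> simp
    simp only [this, Finset.sum_sub_distrib, Finset.sum_ite_eq', Finset.mem_univ, if_true]
    simp
  rw [h4, card_nonsplitCartan hu] at h2
  have h5 : f (1 : modZ (nonsplitCartan u)) = 1 := if_pos rfl
  rw [h5] at h1
  obtain ⟨-, hp1, -⟩ := prime_cast_ne (p := p) hp
  have h6 : (Nat.card (modZ (nonsplitCartan u)) : ℂ) = p + 1 := by
    refine mul_right_cancel₀ hp1 ?_
    linear_combination -(Nat.card (modZ (nonsplitCartan u)) : ℂ) * h2 + ((p : ℂ) ^ 2 - 1) * h1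
  exact_mod_cast h6

variable (u) in
/-- The restriction of the quadratic character to `T'/Z`. -/
def omegaNonsplit : modZ (nonsplitCartan u) →* ℂˣ := (omega p).comp (modZ (nonsplitCartan u)).subtype

lemma omegaNonsplit_nonsplitElt (a b : ZMod p) (h) : (omegaNonsplit u (nonsplitElt a b h) : ℂ) =
    (quadraticChar (ZMod p) (a ^ 2 - u * b ^ 2) : ℂ) := by
  change (omega p (Matrix.ProjGenLinGroup.mk _) : ℂ) = _
  rw [omega_mk]
  change (quadraticChar (ZMod p) (Matrix.det !![a, b * u; b, a]) : ℂ) = _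
  rw [Matrix.det_fin_two_of]
  congr 2
  ring

lemma omegaNonsplit_sq : omegaNonsplit u ^ 2 = 1 := by
  refine MonoidHom.ext fun c => ?_
  obtain ⟨a, b, h, rfl⟩ := exists_nonsplitElt c
  refine Units.ext ?_
  rw [MonoidHom.pow_apply, Units.val_pow_eq_pow_val, omegaNonsplit_nonsplitElt, ← Int.cast_pow,
    quadraticChar_sq_one h]
  simp

/-- Elements of `T'/Z` whose norm is a square are squares. -/
lemma exists_sq_of_isSquare (hp : 2 < p) (hu : ¬ IsSquare u) {a b : ZMod p} (h)
    (hs : IsSquare (a ^ 2 - u * b ^ 2)) : ∃ c, nonsplitElt (u := u) a b h = c ^ 2 := by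
  have h2 := two_ne_zero_of_lt hp
  obtain ⟨r, hr⟩ := hs
  have hr0 : r ≠ 0 := by rintro rfl; exact h (by rw [hr]; ring)
  by_cases hra : r + a = 0
  · have ha : a = -r := by linear_combination hra
    have hb : u * b ^ 2 = 0 := by rw [ha] at hr; linear_combination -hr
    have hb0 : b = 0 := by
      rcases mul_eq_zero.1 hb with h3 | h3
      · exact absurd h3 (ne_zero_of_not_isSquare hu)
      · exact pow_eq_zero_iff two_ne_zero |>.1 h3
    exact ⟨1, by rw [nonsplitElt_eq_one_iff.2 hb0]; simp⟩
  · have hN : (r + a) ^ 2 - u * b ^ 2 ≠ 0 := by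
      rw [show (r + a) ^ 2 - u * b ^ 2 = 2 * r * (r + a) by linear_combination hr]
      exact mul_ne_zero (mul_ne_zero h2 hr0) hra
    -- If `r²` is the norm of `a + b √u`, then `(r + a + b √u)² = 2 (r + a) (a + b √u)`, and the
    -- scalar disappears modulo `Z`.
    refine ⟨nonsplitElt (r + a) b hN, ?_⟩
    rw [sq, nonsplitElt_mul _ _ _ _ _ _ (norm_mul_ne_zero hN hN)]
    have hm : (2 * (r + a) * a) ^ 2 - u * (2 * (r + a) * b) ^ 2 ≠ 0 := by
      rw [show (2 * (r + a) * a) ^ 2 - u * (2 * (r + a) * b) ^ 2 =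
        (2 * (r + a)) ^ 2 * (a ^ 2 - u * b ^ 2) by ring]
      exact mul_ne_zero (pow_ne_zero 2 (mul_ne_zero h2 hra)) h
    rw [← nonsplitElt_smul (r := 2 * (r + a)) a b hm]
    refine nonsplitElt_eq_of ?_ (by ring) _ _
    linear_combination hr

/-- The characters of `T'/Z` of order at most two. -/
lemma eq_one_or_eq_omegaNonsplit (hp : 2 < p) (hu : ¬ IsSquare u)
    {θ : modZ (nonsplitCartan u) →* ℂˣ} (hθ : θ ^ 2 = 1) : θ = 1 ∨ θ = omegaNonsplit u := by
  have hsq : ∀ c, θ c ^ 2 = 1 := fun c => by rw [← MonoidHom.pow_apply, hθ]; rfl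
  have hωsq : ∀ c, omegaNonsplit u c ^ 2 = 1 := fun c => by
    rw [← MonoidHom.pow_apply, omegaNonsplit_sq]; rfl
  -- The kernel of `ω` on `T'/Z` consists of squares, which `θ` kills; the value on the other coset
  -- then determines `θ`.
  have hker : ∀ c, omegaNonsplit u c = 1 → θ c = 1 := by
    intro c hc
    obtain ⟨a, b, h, rfl⟩ := exists_nonsplitElt c
    have h1 := congrArg Units.val hc
    rw [omegaNonsplit_nonsplitElt, Units.val_one] at h1
    obtain ⟨c, hc⟩ := exists_sq_of_isSquare hp hu h
      ((quadraticChar_one_iff_isSquare h).1 (by exact_mod_cast h1))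
    rw [hc, map_pow, hsq]
  have cases : ∀ z : ℂˣ, z ^ 2 = 1 → z = 1 ∨ z = -1 := fun z hz => by
    have h1 : (z : ℂ) ^ 2 = 1 := by rw [← Units.val_pow_eq_pow_val, hz]; rfl
    rcases sq_eq_sq_iff_eq_or_eq_neg.1 (h1.trans (one_pow 2).symm) with h2 | h2
    · exact Or.inl (Units.ext h2)
    · exact Or.inr (Units.ext h2)
  obtain ⟨a, b, hab⟩ := exists_norm_not_isSquare hu
  have h0 := ne_zero_of_not_isSquare hab
  set c₀ := nonsplitElt a b h0
  have hc₀ : omegaNonsplit u c₀ = -1 := by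
    refine Units.ext ?_
    rw [omegaNonsplit_nonsplitElt, quadraticChar_of_not_isSquare hab]; simp
  have key : ∀ c, omegaNonsplit u c = -1 → θ c = θ c₀ := by
    intro c hc
    have h1 := hker (c * c₀⁻¹) (by rw [map_mul, map_inv, hc, hc₀]; simp)
    rwa [map_mul, map_inv, mul_inv_eq_one] at h1
  rcases cases _ (hsq c₀) with h1 | h1
  · left
    refine MonoidHom.ext fun c => ?_
    rcases cases _ (hωsq c) with h2 | h2
    · exact hker c h2
    · rw [key c h2, h1]; rfl
  · right
    refine MonoidHom.ext fun c => ?_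
    rcases cases _ (hωsq c) with h2 | h2
    · rw [hker c h2, h2]
    · rw [key c h2, h1, h2]

variable (u) in
/-- The element of order two of `T'/Z`. -/
def nonsplitInvolution (hu : ¬ IsSquare u) : modZ (nonsplitCartan u) :=
  nonsplitElt 0 1 (by simpa using ne_zero_of_not_isSquare hu)

lemma nonsplitInvolution_ne_one (hu : ¬ IsSquare u) : nonsplitInvolution u hu ≠ 1 :=
  fun h => one_ne_zero (nonsplitElt_eq_one_iff.1 h)

lemma nonsplitInvolution_sq (hu : ¬ IsSquare u) : nonsplitInvolution u hu ^ 2 = 1 := by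
  rw [sq, nonsplitInvolution, nonsplitElt_mul _ _ _ _ _ _
    (by simpa using ne_zero_of_not_isSquare hu), nonsplitElt_eq_one_iff]
  ring

lemma isEvenChar_iff_nonsplitInvolution (hp : 2 < p) (hu : ¬ IsSquare u)
    (θ : modZ (nonsplitCartan u) →* ℂˣ) : IsEvenChar θ ↔ θ (nonsplitInvolution u hu) = 1 := by
  have h2 := two_ne_zero_of_lt hp
  constructor
  · exact fun h => h _ (orderOf_eq_prime (nonsplitInvolution_sq hu) (nonsplitInvolution_ne_one hu))
  · intro h c hc
    obtain ⟨h3, h4⟩ := orderOf_eq_prime_iff.1 hc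
    obtain ⟨a, b, hab, rfl⟩ := exists_nonsplitElt c
    rw [sq, nonsplitElt_mul _ _ _ _ _ _ (norm_mul_ne_zero hab hab), nonsplitElt_eq_one_iff] at h3
    rw [Ne, nonsplitElt_eq_one_iff] at h4
    have h5 : 2 * (a * b) = 0 := by linear_combination h3
    have ha : a = 0 := by
      rcases mul_eq_zero.1 ((mul_eq_zero.1 h5).resolve_left h2) with h | h
      · exact h
      · exact absurd h h4
    subst ha
    rw [← h]
    congr 1
    rw [nonsplitInvolution, ← nonsplitElt_smul (r := b) 0 1 (by simpa using hab)]
    exact nonsplitElt_eq_of (by ring) (by ring) _ _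

/-- Conjugation by `diag(1, -1)` is Galois conjugation on `T'`, and this is inversion modulo
scalars. -/
lemma classFun_inv_nonsplit (hp : 2 < p) {f : PGLp p → ℂ} (hf : IsClassFun f) (c : modZ (nonsplitCartan u)) :
    f (c : PGLp p)⁻¹ = f c := by
  have h2 := two_ne_zero_of_lt hp
  obtain ⟨a, b, h, rfl⟩ := exists_nonsplitElt c
  have hneg : a ^ 2 - u * (-b) ^ 2 ≠ 0 := by rwa [neg_sq]
  have h1 : nonsplitElt (u := u) a b h * nonsplitElt a (-b) hneg = 1 := by
    rw [nonsplitElt_mul _ _ _ _ _ _ (norm_mul_ne_zero h hneg), nonsplitElt_eq_one_iff]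
    ring
  rw [← Subgroup.coe_inv, inv_eq_of_mul_eq_one_right h1]
  change f (pglOf _ _) = f (pglOf _ _)
  rw [← matExt_of_det_ne_zero f, ← matExt_of_det_ne_zero f]
  refine matExt_conj_of hf 1 0 0 (-1) (by simp) ?_ ?_ ?_ ?_ <;> ring

end NonsplitTorus

/-! ### Representations without unipotent invariants -/

section Multiplicities

variable {p : ℕ} [Fact p.Prime] {u : ZMod p} {W : Type*} [AddCommGroup W] [Module ℂ W]

/-- The multiplicity of a character of `T'/Z` in a representation. -/
abbrev nonsplitMult (θ : modZ (nonsplitCartan u) →* ℂˣ) (σ : Representation ℂ (PGLp p) W) : ℕ :=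
  Module.finrank ℂ (eigenspace (modZ (nonsplitCartan u)).subtype θ σ)

variable [FiniteDimensional ℂ W] (σ : Representation ℂ (PGLp p) W)

lemma nonsplitMult_one : nonsplitMult (1 : modZ (nonsplitCartan u) →* ℂˣ) σ =
    Module.finrank ℂ (fixedSpace σ (nonsplitCartan u)) := by
  have h : (nonsplitMult (1 : modZ (nonsplitCartan u) →* ℂˣ) σ : ℂ) =
      Module.finrank ℂ (fixedSpace σ (nonsplitCartan u)) := by
    rw [finrank_eigenspace, finrank_fixedSpace, avgOn_eq_avg_modZ]
    simp
  exact_mod_cast h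

lemma nonsplitMult_omega : nonsplitMult (omegaNonsplit u) σ =
    Module.finrank ℂ (fixedSpace (twist (omega p) σ) (nonsplitCartan u)) := by
  have h : (nonsplitMult (omegaNonsplit u) σ : ℂ) =
      Module.finrank ℂ (fixedSpace (twist (omega p) σ) (nonsplitCartan u)) := by
    rw [finrank_eigenspace, finrank_fixedSpace, avgOn_eq_avg_modZ]
    congr 1
    ext c
    rw [character_twist]
    congr 2
    have : omegaNonsplit u c * omegaNonsplit u c = 1 := by
      rw [← sq, ← MonoidHom.pow_apply, omegaNonsplit_sq]; rfl
    exact inv_eq_of_mul_eq_one_left this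
  exact_mod_cast h

lemma nonsplitMult_inv (hp : 2 < p) (θ : modZ (nonsplitCartan u) →* ℂˣ) :
    nonsplitMult θ⁻¹ σ = nonsplitMult θ σ := by
  have h : (nonsplitMult θ⁻¹ σ : ℂ) = nonsplitMult θ σ := by
    rw [finrank_eigenspace, finrank_eigenspace, ← avg_inv]
    congr 1
    ext c
    change _ * σ.character (c : PGLp p)⁻¹ = _ * σ.character c
    rw [classFun_inv_nonsplit hp (isClassFun_character σ)]
    simp
  exact_mod_cast h

end Multiplicities

section HomFun

variable {G V W : Type*} [Group G] [AddCommGroup V] [Module ℂ V] [AddCommGroup W] [Module ℂ W]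
  (ρ : Representation ℂ G V) (σ : Representation ℂ G W)

/-- The function whose average is the dimension of a space of intertwining maps. -/
def homFun : G → ℂ := fun g => ρ.character g⁻¹ * σ.character g

lemma isClassFun_homFun : IsClassFun (homFun ρ σ) := by
  intro g h
  have e : (h * g * h⁻¹)⁻¹ = h * g⁻¹ * h⁻¹ := by group
  simp only [homFun]
  rw [e, char_conj, char_conj]

end HomFun

/-! ### Representations with `V^U = 0` and the characters of `T'/Z` they omit. -/

section Cuspidal

variable {p : ℕ} [Fact p.Prime] {u : ZMod p} {V : Type*} [AddCommGroup V] [Module ℂ V]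
  {ρ : Representation ℂ (PGLp p) V}

lemma fixedSpace_borel_eq_bot (hU : uInvariants ρ = ⊥) : fixedSpace ρ (borel p) = ⊥ :=
  le_bot_iff.1 (fixedSpace_borel_le_uInvariants.trans hU.le)

lemma uInvariants_twist (hU : uInvariants ρ = ⊥) : uInvariants (twist (omega p) ρ) = ⊥ := by
  rw [eq_bot_iff] at hU ⊢
  intro v hv
  refine hU (mem_uInvariants.2 fun x => ?_)
  have h := mem_uInvariants.1 hv x
  rw [matRep_twist_omega, LinearMap.smul_apply] at h
  simpa [Matrix.det_fin_two_of] using h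

/-- The projection to `V^U` is zero, hence so is its trace after multiplication by a diagonal matrix
`t`. With distinct eigenvalues, every `t n` with `n` in `U` is conjugate to `t`, so that trace is
the character at `t`. -/
lemma matExt_character_diag_of_uInvariants_eq_bot (hU : uInvariants ρ = ⊥) {a d : ZMod p}
    (had : a ≠ d) : matExt ρ.character !![a, 0; 0, d] = 0 := by
  have h1 : uProj ρ 0 = 0 := LinearMap.range_eq_bot.1 hU
  have h2 : LinearMap.trace ℂ V (matRep ρ !![a, 0; 0, d] * uProj ρ 0) = 0 := by
    rw [h1, mul_zero, map_zero]
  rw [uProj, mul_smul_comm, map_smul, Finset.mul_sum, map_sum, smul_eq_mul] at h2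
  have hp0 : (p : ℂ) ≠ 0 := by exact_mod_cast (Fact.out : p.Prime).ne_zero
  have h3 : ∀ x : ZMod p, LinearMap.trace ℂ V (matRep ρ !![a, 0; 0, d] *
      (0 : AddChar (ZMod p) ℂ) (-x) • matRep ρ !![1, x; 0, 1]) =
      matExt ρ.character !![a, 0; 0, d] := by
    intro x
    rw [AddChar.zero_apply, one_smul, matRep_mul_of, trace_matRep,
      ← matExt_upper (isClassFun_character ρ) (a * x) had]
    congr 1
    refine mat_eq ?_ ?_ ?_ ?_ <;> ring
  rw [Finset.sum_congr rfl fun x _ => h3 x, sum_const_zmod, inv_mul_cancel_left₀ hp0] at h2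
  exact h2

variable {W : Type*} [AddCommGroup W] [Module ℂ W] (σ : Representation ℂ (PGLp p) W)

/-- Modulo scalars the adjugate is the inverse. -/
lemma matExt_homFun {a b c d : ZMod p} (h : a * d - b * c ≠ 0) :
    matExt (homFun ρ σ) !![a, b; c, d] =
      matExt ρ.character !![d, -b; -c, a] * matExt σ.character !![a, b; c, d] := by
  have hd : Matrix.det !![a, b; c, d] ≠ 0 := by rwa [Matrix.det_fin_two_of]
  have hd' : Matrix.det !![d, -b; -c, a] ≠ 0 := by
    rw [Matrix.det_fin_two_of]; intro h0; exact h (by linear_combination h0)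
  rw [matExt_of_det_ne_zero _ hd, matExt_of_det_ne_zero _ hd, matExt_of_det_ne_zero _ hd', homFun]
  congr 2
  refine inv_eq_of_mul_eq_one_right ?_
  rw [pglOf_mul]
  have e : !![a, b; c, d] * !![d, -b; -c, a] = !![a * d - b * c, 0; 0, a * d - b * c] := by
    rw [Matrix.mul_fin_two]
    refine mat_eq ?_ ?_ ?_ ?_ <;> ring
  simp only [e]
  exact (pglOf_eq_one_iff _).2 ⟨rfl, rfl, rfl⟩

variable [FiniteDimensional ℂ V] [FiniteDimensional ℂ W]

/-- For a cuspidal representation, the characters on the non-split torus compute the dimension of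
the space of intertwining maps. -/
theorem avg_homFun_nonsplit (hp : 2 < p) (hu : ¬ IsSquare u) (hρ : ρ.IsIrreducible)
    (hdim : Module.finrank ℂ V ≠ 1) (hU : uInvariants ρ = ⊥) :
    avg (modZ (nonsplitCartan u)) (fun c => homFun ρ σ c) =
      2 * Module.finrank ℂ (IntertwiningMap ρ σ) -
        2 * Module.finrank ℂ (eigenspace (unipotentHom p) (psi p) σ) + Module.finrank ℂ W := by
  obtain ⟨hp0, hp1, -⟩ := prime_cast_ne hp
  have hdV := finrank_eq_add_uInvariants hp hρ hdim
  rw [hU, finrank_bot, add_zero] at hdV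
  have hdV' : (Module.finrank ℂ V : ℂ) = p - 1 := by
    rw [eq_sub_iff_add_eq]; exact_mod_cast hdV
  have hf := isClassFun_homFun ρ σ
  have h1 : matExt (homFun ρ σ) !![1, 0; 0, 1] = (p - 1) * Module.finrank ℂ W := by
    rw [matExt_homFun σ (by simp), neg_zero, matExt_character_one, matExt_character_one, hdV']
  have hu1 : matExt (homFun ρ σ) !![1, 1; 0, 1] = -matExt σ.character !![1, 1; 0, 1] := by
    rw [matExt_homFun σ (by simp), neg_zero, matExt_unipotent (isClassFun_character ρ) one_ne_zero
      (neg_ne_zero.2 one_ne_zero), matExt_character_unipotent hp hρ hdim, hdV']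
    ring
  -- Only scalar matrices contribute to the average over `T`.
  have hT : avgOn (splitCartan p) (homFun ρ σ) = Module.finrank ℂ W := by
    have h2 := card_mul_avgOn_splitCartan (homFun ρ σ)
    have h3 : ∀ a : ZMod p, ∑ d, matExt (homFun ρ σ) !![a, 0; 0, d] =
        (1 - if a = 0 then 1 else 0) * ((p - 1) * Module.finrank ℂ W) := by
      intro a
      rw [Finset.sum_eq_single a]
      · split_ifs with ha
        · rw [ha, matExt_of_det_eq_zero _ (by simp)]; simp
        · rw [matExt_scalar _ ha, h1]; simp
      · intro d _ hd
        by_cases h0 : a * d = 0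
        · rw [matExt_of_det_eq_zero _ (by simpa [Matrix.det_fin_two_of] using h0)]
        · rw [matExt_homFun σ (by simpa using h0), neg_zero,
            matExt_character_diag_of_uInvariants_eq_bot hU hd, zero_mul]
      · simp
    rw [Finset.sum_congr rfl fun a _ => h3 a, ← Finset.sum_mul, Finset.sum_sub_distrib,
      Finset.sum_ite_eq' Finset.univ, sum_const_zmod, card_splitCartan] at h2
    simp only [Finset.mem_univ, if_true, mul_one] at h2
    refine mul_left_cancel₀ (pow_ne_zero 2 hp1) ?_
    linear_combination h2
  have hB : avgOn (borel p) (homFun ρ σ) =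
      Module.finrank ℂ (eigenspace (unipotentHom p) (psi p) σ) := by
    have h2 := avgOn_borel hp hf
    have h3 := finrank_whittaker σ
    rw [hT, h1, hu1] at h2
    rw [matExt_character_one] at h3
    refine mul_left_cancel₀ hp0 ?_
    linear_combination h2 - h3
  have htop : avgOn ⊤ (homFun ρ σ) = Module.finrank ℂ (IntertwiningMap ρ σ) := by
    rw [avgOn_top, finrank_intertwiningMap_eq_avg]; rfl
  have h2 := two_mul_avgOn_top hp hf hu
  rw [hT, hB, htop, avgOn_eq_avg_modZ] at h2
  linear_combination -h2

lemma finrank_fixedSpace_nonsplitCartan_of_cuspidal (hp : 2 < p) (hu : ¬ IsSquare u)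
    (hρ : ρ.IsIrreducible) (hdim : Module.finrank ℂ V ≠ 1) (hU : uInvariants ρ = ⊥) :
    Module.finrank ℂ (fixedSpace ρ (nonsplitCartan u)) = 1 := by
  have h1 := finrank_fixedSpace_nonsplitCartan hp hu hρ hdim
  rwa [fixedSpace_borel_eq_bot hU, finrank_bot, add_zero] at h1

open scoped Classical in
/-- The restriction to `T'/Z` of a cuspidal representation omits a pair of characters. -/
theorem exists_omitted_characters (hp : 2 < p) (hu : ¬ IsSquare u)
    (hρ : ρ.IsIrreducible) (hdim : Module.finrank ℂ V ≠ 1) (hU : uInvariants ρ = ⊥) :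
    ∃ θ : modZ (nonsplitCartan u) →* ℂˣ, θ ^ 2 ≠ 1 ∧ ∀ η, (nonsplitMult η ρ : ℂ) =
      1 - (if η = θ then 1 else 0) - (if η = θ⁻¹ then 1 else 0) := by
  have := Fintype.ofFinite (modZ (nonsplitCartan u) →* ℂˣ)
  have hdV := finrank_eq_add_uInvariants hp hρ hdim
  rw [hU, finrank_bot, add_zero] at hdV
  -- With `σ = ρ`, one intertwining map and one Whittaker vector cancel, so the norm on `T'/Z`
  -- equals the dimension.
  have hle := finrank_eigenspace_le_one_of_avg (modZ (nonsplitCartan u)).subtype ρ (by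
    have h := avg_homFun_nonsplit ρ hp hu hρ hdim hU
    rw [finrank_whittaker_eq_one ρ hp hρ hdim, IsIrreducible.finrank_intertwiningMap_self,
      sub_self, zero_add] at h
    exact h)
  have hcard := card_filter_finrank_eq_zero (modZ (nonsplitCartan u)).subtype ρ hle
  rw [card_modZ_nonsplitCartan hp hu] at hcard
  set S := Finset.univ.filter fun η : modZ (nonsplitCartan u) →* ℂˣ => nonsplitMult η ρ = 0 with hS
  have hS2 : S.card = 2 := by
    have : S.card + Module.finrank ℂ V = p + 1 := hcard
    omega
  have hmem : ∀ η, η ∈ S ↔ nonsplitMult η ρ = 0 := fun η => by simp [hS]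
  obtain ⟨θ, hθ⟩ := Finset.card_pos.1 (by omega : 0 < S.card)
  -- The characters with trivial square are `1` and `ω`; both occur, since `V` and its twist by `ω`
  -- have `T'`-invariants.
  have hθ2 : θ ^ 2 ≠ 1 := by
    intro h
    rcases eq_one_or_eq_omegaNonsplit hp hu h with rfl | rfl
    · have := (hmem _).1 hθ
      rw [nonsplitMult_one, finrank_fixedSpace_nonsplitCartan_of_cuspidal hp hu hρ hdim hU] at this
      exact one_ne_zero this
    · have := (hmem _).1 hθ
      rw [nonsplitMult_omega, finrank_fixedSpace_nonsplitCartan_of_cuspidal hp hu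
        (isIrreducible_twist _ hρ) hdim (uInvariants_twist hU)] at this
      exact one_ne_zero this
  have hθ' : θ⁻¹ ∈ S := by rw [hmem, nonsplitMult_inv ρ hp, ← hmem]; exact hθ
  have hne : θ ≠ θ⁻¹ := by
    intro h
    refine hθ2 ?_
    rw [sq]
    nth_rewrite 2 [h]
    exact mul_inv_cancel θ
  have hSeq : S = {θ, θ⁻¹} := by
    symm
    refine Finset.eq_of_subset_of_card_le ?_ ?_
    · intro η hη
      rcases Finset.mem_insert.1 hη with rfl | hη
      · exact hθ
      · rw [Finset.mem_singleton.1 hη]; exact hθ'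
    · rw [hS2, Finset.card_pair hne]
  refine ⟨θ, hθ2, fun η => ?_⟩
  have h0 : nonsplitMult η ρ = 0 ↔ η = θ ∨ η = θ⁻¹ := by
    rw [← hmem, hSeq, Finset.mem_insert, Finset.mem_singleton]
  by_cases h1 : η = θ
  · rw [h0.2 (Or.inl h1), if_pos h1, if_neg (by rw [h1]; exact hne)]; simp
  · by_cases h2 : η = θ⁻¹
    · rw [h0.2 (Or.inr h2), if_neg h1, if_pos h2]; simp
    · have h3 : nonsplitMult η ρ = 1 := by
        have h4 := hle η
        have h5 : nonsplitMult η ρ ≠ 0 := fun h => (h0.1 h).elim h1 h2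
        exact le_antisymm h4 (Nat.one_le_iff_ne_zero.2 h5)
      rw [h3, if_neg h1, if_neg h2]; simp

open scoped Classical in
/-- Intertwining maps from a cuspidal representation. -/
theorem finrank_intertwiningMap_add_nonsplitMult (hp : 2 < p) (hu : ¬ IsSquare u)
    (hρ : ρ.IsIrreducible) (hdim : Module.finrank ℂ V ≠ 1) (hU : uInvariants ρ = ⊥)
    {θ : modZ (nonsplitCartan u) →* ℂˣ} (hθ : ∀ η, (nonsplitMult η ρ : ℂ) =
      1 - (if η = θ then 1 else 0) - (if η = θ⁻¹ then 1 else 0)) :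
    Module.finrank ℂ (IntertwiningMap ρ σ) + nonsplitMult θ σ =
      Module.finrank ℂ (eigenspace (unipotentHom p) (psi p) σ) := by
  have := Fintype.ofFinite (modZ (nonsplitCartan u) →* ℂˣ)
  have h1 := avg_homFun_nonsplit σ hp hu hρ hdim hU
  have h2 := sum_finrank_eigenspace_mul_finrank_eigenspace (modZ (nonsplitCartan u)).subtype ρ σ
  have h3 : (∑ η : modZ (nonsplitCartan u) →* ℂˣ, nonsplitMult η σ : ℂ) = Module.finrank ℂ W := by
    exact_mod_cast sum_finrank_eigenspace (modZ (nonsplitCartan u)).subtype σ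
  simp only [hθ, sub_mul, one_mul, ite_mul, zero_mul, Finset.sum_sub_distrib, Finset.sum_ite_eq',
    Finset.mem_univ, if_true] at h2
  have h6 : (nonsplitMult θ⁻¹ σ : ℂ) = nonsplitMult θ σ := by rw [nonsplitMult_inv σ hp]
  rw [h3, h6] at h2
  have h4 : (Module.finrank ℂ (IntertwiningMap ρ σ) : ℂ) + nonsplitMult θ σ =
      Module.finrank ℂ (eigenspace (unipotentHom p) (psi p) σ) := by
    -- The same average evaluated twice: by Parseval, where `θ` and `θ⁻¹` count equally, and by
    -- comparison of averages over subgroups.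
    have h5 := h2.trans h1
    linear_combination -h5 / 2
  exact_mod_cast h4

lemma finrank_intertwiningMap_prod {G A B D : Type*} [Group G] [Finite G] [AddCommGroup A]
    [Module ℂ A] [FiniteDimensional ℂ A] [AddCommGroup B] [Module ℂ B] [FiniteDimensional ℂ B]
    [AddCommGroup D] [Module ℂ D] [FiniteDimensional ℂ D] (α : Representation ℂ G A)
    (β : Representation ℂ G B) (δ : Representation ℂ G D) :
    Module.finrank ℂ (IntertwiningMap (α.prod β) δ) =
      Module.finrank ℂ (IntertwiningMap α δ) + Module.finrank ℂ (IntertwiningMap β δ) := by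
  have h : (Module.finrank ℂ (IntertwiningMap (α.prod β) δ) : ℂ) =
      Module.finrank ℂ (IntertwiningMap α δ) + Module.finrank ℂ (IntertwiningMap β δ) := by
    rw [finrank_intertwiningMap_eq_avg, finrank_intertwiningMap_eq_avg,
      finrank_intertwiningMap_eq_avg, ← avg_add]
    congr 1
    ext g
    rw [← add_mul]
    congr 1
    exact LinearMap.trace_prodMap' _ _
  exact_mod_cast h

open scoped Classical in
-- By Frobenius reciprocity both sides have equally many maps to every irreducible `τ`, which is the
-- preceding dimension formula.
theorem isCuspidalFor_of_omitted (hp : 2 < p) (hu : ¬ IsSquare u)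
    (hρ : ρ.IsIrreducible) (hdim : Module.finrank ℂ V ≠ 1) (hU : uInvariants ρ = ⊥)
    {θ : modZ (nonsplitCartan u) →* ℂˣ} (hθ : ∀ η, (nonsplitMult η ρ : ℂ) =
      1 - (if η = θ then 1 else 0) - (if η = θ⁻¹ then 1 else 0)) : IsCuspidalFor θ ρ := by
  refine nonempty_equiv_of_finrank_eq _ _ ?_ ?_ <;>
  · intro T _ _ _ τ _
    rw [finrank_intertwiningMap_prod, (indHomEquiv _ _ τ).finrank_eq,
      (indHomEquiv _ _ τ).finrank_eq]
    exact finrank_intertwiningMap_add_nonsplitMult τ hp hu hρ hdim hU hθ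

open scoped Classical in
/-- The invariants of the split normalizer in a cuspidal representation are determined by the
parity of the character. -/
theorem finrank_fixedSpace_splitNormalizer_of_omitted (hp : 2 < p) (hu : ¬ IsSquare u)
    (hρ : ρ.IsIrreducible) (hdim : Module.finrank ℂ V ≠ 1) (hU : uInvariants ρ = ⊥)
    {θ : modZ (nonsplitCartan u) →* ℂˣ} (hθ : ∀ η, (nonsplitMult η ρ : ℂ) =
      1 - (if η = θ then 1 else 0) - (if η = θ⁻¹ then 1 else 0)) :
    Module.finrank ℂ (fixedSpace ρ (splitNormalizer p)) = 1 ↔ ¬ IsEvenChar θ := by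
  have := Fintype.ofFinite (modZ (nonsplitCartan u) →* ℂˣ)
  have h2 := two_ne_zero_of_lt hp
  have hdT := finrank_fixedSpace_splitCartan hp hρ hdim
  rw [fixedSpace_borel_eq_bot hU, finrank_bot, add_zero] at hdT
  have h1 := four_mul_avgOn_splitNormalizer hp (isClassFun_character ρ) hu
  -- This matrix is conjugate to `diag(1, -1)`, where the character vanishes.
  have hn1 : matExt ρ.character !![0, 1; 1, 0] = 0 := by
    have h3 := matExt_sq hp (isClassFun_character ρ) 0 (b := 1) one_ne_zero
    rw [one_pow, zero_add, zero_sub] at h3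
    rw [h3]
    refine matExt_character_diag_of_uInvariants_eq_bot hU fun h => h2 ?_
    linear_combination h
  have hsq : (θ (nonsplitInvolution u hu) : ℂ) ^ 2 = 1 := by
    rw [← Units.val_pow_eq_pow_val, ← map_pow, nonsplitInvolution_sq, map_one]; rfl
  -- The sum of all characters of `T'/Z` vanishes at the involution, so only the omitted `θ` and
  -- `θ⁻¹` remain; they agree there.
  have hnu : matExt ρ.character !![0, u; 1, 0] = -2 * θ (nonsplitInvolution u hu) := by
    have h3 : matExt ρ.character !![0, u; 1, 0] = ρ.character (nonsplitInvolution u hu) := by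
      refine (congrArg (matExt ρ.character) (mat_eq rfl (one_mul u).symm rfl rfl)).trans ?_
      rw [matExt_of_det_ne_zero _ (by
        simpa [Matrix.det_fin_two_of] using ne_zero_of_not_isSquare hu)]
      rfl
    have h4 := sum_finrank_eigenspace_mul (modZ (nonsplitCartan u)).subtype ρ
      (nonsplitInvolution u hu)
    simp only [hθ, sub_mul, one_mul, ite_mul, zero_mul, Finset.sum_sub_distrib, Finset.sum_ite_eq',
      Finset.mem_univ, if_true] at h4
    rw [sum_characters (nonsplitInvolution_ne_one hu)] at h4
    have h5 : (θ⁻¹ (nonsplitInvolution u hu) : ℂ) = θ (nonsplitInvolution u hu) := by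
      rw [MonoidHom.inv_apply, Units.val_inv_eq_inv_val]
      refine inv_eq_of_mul_eq_one_left ?_
      rw [← sq, hsq]
    rw [h3]
    refine h4.symm.trans ?_
    rw [h5]; ring
  rw [← finrank_fixedSpace, ← finrank_fixedSpace, hdT, hn1, hnu] at h1
  rw [isEvenChar_iff_nonsplitInvolution hp hu]
  have h6 : ((θ (nonsplitInvolution u hu) : ℂ) - 1) * (θ (nonsplitInvolution u hu) + 1) = 0 := by
    linear_combination hsq
  push_cast at h1
  constructor
  · intro h e
    rw [h, e, Units.val_one] at h1
    norm_num at h1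
  · intro h
    have h7 := (mul_eq_zero.1 h6).resolve_left fun h0 => h (Units.ext (sub_eq_zero.1 h0))
    have h8 : (Module.finrank ℂ (fixedSpace ρ (splitNormalizer p)) : ℂ) = 1 := by
      linear_combination h1 / 4 - h7 / 2
    exact_mod_cast h8

end Cuspidal

/-! ### Consequences of the isomorphism defining `V_θ`. -/

section CuspidalConverse

variable {p : ℕ} [Fact p.Prime] {u : ZMod p} {V : Type*} [AddCommGroup V] [Module ℂ V]
  {ρ : Representation ℂ (PGLp p) V}

/-- As `G = T' B`, the translates of an eigenvector of `B` by `T'` span. -/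
lemma IsBorelEigenvector.span_nonsplit {v : V} {χ : MulChar (ZMod p) ℂ}
    (h : IsBorelEigenvector ρ χ v) (hu : ¬ IsSquare u) (hρ : ρ.IsIrreducible) (hv : v ≠ 0) :
    Submodule.span ℂ (Set.range fun c => ρ ((modZ (nonsplitCartan u)).subtype c) v) = ⊤ := by
  rw [eq_top_iff, ← span_orbit_eq_top hρ hv, Submodule.span_le]
  rintro _ ⟨g, rfl⟩
  obtain ⟨a, b, c, d, hd, hg⟩ := exists_matRep ρ g
  have hN : a ^ 2 - u * c ^ 2 ≠ 0 := by
    intro h0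
    obtain ⟨rfl, rfl⟩ := (norm_eq_zero_iff hu).1 h0
    exact hd (by ring)
  have hN' : a ^ 2 - c ^ 2 * u ≠ 0 := fun h0 => hN (by linear_combination h0)
  have hdet : Matrix.det !![a, c * u; c, a] ≠ 0 := by
    rw [Matrix.det_fin_two_of]; intro h0; exact hN (by linear_combination h0)
  -- The element of `T'` with the same first column as `g` differs from `g` by a right factor in `B`
  -- with upper left entry `1`.
  have h1 : ρ g v = χ (1 / ((a * d - b * c) / (a ^ 2 - u * c ^ 2))) •
      ρ ((modZ (nonsplitCartan u)).subtype (nonsplitElt a c hN)) v := by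
    change _ = _ • ρ (pglOf _ _) v
    rw [hg, ← matRep_of_det_ne_zero ρ hdet, ← map_smul,
      ← h.borel one_ne_zero (div_ne_zero hd hN) ((a * b - c * d * u) / (a ^ 2 - u * c ^ 2)),
      matRep_apply_apply]
    congr 2
    refine mat_eq ?_ ?_ ?_ ?_ <;> field_simp <;> ring
  change ρ g v ∈ _
  rw [h1]
  exact Submodule.smul_mem _ _ (Submodule.subset_span ⟨_, rfl⟩)

variable [FiniteDimensional ℂ V]

/-- Counting maps from both sides of the isomorphism into `ρ` gives `1 + m_θ = 1`. -/
lemma nonsplitMult_eq_zero_of_isCuspidalFor (hp : 2 < p) (hρ : ρ.IsIrreducible)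
    (hdim : Module.finrank ℂ V ≠ 1) {θ : modZ (nonsplitCartan u) →* ℂˣ}
    (h : IsCuspidalFor θ ρ) : nonsplitMult θ ρ = 0 := by
  obtain ⟨e⟩ := h
  have h1 : (Module.finrank ℂ (IntertwiningMap (ρ.prod (ind (modZ (nonsplitCartan u)).subtype
      (charRep θ))) ρ) : ℂ) =
      Module.finrank ℂ (IntertwiningMap (ind (unipotentHom p) (charRep (psi p))) ρ) := by
    rw [finrank_intertwiningMap_eq_avg, finrank_intertwiningMap_eq_avg, char_iso e]
  have h2 : Module.finrank ℂ (IntertwiningMap (ρ.prod (ind (modZ (nonsplitCartan u)).subtype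
      (charRep θ))) ρ) =
      Module.finrank ℂ (IntertwiningMap (ind (unipotentHom p) (charRep (psi p))) ρ) := by
    exact_mod_cast h1
  rw [finrank_intertwiningMap_prod, (indHomEquiv _ _ ρ).finrank_eq, (indHomEquiv _ _ ρ).finrank_eq,
    finrank_whittaker_eq_one ρ hp hρ hdim, IsIrreducible.finrank_intertwiningMap_self] at h2
  exact Nat.add_left_cancel h2

/-- A Borel eigenvector would make the restriction to `T'/Z` multiplicity free. Omitting `θ` and
`θ⁻¹` then bounds the dimension by `p - 1`, whereas nonzero `V^U` makes it at least `p`. -/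
lemma uInvariants_eq_bot_of_isCuspidalFor (hp : 2 < p) (hu : ¬ IsSquare u) (hρ : ρ.IsIrreducible)
    (hdim : Module.finrank ℂ V ≠ 1) {θ : modZ (nonsplitCartan u) →* ℂˣ} (hθ : θ ^ 2 ≠ 1)
    (h : IsCuspidalFor θ ρ) : uInvariants ρ = ⊥ := by
  classical
  have := Fintype.ofFinite (modZ (nonsplitCartan u) →* ℂˣ)
  by_contra hU
  obtain ⟨v, χ, hv, hχ⟩ := IsBorelEigenvector.exists_of_uInvariants_ne_bot hp hU
  have hle := finrank_eigenspace_le_one_of_span (modZ (nonsplitCartan u)).subtype ρ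
    (hχ.span_nonsplit hu hρ hv)
  have hcard := card_filter_finrank_eq_zero (modZ (nonsplitCartan u)).subtype ρ hle
  rw [card_modZ_nonsplitCartan hp hu] at hcard
  have h0 := nonsplitMult_eq_zero_of_isCuspidalFor hp hρ hdim h
  have hne : θ ≠ θ⁻¹ := by
    intro h
    refine hθ ?_
    rw [sq]
    nth_rewrite 2 [h]
    exact mul_inv_cancel θ
  have hsub : ({θ, θ⁻¹} : Finset (modZ (nonsplitCartan u) →* ℂˣ)) ⊆
      Finset.univ.filter fun η => nonsplitMult η ρ = 0 := by
    intro η hη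
    refine Finset.mem_filter.2 ⟨Finset.mem_univ _, ?_⟩
    rcases Finset.mem_insert.1 hη with rfl | hη
    · exact h0
    · rw [Finset.mem_singleton.1 hη, nonsplitMult_inv ρ hp, h0]
  have h2 := Finset.card_le_card hsub
  rw [Finset.card_pair hne] at h2
  have h3 := finrank_eq_add_uInvariants hp hρ hdim
  have h4 : 1 ≤ Module.finrank ℂ (uInvariants ρ) := Submodule.one_le_finrank_iff.2 hU
  have h5 : (Finset.univ.filter fun η : modZ (nonsplitCartan u) →* ℂˣ =>
    nonsplitMult η ρ = 0).card + Module.finrank ℂ V = p + 1 := hcard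
  omega

/-- The character `θ` is omitted, so it is one of the pair `ξ`, `ξ⁻¹`, whose members have the same
parity. -/
theorem finrank_fixedSpace_splitNormalizer_of_isCuspidalFor (hp : 2 < p) (hu : ¬ IsSquare u)
    (hρ : ρ.IsIrreducible) (hdim : Module.finrank ℂ V ≠ 1)
    {θ : modZ (nonsplitCartan u) →* ℂˣ} (hθ : θ ^ 2 ≠ 1) (h : IsCuspidalFor θ ρ) :
    Module.finrank ℂ (fixedSpace ρ (splitNormalizer p)) = 1 ↔ ¬ IsEvenChar θ := by
  classical
  have hU := uInvariants_eq_bot_of_isCuspidalFor hp hu hρ hdim hθ h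
  obtain ⟨ξ, -, hξ⟩ := exists_omitted_characters hp hu hρ hdim hU
  rw [finrank_fixedSpace_splitNormalizer_of_omitted hp hu hρ hdim hU hξ,
    isEvenChar_iff_nonsplitInvolution hp hu, isEvenChar_iff_nonsplitInvolution hp hu]
  have h0 := hξ θ
  rw [nonsplitMult_eq_zero_of_isCuspidalFor hp hρ hdim h] at h0
  by_cases h1 : θ = ξ
  · rw [h1]
  · by_cases h2 : θ = ξ⁻¹
    · rw [h2, MonoidHom.inv_apply, inv_eq_one]
    · rw [if_neg h1, if_neg h2] at h0
      norm_num at h0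

end CuspidalConverse

end CartanInvariants

end

open CartanInvariants in
theorem proposition2p1 (p : ℕ) [Fact p.Prime] (hp : 2 < p) (u : ZMod p) (hu : ¬ IsSquare u)
    {V : Type*} [AddCommGroup V] [Module ℂ V] (ρ : Representation ℂ (PGLp p) V)
    (hirr : ρ.IsIrreducible) (hdim : Module.finrank ℂ V ≠ 1) :
    (Nonempty (ρ.Equiv (steinberg p)) →
      Module.finrank ℂ (fixedSpace ρ (splitCartan p)) = 2 ∧
      Module.finrank ℂ (fixedSpace ρ (splitNormalizer p)) = 1 ∧
      Module.finrank ℂ (fixedSpace ρ (nonsplitCartan u)) = 0 ∧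
      Module.finrank ℂ (fixedSpace ρ (nonsplitNormalizer u)) = 0) ∧
    (¬ Nonempty (ρ.Equiv (steinberg p)) →
      Module.finrank ℂ (fixedSpace ρ (splitCartan p)) = 1 ∧
      Module.finrank ℂ (fixedSpace ρ (nonsplitCartan u)) = 1 ∧
      Module.finrank ℂ (fixedSpace ρ (splitNormalizer p)) =
        Module.finrank ℂ (fixedSpace ρ (nonsplitNormalizer u)) ∧
      Module.finrank ℂ (fixedSpace ρ (nonsplitNormalizer u)) ≤ 1 ∧
      ((Module.finrank ℂ (fixedSpace ρ (splitNormalizer p)) = 1 ∧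
          Module.finrank ℂ (fixedSpace ρ (nonsplitNormalizer u)) = 1) ↔
        (∃ μ : modZ (borel p) →* ℂˣ, μ ^ 2 ≠ 1 ∧ IsEvenChar (restrictToTorus μ) ∧
          Nonempty (ρ.Equiv (principalSeries μ))) ∨
        (∃ θ : modZ (nonsplitCartan u) →* ℂˣ, θ ^ 2 ≠ 1 ∧ ¬ IsEvenChar θ ∧
          IsCuspidalFor θ ρ) ∨
        (Nonempty (ρ.Equiv (twistedSteinberg p)) ∧ p ≡ 1 [MOD 4]))) := by
  have := finiteDimensional_of_isIrreducible hirr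
  refine ⟨finrank_fixedSpace_of_equiv_steinberg hp hu hirr hdim, fun hSt => ?_⟩
  obtain ⟨hT, hT', hN, hN'⟩ := finrank_fixedSpace_of_not_equiv_steinberg hp hu hirr hdim hSt
  refine ⟨hT, hT', hN, hN', ?_⟩
  -- The dimensions for `N` and `N'` agree, so only `N` remains, and the cases are split by whether
  -- `V^U` vanishes.
  rw [← hN, and_self]
  constructor
  · intro h
    by_cases hU : uInvariants ρ = ⊥
    · obtain ⟨θ, hθ, hmult⟩ := exists_omitted_characters hp hu hirr hdim hU
      exact Or.inr (Or.inl ⟨θ, hθ,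
        (finrank_fixedSpace_splitNormalizer_of_omitted hp hu hirr hdim hU hmult).1 h,
        isCuspidalFor_of_omitted hp hu hirr hdim hU hmult⟩)
    · exact (equiv_of_finrank_fixedSpace_splitNormalizer hp hu hirr hdim hSt hU h).imp id Or.inr
  · rintro (⟨μ, -, he, hμ⟩ | ⟨θ, hθ, he, hc⟩ | h)
    · exact finrank_fixedSpace_splitNormalizer_of_principal hp hu hirr hdim hSt
        (Or.inl ⟨μ, he, hμ⟩)
    · exact (finrank_fixedSpace_splitNormalizer_of_isCuspidalFor hp hu hirr hdim hθ hc).2 he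
    · exact finrank_fixedSpace_splitNormalizer_of_principal hp hu hirr hdim hSt (Or.inr h)
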